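/- Let $\mathbb{k}$ be a field of characteristic $0$ and $n\ge 0$. **Data.** Let $N$ be the group of formal diffeomorphisms $\psi$ of $n$-space with $\psi(0)=0$, $\psi'(0)=\mathrm{Id}$ (product: composition), and let $\mathcal F=\mathcal F(N)$ be the Hopf algebra of its regular functions, i.e. the polynomial algebra on the jet coordinates $\alpha^i_J(\psi)=\partial^J\psi^i(0)$, $|J|\ge 2$, with $\Delta f(\psi_1,\psi_2)=f(\psi_1\psi_2)$, $\varepsilon f=f(\mathrm{Id})$, $Sf(\psi)=f(\psi^{-1})$. Put $\eta^i_{jk}(\psi)=\partial_j\partial_k\psi^i(0)$. Let $\mathfrak s=g\ell_n^{\rm aff}$ have basis $X_k,Y_i^j$ with $[Y_i^j,X_k]=\delta^j_kX_i$, $[X_k,X_l]=0$, $[Y_i^j,Y_p^q]=\delta^j_pY_i^q-\delta_i^qY_p^j$; $Z=(v,A)=\sum v^kX_k+\sum A^i_jY_i^j$ corresponds to the affine map germ $x\mapsto v+Ax$. Let $X_{\langle0\rangle}\otimes X_{\langle1\rangle}$ denote the right coaction $X_k\mapsto X_k\otimes1+\sum Y_i^j\otimes\eta^i_{jk}$,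 $Y_i^j\mapsto Y_i^j\otimes1$ of $\mathcal F$ on $\mathfrak s$, and $\eta\mapsto\eta_{\langle-1\rangle}\otimes\eta_{\langle0\rangle}$ the left coaction on $\wedge^*\mathfrak s^*$ that is multiplicative and is given on the dual basis by $\theta^k\mapsto1\otimes\theta^k$, $\theta^i_j\mapsto1\otimes\theta^i_j+\sum_k\eta^i_{jk}\otimes\theta^k$. $\mathfrak s$ acts on $\mathcal F$ by the derivations $(Z\triangleright f)(\psi)=\frac{d}{dt}\big|_{0}f(\psi\triangleleft\exp tZ)$, where $\psi\circ g=(\psi\triangleright g)\circ(\psi\triangleleft g)$ with $\psi\triangleright g$ affine and $\psi\triangleleft g\in N$; it acts on $\mathcal F^{\otimes q}$ by $$X\bullet(f^1\otimes\cdots\otimes f^q)=\sum_{i}f^1\otimes\cdots\otimes X_{\langle0\rangle}\triangleright f^i\otimes X_{\langle1\rangle}\cdot(f^{i+1}\otimes\cdots\otimes f^q),$$ where $h\cdot\tilde g=\Delta^{(r)}(h)\,\tilde g$ for $\tilde g\in\mathcal F^{\otimes r}$ ($\Delta^{(0)}=\varepsilon$). Let $\Omega^{\le1}=\Omega^0\oplus\Omega^1$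 be the formal differential forms of degree $\le1$ in $x^1,\dots,x^n$. $Z=(v,A)\in\mathfrak s$ acts on $\Omega^{\le1}$ by minus the Lie derivative along the vector field $x\mapsto v+Ax$ (the derivative of push-forward by $\exp tZ$), and $\mathcal F$ coacts by $\omega_{\langle0\rangle}\,\omega_{\langle1\rangle}(\psi)=(\psi^{-1})^*\omega$. Tensor products with $\Omega$ are completed: elements of $\Omega^{\le1}\otimes\mathcal F^{\otimes q}$ are forms whose coefficients are power series over $\mathcal F^{\otimes q}$. **The bicomplex.** $C^{p,q}(\Omega^{\bullet})=\Omega^{\bullet}\otimes\wedge^p\mathfrak s^*\otimes\mathcal F^{\otimes q}$, for $\Omega^\bullet=\Omega^{\le1},\Omega^0,\Omega^1$, with $$d_{\rm CE}(\omega\otimes\eta\otimes\tilde f)=\omega\otimes d_{\rm DR}\eta\otimes\tilde f-\sum_i X_i\cdot\omega\otimes v^i\wedge\eta\otimes\tilde f-\sum_i\omega\otimes v^i\wedge\eta\otimes X_i\bullet\tilde f,$$ where $X_i$ runs through a basis of $\mathfrak s$, $v^i$ is the dual basis and $d_{\rm DR}$ is the graded derivation of $\wedge^*\mathfrak s^*$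 with $(d_{\rm DR}\theta)(Z,W)=\theta([Z,W])$, and $$b_N^*(\omega\otimes\eta\otimes\tilde f)=\omega\otimes\eta\otimes1\otimes\tilde f+\sum_{i=1}^q(-1)^i\omega\otimes\eta\otimes\Delta_i(\tilde f)+(-1)^{q+1}\omega_{\langle0\rangle}\otimes\eta_{\langle0\rangle}\otimes\tilde f\otimes S(\omega_{\langle1\rangle})\eta_{\langle-1\rangle},$$ where $\Delta_i$ applies $\Delta$ to the $i$-th factor. The cup product $C^{p,q}(\Omega^0)\times C^{p',q'}(\Omega^1)\to C^{p+p',q+q'}(\Omega^1)$ is $$(a\otimes\eta\otimes\tilde f)\cup(\omega\otimes\zeta\otimes\tilde g)=a_{\langle0\rangle}\omega\otimes\eta_{\langle0\rangle}\wedge\zeta\otimes\tilde f\otimes S(a_{\langle1\rangle})\eta_{\langle-1\rangle}\cdot\tilde g .$$ **Theorem 4.7.** The map $d_{\rm CE}+(-1)^pb_N^*$ sends $C^{p,q}(\Omega^{\le1})$ to $C^{p+1,q}(\Omega^{\le1})\oplus C^{p,q+1}(\Omega^{\le1})$ (with $d_{\rm CE}$ giving the first and $b_N^*$ the second component), and it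 is a graded derivation for the bilinear product $x*y=(-1)^{qp'}\,x\cup y$: for all $x\in C^{p,q}(\Omega^0)$ and $y\in C^{p',q'}(\Omega^1)$ one has $x*y\in C^{p+p',q+q'}(\Omega^1)$ and $$(d_{\rm CE}+(-1)^{p+p'}b_N^*)(x*y)=\big((d_{\rm CE}+(-1)^pb_N^*)x\big)*y+(-1)^{p+q}\,x*\big((d_{\rm CE}+(-1)^{p'}b_N^*)y\big).$$ -/

import Mathlib

noncomputable section

namespace HopfCyclic

open scoped TensorProduct Matrix

universe u v w

/-- Formal power series in `x¹, …, xⁿ` with coefficients in `R`. -/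
abbrev PS (n : ℕ) (R : Type v) : Type v := MvPowerSeries (Fin n) R

/-- The group `N(R)` of formal diffeomorphisms `ψ` of `n`-space with coefficients in `R` such that
`ψ(0) = 0` and `ψ'(0) = Id`. -/
@[ext] structure Diffeo (n : ℕ) (R : Type v) [CommRing R] where
  toFun : Fin n → PS n R
  value_zero : ∀ i, MvPowerSeries.constantCoeff (toFun i) = 0
  deriv_zero : ∀ i j, MvPowerSeries.coeff (Finsupp.single j 1) (toFun i) = if i = j then 1 else 0

namespace Diffeo

variable {n : ℕ} {R : Type v} {A : Type w} [CommRing R] [CommRing A]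

theorem hasSubst (φ : Diffeo n R) : MvPowerSeries.HasSubst φ.toFun :=
  MvPowerSeries.hasSubst_of_constantCoeff_zero φ.value_zero

theorem two_le_order_sub (φ : Diffeo n R) (i : Fin n) :
    2 ≤ (φ.toFun i - MvPowerSeries.X i).order := by
  refine MvPowerSeries.le_order (n := 2) fun d hd => ?_
  have hd' : d.degree < 2 := by exact_mod_cast hd
  rcases Nat.lt_succ_iff_lt_or_eq.1 hd' with h | h
  · have h0 : d = 0 := (Finsupp.degree_eq_zero_iff d).1 (Nat.lt_one_iff.1 h)
    subst h0
    simp [φ.value_zero]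
  · obtain ⟨j, rfl⟩ := (Finsupp.sum_eq_one_iff d).1 h
    simp only [map_sub, φ.deriv_zero, MvPowerSeries.coeff_index_single_X]
    rw [sub_eq_zero]
    congr 1
    exact propext eq_comm

/-- Recognising an element of `N(R)` by the order of `ψ - x`. -/
def mk' (f : Fin n → PS n R) (h : ∀ i, 2 ≤ (f i - MvPowerSeries.X i).order) : Diffeo n R where
  toFun := f
  value_zero i := by
    have := MvPowerSeries.coeff_of_lt_order (d := 0) (f := f i - MvPowerSeries.X i)
      (lt_of_lt_of_le (by simp) (h i))
    simpa using this
  deriv_zero i j := by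
    have := MvPowerSeries.coeff_of_lt_order (d := Finsupp.single j 1)
      (f := f i - MvPowerSeries.X i) (lt_of_lt_of_le (by simp) (h i))
    rw [map_sub, sub_eq_zero, MvPowerSeries.coeff_index_single_X] at this
    rw [this]
    congr 1
    exact propext eq_comm

theorem one_le_order (φ : Diffeo n R) (i : Fin n) : 1 ≤ (φ.toFun i).order :=
  MvPowerSeries.one_le_order_iff_constCoeff_eq_zero.2 (φ.value_zero i)

theorem le_order_comp (φ : Diffeo n R) (f : PS n R) :
    f.order ≤ (MvPowerSeries.subst φ.toFun f).order := by
  refine le_trans ?_ (MvPowerSeries.le_order_subst φ.hasSubst f)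
  calc f.order = 1 * f.order := (one_mul _).symm
    _ ≤ _ := mul_le_mul_left (le_iInf fun i => φ.one_le_order i) _

/-- The identity. -/
instance : One (Diffeo n R) := ⟨mk' MvPowerSeries.X fun i => by simp⟩

/-- Composition `φ * ψ = φ ∘ ψ`. -/
instance : Mul (Diffeo n R) :=
  ⟨fun φ ψ => mk' (fun i => MvPowerSeries.subst ψ.toFun (φ.toFun i)) fun i => by
    have h1 : MvPowerSeries.subst ψ.toFun (φ.toFun i) - MvPowerSeries.X i =
        MvPowerSeries.subst ψ.toFun (φ.toFun i - MvPowerSeries.X i) +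
          (ψ.toFun i - MvPowerSeries.X i) := by
      rw [MvPowerSeries.subst_sub ψ.hasSubst, MvPowerSeries.subst_X ψ.hasSubst]
      abel
    rw [h1]
    exact le_trans (le_min ((φ.two_le_order_sub i).trans (ψ.le_order_comp _))
      (ψ.two_le_order_sub i)) MvPowerSeries.min_order_le_add⟩

@[simp] theorem one_toFun (i : Fin n) : (1 : Diffeo n R).toFun i = MvPowerSeries.X i := rfl

@[simp] theorem mul_toFun (φ ψ : Diffeo n R) (i : Fin n) :
    (φ * ψ).toFun i = MvPowerSeries.subst ψ.toFun (φ.toFun i) := rfl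

theorem order_prod_sub (φ : Diffeo n R) (d : Fin n →₀ ℕ) :
    ((d.degree + 1 : ℕ) : ℕ∞) ≤ ((d.prod fun s e => φ.toFun s ^ e) -
      d.prod fun s e => (MvPowerSeries.X s : PS n R) ^ e).order := by
  have hX : ∀ d : Fin n →₀ ℕ,
      (d.degree : ℕ∞) ≤ (d.prod fun s e => (MvPowerSeries.X s : PS n R) ^ e).order := by
    intro d
    rw [← MvPowerSeries.monomial_one_eq]
    refine MvPowerSeries.le_order fun m hm => ?_
    rw [MvPowerSeries.coeff_monomial, if_neg]
    rintro rfl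
    exact lt_irrefl _ hm
  induction d using Finsupp.induction_linear with
  | zero => simp
  | add f g hf hg =>
    have e1 : ∀ a : Fin n → PS n R, ((f + g).prod fun s e => a s ^ e) =
        (f.prod fun s e => a s ^ e) * g.prod fun s e => a s ^ e := fun a =>
      Finsupp.prod_add_index' (fun _ => pow_zero _) (fun _ _ _ => pow_add _ _ _)
    rw [e1, e1]
    set a := f.prod fun s e => φ.toFun s ^ e
    set b := g.prod fun s e => φ.toFun s ^ e
    set a' := f.prod fun s e => (MvPowerSeries.X s : PS n R) ^ e with ha'
    set b' := g.prod fun s e => (MvPowerSeries.X s : PS n R) ^ e with hb'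
    have ha : (f.degree : ℕ∞) ≤ a.order := by
      have : a = (a - a') + a' := by abel
      rw [this]
      refine le_trans (le_min (le_trans ?_ hf) (hX f)) MvPowerSeries.min_order_le_add
      exact_mod_cast Nat.le_succ _
    have : a * b - a' * b' = a * (b - b') + (a - a') * b' := by ring
    rw [this]
    refine le_trans (le_min ?_ ?_) MvPowerSeries.min_order_le_add
    · refine le_trans ?_ MvPowerSeries.le_order_mul
      refine le_trans (le_of_eq ?_) (add_le_add ha hg)
      rw [map_add]; push_cast; ring
    · refine le_trans ?_ MvPowerSeries.le_order_mul
      refine le_trans (le_of_eq ?_) (add_le_add hf (hX g))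
      rw [map_add]; push_cast; ring
  | single i k =>
    have e1 : ∀ (k : ℕ) (a : Fin n → PS n R),
        ((Finsupp.single i k).prod fun s e => a s ^ e) = a i ^ k :=
      fun k a => Finsupp.prod_single_index (pow_zero _)
    rw [e1, e1, Finsupp.degree_single]
    induction k with
    | zero => simp
    | succ k ih =>
      have : φ.toFun i ^ (k + 1) - (MvPowerSeries.X i : PS n R) ^ (k + 1) =
          φ.toFun i * (φ.toFun i ^ k - (MvPowerSeries.X i : PS n R) ^ k) +
            (φ.toFun i - MvPowerSeries.X i) * (MvPowerSeries.X i : PS n R) ^ k := by ring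
      rw [this]
      refine le_trans (le_min ?_ ?_) MvPowerSeries.min_order_le_add
      · refine le_trans ?_ MvPowerSeries.le_order_mul
        refine le_trans (le_of_eq ?_) (add_le_add (φ.one_le_order i) ih)
        push_cast; ring
      · refine le_trans ?_ MvPowerSeries.le_order_mul
        have h := hX (Finsupp.single i k)
        rw [e1, Finsupp.degree_single] at h
        refine le_trans (le_of_eq ?_) (add_le_add (φ.two_le_order_sub i) h)
        push_cast; ring

/-- Composition with an element of `N(R)` only changes terms of higher order. -/
theorem order_sub_comp (φ : Diffeo n R) (f : PS n R) {d : ℕ} (hf : (d : ℕ∞) ≤ f.order) :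
    ((d + 1 : ℕ) : ℕ∞) ≤ (f - MvPowerSeries.subst φ.toFun f).order := by
  refine MvPowerSeries.le_order fun e he => ?_
  have he' : e.degree < d + 1 := by exact_mod_cast he
  have hX := congrArg (MvPowerSeries.coeff e)
    (congrFun (MvPowerSeries.subst_self (σ := Fin n) (R := R)) f)
  rw [id, MvPowerSeries.coeff_subst MvPowerSeries.HasSubst.X] at hX
  rw [map_sub, ← hX, MvPowerSeries.coeff_subst φ.hasSubst, sub_eq_zero]
  refine finsum_congr fun m => ?_
  by_cases hm : m.degree < d
  · rw [MvPowerSeries.coeff_of_lt_order (lt_of_lt_of_le (by exact_mod_cast hm) hf),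
      zero_smul, zero_smul]
  · congr 1
    have := MvPowerSeries.coeff_of_lt_order (d := e)
      (lt_of_lt_of_le (b := ((m.degree + 1 : ℕ) : ℕ∞)) (by exact_mod_cast (by omega))
        (φ.order_prod_sub m))
    rw [map_sub, sub_eq_zero] at this
    exact this.symm

/-- `f ↦ f - f ∘ φ`. -/
def defect (φ : Diffeo n R) : Module.End R (PS n R) :=
  1 - (MvPowerSeries.substAlgHom φ.hasSubst).toLinearMap

theorem defect_apply (φ : Diffeo n R) (f : PS n R) :
    φ.defect f = f - MvPowerSeries.subst φ.toFun f := by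
  simp [defect]

theorem le_order_defect_pow (φ : Diffeo n R) (f : PS n R) {d : ℕ} (hf : (d : ℕ∞) ≤ f.order)
    (k : ℕ) : ((d + k : ℕ) : ℕ∞) ≤ ((φ.defect ^ k) f).order := by
  induction k with
  | zero => simpa using hf
  | succ k ih =>
    rw [pow_succ', Module.End.mul_apply, defect_apply]
    exact φ.order_sub_comp _ ih

/-- The series `f ∘ φ⁻¹`, as the (coefficientwise finite) Neumann series `∑ₖ (1 - φ^*)ᵏ f`. -/
def precompInv (φ : Diffeo n R) (f : PS n R) : PS n R :=
  fun e => MvPowerSeries.coeff e (∑ k ∈ Finset.range (e.degree + 1), (φ.defect ^ k) f)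

theorem order_precompInv_sub (φ : Diffeo n R) (f : PS n R) {d : ℕ} (hf : (d : ℕ∞) ≤ f.order)
    (K : ℕ) : ((d + K : ℕ) : ℕ∞) ≤
      (φ.precompInv f - ∑ k ∈ Finset.range K, (φ.defect ^ k) f).order := by
  refine MvPowerSeries.le_order fun e he => ?_
  have he' : e.degree < d + K := by exact_mod_cast he
  have hz : ∀ k, e.degree < d + k → MvPowerSeries.coeff e ((φ.defect ^ k) f) = 0 := fun k hk =>
    MvPowerSeries.coeff_of_lt_order
      (lt_of_lt_of_le (by exact_mod_cast hk) (φ.le_order_defect_pow f hf k))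
  have h1 : MvPowerSeries.coeff e (φ.precompInv f) =
      MvPowerSeries.coeff e (∑ k ∈ Finset.range (e.degree + 1), (φ.defect ^ k) f) := rfl
  rw [map_sub, h1, map_sum, map_sum, sub_eq_zero]
  rcases le_total (e.degree + 1) K with h | h
  · refine Finset.sum_subset (Finset.range_mono h) fun k _ hk => hz k ?_
    rw [Finset.mem_range] at hk
    omega
  · refine (Finset.sum_subset (Finset.range_mono h) fun k _ hk => hz k ?_).symm
    rw [Finset.mem_range] at hk
    omega

theorem subst_precompInv (φ : Diffeo n R) (f : PS n R) :
    MvPowerSeries.subst φ.toFun (φ.precompInv f) = f := by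
  rw [← sub_eq_zero, ← MvPowerSeries.order_eq_top_iff, ENat.eq_top_iff_forall_ge]
  intro K
  have hT : ∀ g : PS n R, MvPowerSeries.subst φ.toFun g = g - φ.defect g := by
    intro g
    rw [defect_apply]; abel
  have h1 : MvPowerSeries.subst φ.toFun (∑ k ∈ Finset.range K, (φ.defect ^ k) f) =
      f - (φ.defect ^ K) f := by
    induction K with
    | zero =>
      rw [Finset.sum_range_zero, pow_zero, Module.End.one_apply, sub_self,
        ← MvPowerSeries.coe_substAlgHom φ.hasSubst, map_zero]
    | succ K ih =>
      rw [Finset.sum_range_succ, MvPowerSeries.subst_add φ.hasSubst, ih, hT ((φ.defect ^ K) f),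
        pow_succ', Module.End.mul_apply]
      abel
  have h2 : MvPowerSeries.subst φ.toFun (φ.precompInv f) - f =
      MvPowerSeries.subst φ.toFun
        (φ.precompInv f - ∑ k ∈ Finset.range K, (φ.defect ^ k) f) + -((φ.defect ^ K) f) := by
    rw [MvPowerSeries.subst_sub φ.hasSubst, h1]
    abel
  rw [h2]
  have hf : ((0 : ℕ) : ℕ∞) ≤ f.order := by simp
  refine le_trans (le_min ?_ ?_) MvPowerSeries.min_order_le_add
  · refine le_trans ?_ (φ.le_order_comp _)
    have h3 := φ.order_precompInv_sub f hf K
    rwa [Nat.zero_add] at h3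
  · rw [MvPowerSeries.order_neg]
    have h3 := φ.le_order_defect_pow f hf K
    rwa [Nat.zero_add] at h3

/-- The compositional inverse. -/
instance : Inv (Diffeo n R) :=
  ⟨fun φ => mk' (fun i => φ.precompInv (MvPowerSeries.X i)) fun i => by
    have h : ((1 : ℕ) : ℕ∞) ≤ (MvPowerSeries.X i : PS n R).order := by
      have := MvPowerSeries.one_le_order_iff_constCoeff_eq_zero
        (f := (MvPowerSeries.X i : PS n R))
      exact this.2 (MvPowerSeries.constantCoeff_X i)
    have h2 := φ.order_precompInv_sub (MvPowerSeries.X i) h 1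
    rw [Finset.sum_range_one, pow_zero, Module.End.one_apply] at h2
    exact h2⟩

instance : Group (Diffeo n R) :=
  Group.ofLeftAxioms
    (fun φ ψ χ => by
      ext1; funext i
      simp only [mul_toFun]
      rw [MvPowerSeries.subst_comp_subst_apply ψ.hasSubst χ.hasSubst]
      rfl)
    (fun φ => by
      ext1; funext i
      exact MvPowerSeries.subst_X φ.hasSubst i)
    (fun φ => by
      ext1; funext i
      exact φ.subst_precompInv _)

/-- Functoriality of `N(R)` in `R`. -/
def map (g : R →+* A) : Diffeo n R →* Diffeo n A where
  toFun φ :=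
    { toFun := fun i => MvPowerSeries.map g (φ.toFun i)
      value_zero := fun i => by simp [φ.value_zero]
      deriv_zero := fun i j => by
        rw [MvPowerSeries.coeff_map, φ.deriv_zero]
        split_ifs <;> simp }
  map_one' := by
    ext1; funext i
    simp
  map_mul' φ ψ := by
    ext1; funext i
    exact MvPowerSeries.map_subst ψ.hasSubst _

@[simp] theorem map_toFun (g : R →+* A) (φ : Diffeo n R) (i : Fin n) :
    (map g φ).toFun i = MvPowerSeries.map g (φ.toFun i) := rfl

end Diffeo

/-! ### The Hopf algebra `F(N)` -/

/-- Indices `(i, J)`, `|J| ≥ 2`, of the jet coordinates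
`α^i_J(ψ) = ∂^J ψ^i (0)` on `N`. -/
abbrev JetIndex (n : ℕ) : Type := {a : Fin n × (Fin n →₀ ℕ) // 2 ≤ a.2.degree}

/-- The multi-index factorial `J!`. -/
def multiFactorial {n : ℕ} (J : Fin n →₀ ℕ) : ℕ := ∏ i, (J i).factorial

theorem multiFactorial_ne_zero {n : ℕ} (J : Fin n →₀ ℕ) : multiFactorial J ≠ 0 :=
  Finset.prod_ne_zero_iff.2 fun _ _ => Nat.factorial_ne_zero _

/-- The algebra `F(N)` of regular functions on `N`: polynomials in the jet coordinates. -/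
def FN (n : ℕ) (𝕜 : Type u) [Field 𝕜] : Type u := MvPolynomial (JetIndex n) 𝕜

section

variable (n : ℕ) (𝕜 : Type u) [Field 𝕜]

instance : CommRing (FN n 𝕜) := inferInstanceAs (CommRing (MvPolynomial (JetIndex n) 𝕜))
instance : Algebra 𝕜 (FN n 𝕜) := inferInstanceAs (Algebra 𝕜 (MvPolynomial (JetIndex n) 𝕜))

end

namespace FN

variable {n : ℕ} {𝕜 : Type u} [Field 𝕜] {A : Type v} [CommRing A] [Algebra 𝕜 A]
  {B : Type w} [CommRing B] [Algebra 𝕜 B]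

/-- The jet coordinate `α^i_J`. -/
def coord (a : JetIndex n) : FN n 𝕜 := (MvPolynomial.X a : MvPolynomial (JetIndex n) 𝕜)

/-- Evaluation `f ↦ f(ψ)` at a point `ψ ∈ N(A)`: `α^i_J(ψ) = ∂^J ψ^i(0)`. -/
def eval (ψ : Diffeo n A) : FN n 𝕜 →ₐ[𝕜] A :=
  MvPolynomial.aeval (R := 𝕜) fun a : JetIndex n =>
    multiFactorial a.1.2 • MvPowerSeries.coeff a.1.2 (ψ.toFun a.1.1)

theorem eval_coord (ψ : Diffeo n A) (a : JetIndex n) :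
    eval (𝕜 := 𝕜) ψ (coord a) =
      multiFactorial a.1.2 • MvPowerSeries.coeff a.1.2 (ψ.toFun a.1.1) :=
  MvPolynomial.aeval_X _ a

theorem algHom_ext {f g : FN n 𝕜 →ₐ[𝕜] A} (h : ∀ a, f (coord a) = g (coord a)) : f = g :=
  MvPolynomial.algHom_ext h

theorem comp_eval (g : A →ₐ[𝕜] B) (ψ : Diffeo n A) :
    g.comp (eval (𝕜 := 𝕜) ψ) = eval (Diffeo.map g.toRingHom ψ) :=
  algHom_ext fun a => by
    rw [AlgHom.comp_apply, eval_coord, eval_coord, map_nsmul, Diffeo.map_toFun,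
      MvPowerSeries.coeff_map]
    rfl

variable (n 𝕜) in
/-- The higher order part of the universal point of `N`. -/
def univTail (i : Fin n) : PS n (FN n 𝕜) := fun J =>
  if h : 2 ≤ J.degree then ((multiFactorial J : 𝕜)⁻¹) • coord ⟨(i, J), h⟩ else 0

theorem coeff_univTail (i : Fin n) (J : Fin n →₀ ℕ) :
    MvPowerSeries.coeff J (univTail n 𝕜 i) =
      if h : 2 ≤ J.degree then ((multiFactorial J : 𝕜)⁻¹) • coord ⟨(i, J), h⟩ else 0 := rfl

variable (n 𝕜) in
/-- The universal point of `N`, whose Taylor coefficients are the functions `α^i_J / J!`. -/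
def univ : Diffeo n (FN n 𝕜) :=
  Diffeo.mk' (fun i => MvPowerSeries.X i + univTail n 𝕜 i) fun i => by
    rw [add_sub_cancel_left]
    refine MvPowerSeries.le_order (n := 2) fun d hd => ?_
    have hd' : d.degree < 2 := by exact_mod_cast hd
    rw [coeff_univTail, dif_neg (by omega)]

theorem coeff_univ (i : Fin n) (J : Fin n →₀ ℕ) (h : 2 ≤ J.degree) :
    MvPowerSeries.coeff J ((univ n 𝕜).toFun i) =
      ((multiFactorial J : 𝕜)⁻¹) • coord ⟨(i, J), h⟩ := by
  have h1 : MvPowerSeries.coeff J (MvPowerSeries.X i : PS n (FN n 𝕜)) = 0 := by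
    rw [MvPowerSeries.coeff_X, if_neg]
    rintro rfl
    rw [Finsupp.degree_single] at h
    omega
  have h2 : (univ n 𝕜).toFun i = MvPowerSeries.X i + univTail n 𝕜 i := rfl
  rw [h2, map_add, h1, zero_add, coeff_univTail, dif_pos h]

theorem _root_.HopfCyclic.Diffeo.ext_of_coeff {φ ψ : Diffeo n A}
    (h : ∀ (i : Fin n) (J : Fin n →₀ ℕ), 2 ≤ J.degree →
      MvPowerSeries.coeff J (φ.toFun i) = MvPowerSeries.coeff J (ψ.toFun i)) : φ = ψ := by
  ext1; funext i; ext J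
  by_cases hJ : 2 ≤ J.degree
  · exact h i J hJ
  · have hJ' : J.degree < 2 := not_le.1 hJ
    have key : ∀ χ : Diffeo n A, MvPowerSeries.coeff J (χ.toFun i) =
        MvPowerSeries.coeff J (MvPowerSeries.X i) := fun χ => by
      have := MvPowerSeries.coeff_of_lt_order (d := J)
        (lt_of_lt_of_le (by exact_mod_cast hJ') (χ.two_le_order_sub i))
      rwa [map_sub, sub_eq_zero] at this
    rw [key, key]

theorem map_comp_univ (f : FN n 𝕜 →ₐ[𝕜] A) (g : A →ₐ[𝕜] B) :
    Diffeo.map (g.comp f).toRingHom (univ n 𝕜) =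
      Diffeo.map g.toRingHom (Diffeo.map f.toRingHom (univ n 𝕜)) := by
  ext1; funext i; ext J
  rfl

theorem map_id_univ : Diffeo.map (AlgHom.id 𝕜 (FN n 𝕜)).toRingHom (univ n 𝕜) = univ n 𝕜 := by
  ext1; funext i; ext J
  rfl

variable (n 𝕜) in
/-- The comultiplication, `Δ(f)(ψ₁, ψ₂) = f(ψ₁ψ₂)`. -/
def comulHom : FN n 𝕜 →ₐ[𝕜] FN n 𝕜 ⊗[𝕜] FN n 𝕜 :=
  eval (Diffeo.map (Algebra.TensorProduct.includeLeft
      (R := 𝕜) (S := 𝕜) (A := FN n 𝕜) (B := FN n 𝕜)).toRingHom (univ n 𝕜) *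
    Diffeo.map (Algebra.TensorProduct.includeRight
      (R := 𝕜) (A := FN n 𝕜) (B := FN n 𝕜)).toRingHom (univ n 𝕜))

variable (n 𝕜) in
/-- The counit, `ε(f) = f(Id)`. -/
def counitHom : FN n 𝕜 →ₐ[𝕜] 𝕜 := eval (1 : Diffeo n 𝕜)

variable (n 𝕜) in
/-- The antipode, `S(f)(ψ) = f(ψ⁻¹)`. -/
def antipodeHom : FN n 𝕜 →ₐ[𝕜] FN n 𝕜 := eval (univ n 𝕜)⁻¹

theorem eval_one : eval (𝕜 := 𝕜) (1 : Diffeo n A) = (Algebra.ofId 𝕜 A).comp (counitHom n 𝕜) := by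
  rw [counitHom, comp_eval, map_one]

variable [CharZero 𝕜]

/-- Algebra maps out of `F(N)` are determined by the induced point of `N`. -/
theorem eval_map_univ (g : FN n 𝕜 →ₐ[𝕜] A) :
    eval (Diffeo.map g.toRingHom (univ n 𝕜)) = g :=
  algHom_ext fun a => by
    rw [eval_coord, Diffeo.map_toFun, MvPowerSeries.coeff_map, coeff_univ _ _ a.2]
    change _ • g (_ • coord a) = _
    rw [map_smul, ← Nat.cast_smul_eq_nsmul 𝕜, smul_smul,
      mul_inv_cancel₀ (Nat.cast_ne_zero.2 (multiFactorial_ne_zero _)), one_smul]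

theorem map_eval_univ (ψ : Diffeo n A) :
    Diffeo.map (eval (𝕜 := 𝕜) ψ).toRingHom (univ n 𝕜) = ψ :=
  Diffeo.ext_of_coeff fun i J h => by
    rw [Diffeo.map_toFun, MvPowerSeries.coeff_map, coeff_univ _ _ h]
    change eval ψ (_ • coord _) = _
    rw [map_smul, eval_coord, ← Nat.cast_smul_eq_nsmul 𝕜, smul_smul,
      inv_mul_cancel₀ (Nat.cast_ne_zero.2 (multiFactorial_ne_zero _)), one_smul]

theorem algHom_ext_univ {f g : FN n 𝕜 →ₐ[𝕜] A}
    (h : Diffeo.map f.toRingHom (univ n 𝕜) = Diffeo.map g.toRingHom (univ n 𝕜)) : f = g := by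
  rw [← eval_map_univ f, h, eval_map_univ g]

theorem comp_comulHom (g : FN n 𝕜 ⊗[𝕜] FN n 𝕜 →ₐ[𝕜] A) :
    Diffeo.map (g.comp (comulHom n 𝕜)).toRingHom (univ n 𝕜) =
      Diffeo.map (g.comp Algebra.TensorProduct.includeLeft).toRingHom (univ n 𝕜) *
        Diffeo.map (g.comp Algebra.TensorProduct.includeRight).toRingHom (univ n 𝕜) := by
  rw [map_comp_univ, comulHom, map_eval_univ, map_mul, ← map_comp_univ, ← map_comp_univ]

theorem comp_counitHom (g : 𝕜 →ₐ[𝕜] A) :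
    Diffeo.map (g.comp (counitHom n 𝕜)).toRingHom (univ n 𝕜) = 1 := by
  rw [map_comp_univ, counitHom, map_eval_univ, map_one]

theorem comp_antipodeHom (g : FN n 𝕜 →ₐ[𝕜] A) :
    Diffeo.map (g.comp (antipodeHom n 𝕜)).toRingHom (univ n 𝕜) =
      (Diffeo.map g.toRingHom (univ n 𝕜))⁻¹ := by
  rw [map_comp_univ, antipodeHom, map_eval_univ, map_inv]

theorem lift_comp_comulHom (f g : FN n 𝕜 →ₐ[𝕜] A) (h : ∀ x y, Commute (f x) (g y)) :
    (Algebra.TensorProduct.lift f g h).comp (comulHom n 𝕜) =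
      eval (Diffeo.map f.toRingHom (univ n 𝕜) * Diffeo.map g.toRingHom (univ n 𝕜)) := by
  apply algHom_ext_univ
  have e1 : (Algebra.TensorProduct.lift f g h).comp
      (Algebra.TensorProduct.includeLeft : FN n 𝕜 →ₐ[𝕜] FN n 𝕜 ⊗[𝕜] FN n 𝕜) = f :=
    AlgHom.ext fun x => by simp
  have e2 : (Algebra.TensorProduct.lift f g h).comp
      (Algebra.TensorProduct.includeRight : FN n 𝕜 →ₐ[𝕜] FN n 𝕜 ⊗[𝕜] FN n 𝕜) = g :=
    AlgHom.ext fun x => by simp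
  rw [comp_comulHom, map_eval_univ, e1, e2]

instance : Bialgebra 𝕜 (FN n 𝕜) :=
  Bialgebra.ofAlgHom (comulHom n 𝕜) (counitHom n 𝕜)
    (by
      apply algHom_ext_univ
      rw [← AlgHom.comp_assoc, comp_comulHom, comp_comulHom]
      have e1 : ((((Algebra.TensorProduct.assoc 𝕜 𝕜 𝕜 (FN n 𝕜) (FN n 𝕜) (FN n 𝕜)).toAlgHom.comp
          (Algebra.TensorProduct.map (comulHom n 𝕜) (.id 𝕜 _))).comp
          Algebra.TensorProduct.includeLeft) : FN n 𝕜 →ₐ[𝕜] _) =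
          ((Algebra.TensorProduct.assoc 𝕜 𝕜 𝕜 (FN n 𝕜) (FN n 𝕜) (FN n 𝕜)).toAlgHom.comp
            Algebra.TensorProduct.includeLeft).comp (comulHom n 𝕜) := by
        ext x; simp
      have e2 : ((Algebra.TensorProduct.map (.id 𝕜 (FN n 𝕜)) (comulHom n 𝕜)).comp
          Algebra.TensorProduct.includeRight : FN n 𝕜 →ₐ[𝕜] _) =
          AlgHom.comp Algebra.TensorProduct.includeRight (comulHom n 𝕜) := by
        ext x; simp
      rw [e1, e2, comp_comulHom, comp_comulHom, mul_assoc]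
      congr 1
      · congr 2
        ext x; simp [Algebra.TensorProduct.one_def]
      · congr 1
        congr 2
        ext x
        simp only [AlgHom.toRingHom_eq_coe, RingHom.coe_coe, AlgHom.comp_apply,
          Algebra.TensorProduct.includeRight_apply, Algebra.TensorProduct.map_tmul, map_one]
        change (Algebra.TensorProduct.assoc 𝕜 𝕜 𝕜 (FN n 𝕜) (FN n 𝕜) (FN n 𝕜))
          ((1 ⊗ₜ[𝕜] 1) ⊗ₜ[𝕜] x) = 1 ⊗ₜ[𝕜] (1 ⊗ₜ[𝕜] x)
        rfl)
    (by
      apply algHom_ext_univ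
      rw [comp_comulHom]
      have e1 : ((Algebra.TensorProduct.map (counitHom n 𝕜) (.id 𝕜 (FN n 𝕜))).comp
          Algebra.TensorProduct.includeLeft : FN n 𝕜 →ₐ[𝕜] _) =
          AlgHom.comp Algebra.TensorProduct.includeLeft (counitHom n 𝕜) := by
        ext x; simp
      rw [e1, comp_counitHom, one_mul]
      congr 2
      ext x; simp)
    (by
      apply algHom_ext_univ
      rw [comp_comulHom]
      have e1 : ((Algebra.TensorProduct.map (.id 𝕜 (FN n 𝕜)) (counitHom n 𝕜)).comp
          Algebra.TensorProduct.includeRight : FN n 𝕜 →ₐ[𝕜] _) =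
          AlgHom.comp Algebra.TensorProduct.includeRight (counitHom n 𝕜) := by
        ext x; simp
      rw [e1, comp_counitHom, mul_one]
      congr 2
      ext x; simp)

theorem map_antipodeHom :
    Diffeo.map (antipodeHom n 𝕜).toRingHom (univ n 𝕜) = (univ n 𝕜)⁻¹ :=
  map_eval_univ _

/-- `F(N)` as a commutative Hopf algebra. -/
instance : HopfAlgebra 𝕜 (FN n 𝕜) :=
  HopfAlgebra.ofAlgHom (antipodeHom n 𝕜)
    ((lift_comp_comulHom _ _ _).trans (by
      rw [map_antipodeHom, map_id_univ, inv_mul_cancel, eval_one]; rfl))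
    ((lift_comp_comulHom _ _ _).trans (by
      rw [map_antipodeHom, map_id_univ, mul_inv_cancel, eval_one]; rfl))

end FN

/-! ### The Lie algebra `gl_n^aff` -/

/-- The affine Lie algebra `gl_n^aff = 𝕜ⁿ ⋊ gl_n`: a pair `(v, A)` stands for the infinitesimal
affine transformation `x ↦ v + A x`. -/
def GlAff (n : ℕ) (𝕜 : Type u) : Type u := (Fin n → 𝕜) × Matrix (Fin n) (Fin n) 𝕜

namespace GlAff

variable {n : ℕ} {𝕜 : Type u} [Field 𝕜]

instance : AddCommGroup (GlAff n 𝕜) :=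
  inferInstanceAs (AddCommGroup ((Fin n → 𝕜) × Matrix (Fin n) (Fin n) 𝕜))
instance : Module 𝕜 (GlAff n 𝕜) :=
  inferInstanceAs (Module 𝕜 ((Fin n → 𝕜) × Matrix (Fin n) (Fin n) 𝕜))

/-- The translation part, as a linear map. -/
def transl : GlAff n 𝕜 →ₗ[𝕜] (Fin n → 𝕜) :=
  LinearMap.fst 𝕜 (Fin n → 𝕜) (Matrix (Fin n) (Fin n) 𝕜)

/-- The linear part, as a linear map. -/
def lin : GlAff n 𝕜 →ₗ[𝕜] Matrix (Fin n) (Fin n) 𝕜 :=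
  LinearMap.snd 𝕜 (Fin n → 𝕜) (Matrix (Fin n) (Fin n) 𝕜)

/-- The element with given translation and linear part. -/
def mk (v : Fin n → 𝕜) (A : Matrix (Fin n) (Fin n) 𝕜) : GlAff n 𝕜 := (v, A)

@[simp] theorem transl_mk (v : Fin n → 𝕜) (A : Matrix (Fin n) (Fin n) 𝕜) :
    transl (mk v A) = v := rfl
@[simp] theorem lin_mk (v : Fin n → 𝕜) (A : Matrix (Fin n) (Fin n) 𝕜) : lin (mk v A) = A := rfl

theorem ext {x y : GlAff n 𝕜} (h1 : transl x = transl y) (h2 : lin x = lin y) : x = y :=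
  Prod.ext h1 h2

instance : Bracket (GlAff n 𝕜) (GlAff n 𝕜) where
  bracket x y := mk (lin x *ᵥ transl y - lin y *ᵥ transl x) (lin x * lin y - lin y * lin x)

theorem transl_lie (x y : GlAff n 𝕜) :
    transl ⁅x, y⁆ = lin x *ᵥ transl y - lin y *ᵥ transl x := rfl
theorem lin_lie (x y : GlAff n 𝕜) : lin ⁅x, y⁆ = lin x * lin y - lin y * lin x := rfl

instance : LieRing (GlAff n 𝕜) where
  add_lie x y z := by
    apply ext
    · simp only [transl_lie, map_add, Matrix.add_mulVec, Matrix.mulVec_add]; abel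
    · simp only [lin_lie, map_add]; noncomm_ring
  lie_add x y z := by
    apply ext
    · simp only [transl_lie, map_add, Matrix.add_mulVec, Matrix.mulVec_add]; abel
    · simp only [lin_lie, map_add]; noncomm_ring
  lie_self x := by
    apply ext
    · simp [transl_lie]
    · simp [lin_lie]
  leibniz_lie x y z := by
    apply ext
    · simp only [transl_lie, lin_lie, map_add, Matrix.sub_mulVec, Matrix.mulVec_sub,
        Matrix.mulVec_mulVec]
      abel
    · simp only [lin_lie, map_add]; noncomm_ring

instance : LieAlgebra 𝕜 (GlAff n 𝕜) where
  lie_smul t x y := by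
    apply ext
    · simp [transl_lie, smul_sub, Matrix.mulVec_smul, Matrix.smul_mulVec]
    · simp [lin_lie, smul_sub]

variable (𝕜) in
/-- The translation generator `X_k`. -/
def X (k : Fin n) : GlAff n 𝕜 := mk (Pi.single k 1) 0

variable (𝕜) in
/-- The linear generator `Y_i^j`, the matrix unit sending the `j`-th basis vector to the `i`-th. -/
def Y (i j : Fin n) : GlAff n 𝕜 := mk 0 (Matrix.single i j 1)

theorem lie_X_X (k l : Fin n) : ⁅X 𝕜 k, X 𝕜 l⁆ = 0 := by
  apply ext
  · simp only [transl_lie, X, lin_mk, transl_mk, Matrix.zero_mulVec, sub_zero, map_zero]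
  · simp [lin_lie, X]

theorem lie_Y_X (i j k : Fin n) : ⁅Y 𝕜 i j, X 𝕜 k⁆ = if k = j then X 𝕜 i else 0 := by
  apply ext
  · simp only [transl_lie, X, Y, lin_mk, transl_mk]
    split_ifs with h
    · ext a
      simp [Pi.single_apply, Matrix.single_apply, h, eq_comm]
    · ext a
      simp [Matrix.single_apply]
      exact fun _ h' => h h'.symm
  · simp only [lin_lie, X, Y, lin_mk]
    split_ifs <;> simp

theorem lie_Y_Y (i j p q : Fin n) : ⁅Y 𝕜 i j, Y 𝕜 p q⁆ =
    (if p = j then Y 𝕜 i q else 0) - if i = q then Y 𝕜 p j else 0 := by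
  apply ext
  · simp only [transl_lie, Y, lin_mk, transl_mk]
    split_ifs <;> simp
  · simp only [lin_lie, Y, lin_mk]
    split_ifs with h1 h2 h2 <;> simp_all [Matrix.single_mul_single_of_ne, eq_comm]

variable (n 𝕜) in
/-- The basis `X_k`, `Y_i^j` of `gl_n^aff`. -/
def basis : Module.Basis (Fin n ⊕ Fin n × Fin n) 𝕜 (GlAff n 𝕜) :=
  (Pi.basisFun 𝕜 (Fin n)).prod (Matrix.stdBasis 𝕜 (Fin n) (Fin n))

theorem basis_inl (k : Fin n) : basis n 𝕜 (Sum.inl k) = X 𝕜 k := by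
  refine ext ((Module.Basis.prod_apply_inl_fst (Pi.basisFun 𝕜 (Fin n))
    (Matrix.stdBasis 𝕜 (Fin n) (Fin n)) k).trans ?_)
    (Module.Basis.prod_apply_inl_snd (Pi.basisFun 𝕜 (Fin n))
      (Matrix.stdBasis 𝕜 (Fin n) (Fin n)) k)
  exact Pi.basisFun_apply 𝕜 (Fin n) k

theorem basis_inr (i j : Fin n) : basis n 𝕜 (Sum.inr (i, j)) = Y 𝕜 i j := by
  refine ext (Module.Basis.prod_apply_inr_fst (Pi.basisFun 𝕜 (Fin n))
    (Matrix.stdBasis 𝕜 (Fin n) (Fin n)) (i, j))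
    ((Module.Basis.prod_apply_inr_snd (Pi.basisFun 𝕜 (Fin n))
      (Matrix.stdBasis 𝕜 (Fin n) (Fin n)) (i, j)).trans ?_)
  exact Matrix.stdBasis_eq_single 𝕜 i j

end GlAff

/-! ### The mutual (co)actions of `F(N)` and `gl_n^aff` -/

section Coactions

variable {n : ℕ} {𝕜 : Type u} [Field 𝕜]

/-- The function `η^i_{jk}(ψ) = ∂_j ∂_k ψ^i (0)`. -/
def eta (i j k : Fin n) : FN n 𝕜 :=
  FN.coord ⟨(i, Finsupp.single j 1 + Finsupp.single k 1), by
    rw [map_add, Finsupp.degree_single, Finsupp.degree_single]⟩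

variable (n 𝕜) in
/-- The right coaction `X_k ↦ X_k ⊗ 1 + Y_i^j ⊗ η^i_{jk}`, `Y_i^j ↦ Y_i^j ⊗ 1`. -/
def coactS : GlAff n 𝕜 →ₗ[𝕜] GlAff n 𝕜 ⊗[𝕜] FN n 𝕜 :=
  (GlAff.basis n 𝕜).constr 𝕜 (Sum.elim
    (fun k => GlAff.X 𝕜 k ⊗ₜ[𝕜] (1 : FN n 𝕜) + ∑ i, ∑ j, GlAff.Y 𝕜 i j ⊗ₜ[𝕜] eta i j k)
    (fun ij => GlAff.Y 𝕜 ij.1 ij.2 ⊗ₜ[𝕜] (1 : FN n 𝕜)))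

theorem coactS_X (k : Fin n) : coactS n 𝕜 (GlAff.X 𝕜 k) =
    GlAff.X 𝕜 k ⊗ₜ[𝕜] (1 : FN n 𝕜) + ∑ i, ∑ j, GlAff.Y 𝕜 i j ⊗ₜ[𝕜] eta i j k := by
  rw [← GlAff.basis_inl, coactS, Module.Basis.constr_basis, Sum.elim_inl, GlAff.basis_inl]

theorem coactS_Y (i j : Fin n) :
    coactS n 𝕜 (GlAff.Y 𝕜 i j) = GlAff.Y 𝕜 i j ⊗ₜ[𝕜] (1 : FN n 𝕜) := by
  rw [← GlAff.basis_inr, coactS, Module.Basis.constr_basis, Sum.elim_inr, GlAff.basis_inr]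

variable (n) in
/-- The affine vector field `x ↦ v + A x` on `n`-space, with coefficients in a `𝕜`-algebra. -/
def affineField {R : Type v} [CommRing R] [Algebra 𝕜 R] :
    GlAff n 𝕜 →ₗ[𝕜] (Fin n → PS n R) where
  toFun Z i := algebraMap 𝕜 _ (GlAff.transl Z i) +
    ∑ j, algebraMap 𝕜 _ (GlAff.lin Z i j) * MvPowerSeries.X j
  map_add' Z W := by
    funext i
    simp only [map_add, Pi.add_apply, Matrix.add_apply, add_mul, Finset.sum_add_distrib]
    abel
  map_smul' c Z := by
    funext i
    simp only [map_smul, Pi.smul_apply, Matrix.smul_apply, smul_eq_mul, map_mul, mul_assoc,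
      ← Finset.mul_sum, ← mul_add, Algebra.smul_def, RingHom.id_apply]

variable (n 𝕜) in
/-- For the universal point `ψ` of `N`, the affine vector field `ψ ▷ Z = Z_<0> Z_<1>(ψ)`. Explicitly,
`(v, A) ▷` gives `x ↦ v + A x + ψ''(0)(v, x)`, which is the first order part of `(ψ' · Z) ∘ ψ⁻¹`. -/
def actField : GlAff n 𝕜 →ₗ[𝕜] (Fin n → PS n (FN n 𝕜)) :=
  TensorProduct.lift (LinearMap.mk₂ 𝕜 (fun Z f i => f • affineField n (R := FN n 𝕜) Z i)
    (fun Z W f => by funext i; simp) (fun c Z f => by funext i; simp [smul_comm c f])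
    (fun Z f g => by funext i; simp [add_smul]) (fun c Z f => by funext i; simp)) ∘ₗ coactS n 𝕜

variable (n 𝕜) in
/-- The velocity at `t = 0` of `t ↦ ψ ◁ exp(t Z)`, for the universal point `ψ` of `N`, in direction
`Z`. Here `ψ ◁ exp(t Z)` is the element of `N` given by
`ψ ∘ exp(t Z) = exp(t (ψ ▷ Z)) ∘ (ψ ◁ exp(t Z))` to first order in `t`. -/
def velocity : GlAff n 𝕜 →ₗ[𝕜] (Fin n → PS n (FN n 𝕜)) where
  toFun Z i := (∑ j, affineField n Z j * MvPowerSeries.pderiv (FN n 𝕜) j ((FN.univ n 𝕜).toFun i)) -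
    MvPowerSeries.substAlgHom (FN.univ n 𝕜).hasSubst (actField n 𝕜 Z i)
  map_add' Z W := by
    funext i
    simp only [map_add, Pi.add_apply, add_mul, Finset.sum_add_distrib]
    abel
  map_smul' c Z := by
    funext i
    have h : c • actField n 𝕜 Z i = algebraMap 𝕜 (FN n 𝕜) c • actField n 𝕜 Z i := by
      rw [algebraMap_smul]
    simp only [map_smul, Pi.smul_apply, smul_mul_assoc, RingHom.id_apply, smul_sub,
      Finset.smul_sum, h]
    rw [algebraMap_smul]

/-- The derivation of `F(N)` with given values on the jet coordinates. -/
def FN.derivationOf : (JetIndex n → FN n 𝕜) ≃ₗ[𝕜] Derivation 𝕜 (FN n 𝕜) (FN n 𝕜) :=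
  MvPolynomial.mkDerivationEquiv (σ := JetIndex n) (A := MvPolynomial (JetIndex n) 𝕜) 𝕜

theorem FN.derivationOf_coord (f : JetIndex n → FN n 𝕜) (a : JetIndex n) :
    FN.derivationOf f (FN.coord a) = f a :=
  MvPolynomial.mkDerivation_X (σ := JetIndex n) (A := MvPolynomial (JetIndex n) 𝕜) 𝕜 f a

variable (n 𝕜) in
/-- The action of `gl_n^aff` on `F(N)` by derivations,
`(Z ▷ f)(ψ) = d/dt f(ψ ◁ exp(t Z))` at `t = 0`. -/
def tri : GlAff n 𝕜 →ₗ[𝕜] Derivation 𝕜 (FN n 𝕜) (FN n 𝕜) :=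
  FN.derivationOf.toLinearMap ∘ₗ LinearMap.pi fun a : JetIndex n =>
    { toFun := fun Z => multiFactorial a.1.2 • MvPowerSeries.coeff a.1.2 (velocity n 𝕜 Z a.1.1)
      map_add' := fun Z W => by simp
      map_smul' := fun c Z => by
        rw [map_smul, Pi.smul_apply, RingHom.id_apply, smul_comm c]
        rfl }

theorem tri_coord (Z : GlAff n 𝕜) (a : JetIndex n) :
    tri n 𝕜 Z (FN.coord a) =
      multiFactorial a.1.2 • MvPowerSeries.coeff a.1.2 (velocity n 𝕜 Z a.1.1) :=
  FN.derivationOf_coord _ _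

end Coactions

/-! ### The exterior algebra of `s^*` -/

section Exterior

variable (n : ℕ) (𝕜 : Type u) [Field 𝕜]

/-- The dual space `s^*` of `s = gl_n^aff`. -/
abbrev DualS : Type u := Module.Dual 𝕜 (GlAff n 𝕜)

/-- The exterior algebra `⋀ s^*`. -/
abbrev ExtS : Type u := ExteriorAlgebra 𝕜 (DualS n 𝕜)

/-- The dual basis `θ^k`, `θ^i_j` of `s^*`. -/
def dualBasis (b : Fin n ⊕ Fin n × Fin n) : DualS n 𝕜 := (GlAff.basis n 𝕜).coord b

/-- The left coaction on `s^*`, `θ^k ↦ 1 ⊗ θ^k`, `θ^i_j ↦ 1 ⊗ θ^i_j + η^i_{jk} ⊗ θ^k`. -/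
def coactDual : DualS n 𝕜 →ₗ[𝕜] FN n 𝕜 ⊗[𝕜] DualS n 𝕜 where
  toFun θ := (1 : FN n 𝕜) ⊗ₜ[𝕜] θ + ∑ i, ∑ j, ∑ k, θ (GlAff.Y 𝕜 i j) •
    ((eta i j k : FN n 𝕜) ⊗ₜ[𝕜] dualBasis n 𝕜 (Sum.inl k))
  map_add' θ θ' := by
    simp only [TensorProduct.tmul_add, LinearMap.add_apply, add_smul, Finset.sum_add_distrib]
    abel
  map_smul' c θ := by
    simp only [TensorProduct.tmul_smul, LinearMap.smul_apply, smul_eq_mul, mul_smul, smul_add,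
      Finset.smul_sum, RingHom.id_apply]

theorem dualBasis_Y (a : Fin n ⊕ Fin n × Fin n) (i j : Fin n) :
    dualBasis n 𝕜 a (GlAff.Y 𝕜 i j) = if Sum.inr (i, j) = a then 1 else 0 := by
  rw [← GlAff.basis_inr, dualBasis, Module.Basis.coord_apply, Module.Basis.repr_self,
    Finsupp.single_apply]

theorem coactDual_inl (k : Fin n) : coactDual n 𝕜 (dualBasis n 𝕜 (Sum.inl k)) =
    (1 : FN n 𝕜) ⊗ₜ[𝕜] dualBasis n 𝕜 (Sum.inl k) := by
  simp [coactDual, dualBasis_Y]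

theorem coactDual_inr (i j : Fin n) : coactDual n 𝕜 (dualBasis n 𝕜 (Sum.inr (i, j))) =
    (1 : FN n 𝕜) ⊗ₜ[𝕜] dualBasis n 𝕜 (Sum.inr (i, j)) +
      ∑ k, (eta i j k : FN n 𝕜) ⊗ₜ[𝕜] dualBasis n 𝕜 (Sum.inl k) := by
  simp only [coactDual, LinearMap.coe_mk, AddHom.coe_mk, dualBasis_Y, Sum.inr.injEq, Prod.mk.injEq]
  congr 1
  rw [Finset.sum_eq_single i _ (by simp), Finset.sum_eq_single j _ (by simp)]
  · simp
  · intro b _ hb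
    simp [hb]
  · intro b _ hb
    simp [hb]

variable {n 𝕜} in
theorem ext_sq_zero {F : Type v} [CommRing F] [Algebra 𝕜 F] {M : Type w} [AddCommGroup M]
    [Module 𝕜 M] (t : F ⊗[𝕜] M) :
    TensorProduct.map LinearMap.id (ExteriorAlgebra.ι 𝕜) t *
      TensorProduct.map LinearMap.id (ExteriorAlgebra.ι 𝕜) t = 0 := by
  have key : ∀ s t : F ⊗[𝕜] M,
      TensorProduct.map LinearMap.id (ExteriorAlgebra.ι 𝕜) s *
        TensorProduct.map LinearMap.id (ExteriorAlgebra.ι 𝕜) t +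
      TensorProduct.map LinearMap.id (ExteriorAlgebra.ι 𝕜) t *
        TensorProduct.map LinearMap.id (ExteriorAlgebra.ι 𝕜) s = 0 := by
    intro s t
    induction s with
    | zero => simp
    | add a b ha hb =>
      rw [map_add, add_mul, mul_add, add_add_add_comm, ha, hb, add_zero]
    | tmul f m =>
      induction t with
      | zero => simp
      | add a b ha hb =>
        rw [map_add, add_mul, mul_add, add_add_add_comm, ha, hb, add_zero]
      | tmul g m' =>
        simp only [TensorProduct.map_tmul, LinearMap.id_apply, Algebra.TensorProduct.tmul_mul_tmul]
        rw [mul_comm g f, ← TensorProduct.tmul_add, ExteriorAlgebra.ι_add_mul_swap,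
          TensorProduct.tmul_zero]
  induction t with
  | zero => simp
  | add a b ha hb => rw [map_add, add_mul, mul_add, mul_add, ha, hb, zero_add, add_zero, key]
  | tmul f m => simp

/-- The left coaction `η ↦ η_<-1> ⊗ η_<0>` on `⋀ s^*`, the multiplicative extension of the one on
`s^*`. -/
def coactExt : ExtS n 𝕜 →ₐ[𝕜] FN n 𝕜 ⊗[𝕜] ExtS n 𝕜 :=
  ExteriorAlgebra.lift 𝕜
    ⟨TensorProduct.map LinearMap.id (ExteriorAlgebra.ι 𝕜) ∘ₗ coactDual n 𝕜, fun _ =>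
      ext_sq_zero _⟩

theorem coactExt_ι (θ : DualS n 𝕜) : coactExt n 𝕜 (ExteriorAlgebra.ι 𝕜 θ) =
    TensorProduct.map LinearMap.id (ExteriorAlgebra.ι 𝕜) (coactDual n 𝕜 θ) :=
  ExteriorAlgebra.lift_ι_apply ..

/-- The differential on `s^*`: `dθ = ½ ∑ θ([b_a, b_b]) v^a ∧ v^b`, for a basis `b_a` of `s` with
dual basis `v^a`; that is, `dθ` is the `2`-form `(Z, W) ↦ θ([Z, W])`. -/
def deRhamOne : DualS n 𝕜 →ₗ[𝕜] ExtS n 𝕜 where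
  toFun θ := ∑ a, ∑ b, ((2 : 𝕜)⁻¹ * θ ⁅GlAff.basis n 𝕜 a, GlAff.basis n 𝕜 b⁆) •
    (ExteriorAlgebra.ι 𝕜 (dualBasis n 𝕜 a) * ExteriorAlgebra.ι 𝕜 (dualBasis n 𝕜 b))
  map_add' θ θ' := by
    simp only [LinearMap.add_apply, mul_add, add_smul, Finset.sum_add_distrib]
  map_smul' c θ := by
    simp only [LinearMap.smul_apply, smul_eq_mul, mul_left_comm _ c, mul_smul, Finset.smul_sum,
      RingHom.id_apply]

/-- The grading involution of `⋀ s^*`, multiplication by `(-1)^p` on `⋀^p s^*`. -/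
def parity : ExtS n 𝕜 →ₐ[𝕜] ExtS n 𝕜 := CliffordAlgebra.involute

theorem parity_ι (θ : DualS n 𝕜) :
    parity n 𝕜 (ExteriorAlgebra.ι 𝕜 θ) = -ExteriorAlgebra.ι 𝕜 θ :=
  CliffordAlgebra.involute_ι θ

/-- A two-form commutes with a one-form. -/
theorem ι_comm_deRhamOne (θ τ : DualS n 𝕜) :
    ExteriorAlgebra.ι 𝕜 τ * deRhamOne n 𝕜 θ = deRhamOne n 𝕜 θ * ExteriorAlgebra.ι 𝕜 τ := by
  have h : ∀ α β : DualS n 𝕜, ExteriorAlgebra.ι 𝕜 α * ExteriorAlgebra.ι 𝕜 β =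
      -(ExteriorAlgebra.ι 𝕜 β * ExteriorAlgebra.ι 𝕜 α) := fun α β =>
    eq_neg_of_add_eq_zero_left (ExteriorAlgebra.ι_add_mul_swap α β)
  simp only [deRhamOne, LinearMap.coe_mk, AddHom.coe_mk, Finset.mul_sum, Finset.sum_mul]
  refine Finset.sum_congr rfl fun a _ => Finset.sum_congr rfl fun b _ => ?_
  rw [mul_smul_comm, smul_mul_assoc, ← mul_assoc, h τ, neg_mul, mul_assoc, h τ, mul_neg, neg_neg,
    mul_assoc]

/-- The algebra map `η ↦ [[η^, dη], [0, η]]`, where `η^` is the grading involution and `d` the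
odd derivation extending `deRhamOne`. -/
def deRhamMatrix : ExtS n 𝕜 →ₐ[𝕜] Matrix (Fin 2) (Fin 2) (ExtS n 𝕜) :=
  ExteriorAlgebra.lift 𝕜
    ⟨{ toFun := fun θ => !![-ExteriorAlgebra.ι 𝕜 θ, deRhamOne n 𝕜 θ; 0, ExteriorAlgebra.ι 𝕜 θ]
       map_add' := fun θ θ' => by
        ext i j
        fin_cases i <;> fin_cases j <;> simp [add_comm]
       map_smul' := fun c θ => by
        ext i j
        fin_cases i <;> fin_cases j <;> simp }, fun θ => by
      ext i j
      fin_cases i <;> fin_cases j <;> simp [Matrix.mul_apply, Fin.sum_univ_two, ι_comm_deRhamOne]⟩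

/-- The differential `d_DR : ⋀^p s^* → ⋀^{p+1} s^*`, the graded derivation extending `deRhamOne`. -/
def deRham : ExtS n 𝕜 →ₗ[𝕜] ExtS n 𝕜 :=
  Matrix.entryLinearMap 𝕜 (ExtS n 𝕜) 0 1 ∘ₗ (deRhamMatrix n 𝕜).toLinearMap

theorem deRhamMatrix_ι (θ : DualS n 𝕜) : deRhamMatrix n 𝕜 (ExteriorAlgebra.ι 𝕜 θ) =
    !![-ExteriorAlgebra.ι 𝕜 θ, deRhamOne n 𝕜 θ; 0, ExteriorAlgebra.ι 𝕜 θ] :=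
  ExteriorAlgebra.lift_ι_apply ..

theorem deRham_ι (θ : DualS n 𝕜) : deRham n 𝕜 (ExteriorAlgebra.ι 𝕜 θ) = deRhamOne n 𝕜 θ := by
  simp [deRham, deRhamMatrix_ι]

theorem deRham_one : deRham n 𝕜 1 = 0 := by
  simp [deRham]

theorem deRhamMatrix_entries (x : ExtS n 𝕜) : deRhamMatrix n 𝕜 x 0 0 = parity n 𝕜 x ∧
    deRhamMatrix n 𝕜 x 1 0 = 0 ∧ deRhamMatrix n 𝕜 x 1 1 = x := by
  induction x using ExteriorAlgebra.induction with
  | algebraMap r => simp [Matrix.algebraMap_matrix_apply]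
  | ι θ => simp [deRhamMatrix_ι, parity_ι]
  | mul a b ha hb =>
    simp [Matrix.mul_apply, Fin.sum_univ_two, ha, hb]
  | add a b ha hb => simp [ha, hb]

/-- The graded Leibniz rule. -/
theorem deRham_mul (x y : ExtS n 𝕜) :
    deRham n 𝕜 (x * y) = deRham n 𝕜 x * y + parity n 𝕜 x * deRham n 𝕜 y := by
  have h : ∀ x, deRham n 𝕜 x = deRhamMatrix n 𝕜 x 0 1 := fun x => rfl
  rw [h, map_mul, Matrix.mul_apply, Fin.sum_univ_two, (deRhamMatrix_entries n 𝕜 x).1,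
    (deRhamMatrix_entries n 𝕜 y).2.2, h, h, add_comm]

end Exterior

/-! ### Tensor powers of `F(N)` -/

section Tensors

variable (n : ℕ) (𝕜 : Type u) [Field 𝕜]

/-- The algebra `F(N)^{⊗ q}`. -/
abbrev Tens (q : ℕ) : Type u := PiTensorProduct 𝕜 (fun _ : Fin q => FN n 𝕜)

namespace Tens

variable {n 𝕜} {q r : ℕ} {S : Type v} [CommRing S] [Algebra 𝕜 S]

variable (n 𝕜) in
/-- `f ↦ 1 ⊗ ⋯ ⊗ f ⊗ ⋯ ⊗ 1`, with `f` in position `i`. -/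
def slot (i : Fin q) : FN n 𝕜 →ₐ[𝕜] Tens n 𝕜 q :=
  PiTensorProduct.singleAlgHom (R := 𝕜) (A := fun _ : Fin q => FN n 𝕜) i

/-- `f¹ ⊗ ⋯ ⊗ f^q ↦ ∏ gᵢ(fⁱ)`. -/
def lift (g : Fin q → FN n 𝕜 →ₐ[𝕜] S) : Tens n 𝕜 q →ₐ[𝕜] S :=
  PiTensorProduct.liftAlgHom
    ((MultilinearMap.mkPiAlgebra 𝕜 (Fin q) S).compLinearMap fun i => (g i).toLinearMap)
    (by simp) (by simp [Finset.prod_mul_distrib])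

theorem lift_tprod (g : Fin q → FN n 𝕜 →ₐ[𝕜] S) (f : Fin q → FN n 𝕜) :
    lift g (PiTensorProduct.tprod 𝕜 f) = ∏ i, g i (f i) := by
  refine (PiTensorProduct.lift.tprod f).trans ?_
  simp

theorem lift_slot (g : Fin q → FN n 𝕜 →ₐ[𝕜] S) (i : Fin q) (f : FN n 𝕜) :
    lift g (slot n 𝕜 i f) = g i f := by
  refine (lift_tprod g _).trans ?_
  rw [Finset.prod_eq_single i]
  · simp
  · intro j _ hj
    simp [MonoidHom.mulSingle_apply, Pi.mulSingle_eq_of_ne hj]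
  · simp

variable (n 𝕜) in
/-- Insertion of factors `1`: the `i`-th factor is moved to position `e i`. -/
def place (e : Fin q → Fin r) : Tens n 𝕜 q →ₐ[𝕜] Tens n 𝕜 r :=
  lift fun i => slot n 𝕜 (e i)

variable [CharZero 𝕜]

variable (n 𝕜) in
/-- The comultiplication of `F(N)`, put in positions `i` and `j`: `f ↦ f_(1)` in position `i`, times
`f_(2)` in position `j`. -/
def comulSlots (i j : Fin r) : FN n 𝕜 →ₐ[𝕜] Tens n 𝕜 r :=
  (Algebra.TensorProduct.productMap (slot n 𝕜 i) (slot n 𝕜 j)).comp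
    (Bialgebra.comulAlgHom 𝕜 (FN n 𝕜))

variable (n 𝕜) in
/-- `f¹ ⊗ ⋯ ⊗ f^q ↦ f¹ ⊗ ⋯ ⊗ Δ(fⁱ) ⊗ ⋯ ⊗ f^q`. -/
def comulAt (i : Fin q) : Tens n 𝕜 q →ₐ[𝕜] Tens n 𝕜 (q + 1) :=
  lift fun j => if j < i then slot n 𝕜 j.castSucc else
    if j = i then comulSlots n 𝕜 j.castSucc j.succ else slot n 𝕜 j.succ

variable (n 𝕜) in
/-- The iterated comultiplication `Δ^{(r)} : F(N) → F(N)^{⊗ r}`, `f ↦ f_(1) ⊗ ⋯ ⊗ f_(r)`, with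
`Δ^{(0)} = ε` and `Δ^{(1)} = id`. -/
def iterComul : (r : ℕ) → FN n 𝕜 →ₐ[𝕜] Tens n 𝕜 r
  | 0 => (Algebra.ofId 𝕜 _).comp (Bialgebra.counitAlgHom 𝕜 (FN n 𝕜))
  | r + 1 => (Algebra.TensorProduct.productMap (slot n 𝕜 0)
      ((place n 𝕜 Fin.succ).comp (iterComul r))).comp (Bialgebra.comulAlgHom 𝕜 (FN n 𝕜))

/-- The linear map applying `u` to the `i`-th factor. -/
def applyAt (i : Fin q) (u : FN n 𝕜 →ₗ[𝕜] FN n 𝕜) : Tens n 𝕜 q →ₗ[𝕜] Tens n 𝕜 q :=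
  PiTensorProduct.map (Function.update (fun _ => LinearMap.id) i u)

variable (n 𝕜) in
/-- The diagonal action of `h ∈ F(N)` on the factors after the `i`-th one:
`1 ⊗ ⋯ ⊗ 1 ⊗ h_(1) ⊗ h_(2) ⊗ ⋯`, as an element to multiply with. -/
def diagAfter (i : Fin q) : FN n 𝕜 →ₐ[𝕜] Tens n 𝕜 q :=
  (place n 𝕜 fun k : Fin (q - (i + 1)) => (⟨i + 1 + k, by omega⟩ : Fin q)).comp
    (iterComul n 𝕜 (q - (i + 1)))

variable (n 𝕜) in
/-- The action of `s` on `F(N)^{⊗ q}`,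
`X • (f¹ ⊗ ⋯ ⊗ f^q) = ∑ᵢ f¹ ⊗ ⋯ ⊗ X_<0> ▷ fⁱ ⊗ X_<1> · (f^{i+1} ⊗ ⋯ ⊗ f^q)`, where `h ·` is
multiplication with the iterated coproduct of `h`. -/
def bullet (q : ℕ) : GlAff n 𝕜 →ₗ[𝕜] Module.End 𝕜 (Tens n 𝕜 q) :=
  ∑ i : Fin q, TensorProduct.lift (LinearMap.mk₂ 𝕜
    (fun Z h => LinearMap.mulLeft 𝕜 (diagAfter n 𝕜 i h) ∘ₗ applyAt i (tri n 𝕜 Z).toLinearMap)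
    (fun Z W h => by
      rw [← LinearMap.comp_add, map_add]
      congr 1
      exact (PiTensorProduct.mapMultilinear ..).map_update_add _ _ _ _)
    (fun c Z h => by
      rw [← LinearMap.comp_smul, map_smul]
      congr 1
      exact (PiTensorProduct.mapMultilinear ..).map_update_smul _ _ _ _)
    (fun Z h k => by
      rw [map_add, ← LinearMap.add_comp]
      congr 1
      exact LinearMap.ext fun x => by simp [add_mul])
    (fun c Z h => LinearMap.ext fun x => by simp)) ∘ₗ coactS n 𝕜

end Tens
end Tensors

/-! ### Formal differential forms of degree at most one -/

section FormsSection

variable (n : ℕ)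

/-- Formal differential forms of degree at most one on `n`-space with coefficients in `R`; the pair
`(a, f)` stands for `a + ∑ᵢ fᵢ dxⁱ`. For an algebra `R` over the ground field this is the completed
tensor product of the space of forms with `R`. -/
abbrev Forms (R : Type v) [CommRing R] : Type v := PS n R × (Fin n → PS n R)

namespace Forms

variable {n} {𝕜 : Type u} [Field 𝕜] {R : Type v} {A : Type w} [CommRing R] [Algebra 𝕜 R]
  [CommRing A] [Algebra 𝕜 A]

/-- Application of a linear map to the coefficients of a power series. -/
def psMap (u : R →ₗ[𝕜] A) : PS n R →ₗ[𝕜] PS n A where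
  toFun f := fun J => u (MvPowerSeries.coeff J f)
  map_add' f g := by
    ext J
    exact map_add u _ _
  map_smul' c f := by
    ext J
    exact map_smul u c _

theorem coeff_psMap (u : R →ₗ[𝕜] A) (f : PS n R) (J : Fin n →₀ ℕ) :
    MvPowerSeries.coeff J (psMap u f) = u (MvPowerSeries.coeff J f) := rfl

/-- Application of a linear map to the coefficients of a form. -/
def map (u : R →ₗ[𝕜] A) : Forms n R →ₗ[𝕜] Forms n A where
  toFun m := (psMap u m.1, fun i => psMap u (m.2 i))
  map_add' m m' := by
    ext1
    · simp
    · funext i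
      simp
  map_smul' c m := by
    ext1
    · simp
    · funext i
      simp

theorem map_add_left (u v : R →ₗ[𝕜] A) (m : Forms n R) : map (u + v) m = map u m + map v m := rfl

theorem map_smul_left (c : 𝕜) (u : R →ₗ[𝕜] A) (m : Forms n R) :
    map (c • u) m = c • map u m := rfl

/-- The pull-back `φ^*`: `a + ∑ fᵢ dxⁱ ↦ a ∘ φ + ∑ (fᵢ ∘ φ) dφⁱ`. -/
def pullback (φ : Diffeo n R) : Forms n R →ₗ[R] Forms n R where
  toFun m := (MvPowerSeries.substAlgHom φ.hasSubst m.1,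
    fun j => ∑ i, MvPowerSeries.substAlgHom φ.hasSubst (m.2 i) *
      MvPowerSeries.pderiv R j (φ.toFun i))
  map_add' m m' := by
    ext1
    · exact map_add _ _ _
    · funext i
      simp only [Prod.snd_add, Pi.add_apply, map_add, add_mul, Finset.sum_add_distrib]
  map_smul' c m := by
    ext1
    · simp [-MvPowerSeries.coe_substAlgHom]
    · funext i
      simp [-MvPowerSeries.coe_substAlgHom, Finset.smul_sum]

/-- The product of forms, with terms of degree `2` dropped. -/
def wedge : Forms n R →ₗ[𝕜] Forms n R →ₗ[𝕜] Forms n R :=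
  LinearMap.mk₂ 𝕜 (fun m m' => (m.1 * m'.1, fun i => m.1 * m'.2 i + m.2 i * m'.1))
    (fun m₁ m₂ m' => by
      ext1
      · simp [add_mul]
      · funext i
        simp only [Prod.fst_add, Prod.snd_add, Pi.add_apply, add_mul]
        abel)
    (fun c m m' => by
      ext1
      · simp
      · funext i
        simp [smul_add])
    (fun m m₁ m₂ => by
      ext1
      · simp [mul_add]
      · funext i
        simp only [Prod.fst_add, Prod.snd_add, Pi.add_apply, mul_add]
        abel)
    (fun c m m' => by
      ext1
      · simp
      · funext i
        simp [smul_add])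

/-- The Lie derivative along the vector field `∑ Vʲ ∂ⱼ`:
`a ↦ ∑ⱼ Vʲ ∂ⱼ a` and `∑ fᵢ dxⁱ ↦ ∑ᵢⱼ (Vʲ ∂ⱼ fᵢ + fⱼ ∂ᵢ Vʲ) dxⁱ`. -/
def lieDer (V : Fin n → PS n R) : Forms n R →ₗ[R] Forms n R where
  toFun m := (∑ j, V j * MvPowerSeries.pderiv R j m.1,
    fun i => ∑ j, (V j * MvPowerSeries.pderiv R j (m.2 i) +
      m.2 j * MvPowerSeries.pderiv R i (V j)))
  map_add' m m' := by
    ext1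
    · simp [mul_add, Finset.sum_add_distrib]
    · funext i
      simp only [Prod.snd_add, Prod.snd_add, Pi.add_apply, map_add, mul_add, add_mul,
        Finset.sum_add_distrib]
      abel
  map_smul' c m := by
    ext1
    · simp [Finset.smul_sum]
    · funext i
      simp [Finset.smul_sum, smul_add]

/-- The action of `s = gl_n^aff` on forms: `Z` acts by minus the Lie derivative along the affine
vector field `x ↦ v + A x`, which is the derivative of the push-forward by `exp(t Z)`. -/
def act : GlAff n 𝕜 →ₗ[𝕜] Module.End 𝕜 (Forms n R) where
  toFun Z := -(lieDer (affineField n Z)).restrictScalars 𝕜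
  map_add' Z W := by
    refine LinearMap.ext fun m => ?_
    ext1
    · simp [lieDer, add_mul, Finset.sum_add_distrib]
      abel
    · funext i
      simp [lieDer, add_mul, mul_add, Finset.sum_add_distrib]
      abel
  map_smul' c Z := by
    refine LinearMap.ext fun m => ?_
    ext1
    · simp [lieDer, Finset.smul_sum]
    · funext i
      simp [lieDer, Finset.smul_sum]

variable (R)

/-- The right coaction `ω ↦ ω_<0> ⊗ ω_<1>` of `F(N)` on forms, `ω_<0> ω_<1>(ψ) = (ψ⁻¹)^* ω`
(linear over the coefficient algebra `R`). -/
def coact : Forms n R →ₗ[𝕜] Forms n (R ⊗[𝕜] FN n 𝕜) :=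
  (pullback (Diffeo.map (Algebra.TensorProduct.includeRight
      (R := 𝕜) (A := R) (B := FN n 𝕜)).toRingHom (FN.univ n 𝕜))⁻¹).restrictScalars 𝕜 ∘ₗ
    map (Algebra.TensorProduct.includeLeft
      (R := 𝕜) (S := 𝕜) (A := R) (B := FN n 𝕜)).toLinearMap

/-- `ω ↦ ω_<0> ⊗ S(ω_<1>)`. -/
def coactAnti [CharZero 𝕜] : Forms n R →ₗ[𝕜] Forms n (R ⊗[𝕜] FN n 𝕜) :=
  map (LinearMap.lTensor R (HopfAlgebra.antipode 𝕜 (A := FN n 𝕜))) ∘ₗ coact R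

end Forms

end FormsSection

/-! ### The bicomplex -/

section Bicomplex

variable (n : ℕ) (𝕜 : Type u) [Field 𝕜]

/-- The `q`-th column `⨁_p Ω^{≤1} ⊗ ⋀^p s^* ⊗ F(N)^{⊗ q}`. -/
abbrev Coch (q : ℕ) : Type u := ExtS n 𝕜 ⊗[𝕜] Forms n (Tens n 𝕜 q)

/-- The multiplication by `(-1)^p` on `C^{p,q}`. -/
def sgn (q : ℕ) : Coch n 𝕜 q →ₗ[𝕜] Coch n 𝕜 q :=
  TensorProduct.map (parity n 𝕜).toLinearMap LinearMap.id

/-- The space `C^{*,*} = ⨁_{p,q} Ω^{≤1} ⊗ ⋀^p s^* ⊗ F(N)^{⊗ q}`. -/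
abbrev Bicomplex : Type u := DirectSum ℕ fun q => Coch n 𝕜 q

/-- The inclusion of the `q`-th column. -/
abbrev column (q : ℕ) : Coch n 𝕜 q →ₗ[𝕜] Bicomplex n 𝕜 :=
  DirectSum.lof 𝕜 ℕ (fun q => Coch n 𝕜 q) q

/-- The bilinear map on the bicomplex with given components. -/
def bilin (B : ∀ q q', Coch n 𝕜 q →ₗ[𝕜] Coch n 𝕜 q' →ₗ[𝕜] Coch n 𝕜 (q + q')) :
    Bicomplex n 𝕜 →ₗ[𝕜] Bicomplex n 𝕜 →ₗ[𝕜] Bicomplex n 𝕜 :=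
  DirectSum.toModule 𝕜 ℕ _ fun q => LinearMap.flip (DirectSum.toModule 𝕜 ℕ _ fun q' =>
    LinearMap.flip ((B q q').compr₂ (column n 𝕜 (q + q'))))

theorem bilin_column (B : ∀ q q', Coch n 𝕜 q →ₗ[𝕜] Coch n 𝕜 q' →ₗ[𝕜] Coch n 𝕜 (q + q'))
    (q q' : ℕ) (x : Coch n 𝕜 q) (y : Coch n 𝕜 q') :
    bilin n 𝕜 B (column n 𝕜 q x) (column n 𝕜 q' y) = column n 𝕜 (q + q') (B q q' x y) := by
  simp [bilin, DirectSum.toModule_lof]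

/-- The subspace of the forms of degree `0`. -/
def formsZero (R : Type v) [CommRing R] [Algebra 𝕜 R] : Submodule 𝕜 (Forms n R) :=
  LinearMap.range (LinearMap.inl 𝕜 (PS n R) (Fin n → PS n R))

/-- The subspace of the forms of degree `1`. -/
def formsOne (R : Type v) [CommRing R] [Algebra 𝕜 R] : Submodule 𝕜 (Forms n R) :=
  LinearMap.range (LinearMap.inr 𝕜 (PS n R) (Fin n → PS n R))

/-- The subspace `W ⊗ ⋀^p s^*` of the `q`-th column, for a space `W` of forms with coefficients in
`F(N)^{⊗ q}`. -/
def homogeneous (p q : ℕ) (W : Submodule 𝕜 (Forms n (Tens n 𝕜 q))) : Submodule 𝕜 (Bicomplex n 𝕜) :=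
  (LinearMap.range (TensorProduct.map (⋀[𝕜]^p (DualS n 𝕜)).subtype W.subtype)).map
    (column n 𝕜 q)

/-- `C^{p,q}(Ω^{≤1}, s^*, F(N)) = Ω^{≤1} ⊗ ⋀^p s^* ⊗ F(N)^{⊗ q}`. -/
def C (p q : ℕ) : Submodule 𝕜 (Bicomplex n 𝕜) := homogeneous n 𝕜 p q ⊤

/-- `C^{p,q}(Ω⁰, s^*, F(N)) = Ω⁰ ⊗ ⋀^p s^* ⊗ F(N)^{⊗ q}`. -/
def CZero (p q : ℕ) : Submodule 𝕜 (Bicomplex n 𝕜) := homogeneous n 𝕜 p q (formsZero n 𝕜 _)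

/-- `C^{p,q}(Ω¹, s^*, F(N)) = Ω¹ ⊗ ⋀^p s^* ⊗ F(N)^{⊗ q}`. -/
def COne (p q : ℕ) : Submodule 𝕜 (Bicomplex n 𝕜) := homogeneous n 𝕜 p q (formsOne n 𝕜 _)

theorem homogeneous_mono (p q : ℕ) {W W' : Submodule 𝕜 (Forms n (Tens n 𝕜 q))} (h : W ≤ W') :
    homogeneous n 𝕜 p q W ≤ homogeneous n 𝕜 p q W' := by
  refine Submodule.map_mono ?_
  rintro _ ⟨w, rfl⟩
  refine ⟨TensorProduct.map LinearMap.id (Submodule.inclusion h) w, ?_⟩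
  rw [← LinearMap.comp_apply, ← TensorProduct.map_comp, LinearMap.comp_id,
    Submodule.subtype_comp_inclusion]

theorem parity_exteriorPower {p : ℕ} {η : ExtS n 𝕜} (hη : η ∈ ⋀[𝕜]^p (DualS n 𝕜)) :
    parity n 𝕜 η = (-1 : 𝕜) ^ p • η := by
  induction hη using Submodule.pow_induction_on_left' with
  | algebraMap r => simp
  | add x y i hx hy h1 h2 => rw [map_add, h1, h2, smul_add]
  | mem_mul m hm i x hx h =>
    obtain ⟨θ, rfl⟩ := hm
    rw [map_mul, h, parity_ι, pow_succ', neg_mul, mul_smul_comm, neg_one_mul, neg_smul]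

theorem sgn_map {p q : ℕ} (W : Submodule 𝕜 (Forms n (Tens n 𝕜 q))) (w : ⋀[𝕜]^p (DualS n 𝕜) ⊗[𝕜] W) :
    sgn n 𝕜 q (TensorProduct.map (⋀[𝕜]^p (DualS n 𝕜)).subtype W.subtype w) =
      (-1 : 𝕜) ^ p • TensorProduct.map (⋀[𝕜]^p (DualS n 𝕜)).subtype W.subtype w := by
  have hp : (parity n 𝕜).toLinearMap ∘ₗ (⋀[𝕜]^p (DualS n 𝕜)).subtype =
      (-1 : 𝕜) ^ p • (⋀[𝕜]^p (DualS n 𝕜)).subtype :=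
    LinearMap.ext fun η => parity_exteriorPower n 𝕜 η.2
  rw [sgn, ← LinearMap.comp_apply, ← TensorProduct.map_comp, hp, LinearMap.id_comp,
    TensorProduct.map_smul_left, LinearMap.smul_apply]

variable [CharZero 𝕜]

variable {n 𝕜}

/-- The map `ω ⊗ η ⊗ f ↦ ω_<0> ⊗ η_<0> ⊗ J(f ⊗ S(ω_<1>) η_<-1>)`. -/
def tailCoact {A B : Type u} [CommRing A] [Algebra 𝕜 A] [CommRing B] [Algebra 𝕜 B]
    (J : A ⊗[𝕜] FN n 𝕜 →ₐ[𝕜] B) : ExtS n 𝕜 ⊗[𝕜] Forms n A →ₗ[𝕜] ExtS n 𝕜 ⊗[𝕜] Forms n B :=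
  TensorProduct.lift (TensorProduct.lift (LinearMap.mk₂ 𝕜
    (fun (h : FN n 𝕜) (η : ExtS n 𝕜) =>
      (TensorProduct.mk 𝕜 (ExtS n 𝕜) (Forms n B) η ∘ₗ Forms.map J.toLinearMap ∘ₗ
        Forms.map (LinearMap.mulLeft 𝕜 ((1 : A) ⊗ₜ[𝕜] h)) ∘ₗ Forms.coactAnti A :
          Forms n A →ₗ[𝕜] ExtS n 𝕜 ⊗[𝕜] Forms n B))
    (fun h h' η => LinearMap.ext fun m => by
      have e : LinearMap.mulLeft 𝕜 ((1 : A) ⊗ₜ[𝕜] (h + h')) =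
          LinearMap.mulLeft 𝕜 ((1 : A) ⊗ₜ[𝕜] h) + LinearMap.mulLeft 𝕜 ((1 : A) ⊗ₜ[𝕜] h') :=
        LinearMap.ext fun x => by simp [TensorProduct.tmul_add, add_mul]
      simp only [LinearMap.comp_apply, LinearMap.add_apply, e, Forms.map_add_left, map_add])
    (fun c h η => LinearMap.ext fun m => by
      have e : LinearMap.mulLeft 𝕜 ((1 : A) ⊗ₜ[𝕜] (c • h)) =
          c • LinearMap.mulLeft 𝕜 ((1 : A) ⊗ₜ[𝕜] h) :=
        LinearMap.ext fun x => by simp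
      simp only [LinearMap.comp_apply, LinearMap.smul_apply, e, Forms.map_smul_left, map_smul])
    (fun h η η' => by
      rw [map_add, LinearMap.add_comp])
    (fun c h η => by
      rw [map_smul, LinearMap.smul_comp])) ∘ₗ (coactExt n 𝕜).toLinearMap)

/-- The horizontal coboundary
`b_N^*(ω ⊗ η ⊗ f) = ω ⊗ η ⊗ 1 ⊗ f + ∑ᵢ (-1)ⁱ ω ⊗ η ⊗ Δᵢ(f)
  + (-1)^{q+1} ω_<0> ⊗ η_<0> ⊗ f ⊗ S(ω_<1>) η_<-1>`. -/
def bN (q : ℕ) : Coch n 𝕜 q →ₗ[𝕜] Coch n 𝕜 (q + 1) :=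
  TensorProduct.map LinearMap.id (Forms.map (Tens.place n 𝕜 Fin.succ).toLinearMap) +
  ∑ i : Fin q, (-1 : 𝕜) ^ (i.val + 1) •
    TensorProduct.map LinearMap.id (Forms.map (Tens.comulAt n 𝕜 i).toLinearMap) +
  (-1 : 𝕜) ^ (q + 1) • tailCoact (Algebra.TensorProduct.productMap
    (Tens.place n 𝕜 Fin.castSucc) (Tens.slot n 𝕜 (Fin.last q)))

/-- The action of `s` on `Ω^{≤1} ⊗ F(N)^{⊗ q}`, `X · (ω ⊗ f) = X · ω ⊗ f + ω ⊗ X • f`. -/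
def actCoeff (q : ℕ) (Z : GlAff n 𝕜) : Module.End 𝕜 (Forms n (Tens n 𝕜 q)) :=
  Forms.act Z + Forms.map (Tens.bullet n 𝕜 q Z)

/-- The vertical coboundary
`d_CE(ω ⊗ η ⊗ f) = ω ⊗ d_DR η ⊗ f - X_i · ω ⊗ v^i ∧ η ⊗ f - ω ⊗ v^i ∧ η ⊗ X_i • f`,
where `X_i` runs through a basis of `s` and `v^i` through the dual basis. -/
def dCE (q : ℕ) : Coch n 𝕜 q →ₗ[𝕜] Coch n 𝕜 q :=
  TensorProduct.map (deRham n 𝕜) LinearMap.id -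
    ∑ b, TensorProduct.map (LinearMap.mulLeft 𝕜 (ExteriorAlgebra.ι 𝕜 (dualBasis n 𝕜 b)))
      (actCoeff q (GlAff.basis n 𝕜 b))

/-- The cup product
`(a ⊗ η ⊗ f) ∪ (ω ⊗ ζ ⊗ g) = a_<0> ω ⊗ η_<0> ∧ ζ ⊗ f ⊗ S(a_<1>) η_<-1> · g`. -/
def cup (q q' : ℕ) : Coch n 𝕜 q →ₗ[𝕜] Coch n 𝕜 q' →ₗ[𝕜] Coch n 𝕜 (q + q') :=
  (TensorProduct.map₂ (LinearMap.mul 𝕜 (ExtS n 𝕜)) Forms.wedge).compl₁₂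
    (tailCoact (Algebra.TensorProduct.productMap (Tens.place n 𝕜 (Fin.castAdd q'))
      ((Tens.place n 𝕜 (Fin.natAdd q)).comp (Tens.iterComul n 𝕜 q'))))
    (TensorProduct.map LinearMap.id (Forms.map (Tens.place n 𝕜 (Fin.natAdd q)).toLinearMap))

variable (n 𝕜)

/-- The vertical coboundary of the bicomplex. -/
def vertical : Bicomplex n 𝕜 →ₗ[𝕜] Bicomplex n 𝕜 :=
  DirectSum.toModule 𝕜 ℕ _ fun q => column n 𝕜 q ∘ₗ dCE q

/-- The horizontal coboundary of the bicomplex. -/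
def horizontal : Bicomplex n 𝕜 →ₗ[𝕜] Bicomplex n 𝕜 :=
  DirectSum.toModule 𝕜 ℕ _ fun q => column n 𝕜 (q + 1) ∘ₗ bN q

/-- The cup product on the bicomplex. -/
def cupProd : Bicomplex n 𝕜 →ₗ[𝕜] Bicomplex n 𝕜 →ₗ[𝕜] Bicomplex n 𝕜 := bilin n 𝕜 cup

/-- The product `x * y = (-1)^{q p'} x ∪ y`, for `x` in the `q`-th column and `y` in the
`p'`-th row. -/
def starProd : Bicomplex n 𝕜 →ₗ[𝕜] Bicomplex n 𝕜 →ₗ[𝕜] Bicomplex n 𝕜 :=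
  bilin n 𝕜 fun q q' => (cup q q').compl₂ (sgn n 𝕜 q' ^ q)

variable {n 𝕜} in
/-- The sign in `x * y` on homogeneous elements. -/
theorem starProd_eq {p q p' q' : ℕ} {x y : Bicomplex n 𝕜} (hx : x ∈ C n 𝕜 p q)
    (hy : y ∈ C n 𝕜 p' q') :
    starProd n 𝕜 x y = (-1 : 𝕜) ^ (q * p') • cupProd n 𝕜 x y := by
  obtain ⟨x, -, rfl⟩ := hx
  obtain ⟨y, ⟨w, rfl⟩, rfl⟩ := hy
  have h : ∀ k : ℕ, (sgn n 𝕜 q' ^ k)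
      (TensorProduct.map (⋀[𝕜]^p' (DualS n 𝕜)).subtype (Submodule.subtype ⊤) w) =
      (-1 : 𝕜) ^ (k * p') •
        TensorProduct.map (⋀[𝕜]^p' (DualS n 𝕜)).subtype (Submodule.subtype ⊤) w := by
    intro k
    induction k with
    | zero => simp
    | succ k ih =>
      rw [pow_succ', Module.End.mul_apply, ih, map_smul, sgn_map, smul_smul, ← pow_add]
      congr 2
      ring
  rw [starProd, cupProd, bilin_column, bilin_column, LinearMap.compl₂_apply, h, map_smul, map_smul]

end Bicomplex

end HopfCyclic

end

/-! The proof replaces computations in the Hopf algebra by computations with points. An algebra map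
`g : F(N) → B` is the same thing as an element `FN.point g` of `N` with coefficients in `B`; the
coproduct becomes composition and the antipode becomes inversion. Two algebra maps are compared by
comparing their points (`FN.point_injective`).

The last face of the horizontal coboundary and the cup product use one common operation, `pullC j
g`: pull a form back along the point `ψ` given by `g`, and apply to the exterior factor the coaction
evaluated at `ψ`. No inverse remains, because the antipode undoes the inverse in the coaction on
forms (`Forms.coactAnti_apply`). With cochains read as functions of points of `N`, the cup product
is therefore the usual one of group cohomology: `x(ψ₁,…,ψ_q)`, acted on by `ψ_{q+1}⋯ψ_{q+q'}`, times
`y(ψ_{q+1},…,ψ_{q+q'})`.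

Horizontally, the Leibniz rule `bN_cup` is the one for group cochains. It needs only that `N` acts
from the right (`pullC_pullC`) and by algebra maps (`pullC_mulC`): each face of `x ∪ y` is a face of
`x` or of `y`, while the last face of `x` and the first face of `y` give the same term with opposite
signs (`cup_pullC_castSucc`).

Vertically, the Chevalley-Eilenberg differential is an odd derivation as soon as `s` acts by
derivations (`diffC_mulC`), so `dCE_cup` reduces to its commuting with `pullC`, which is
`diffC_pullC`. The actions of `s` and `N` do not commute: moving `Z` past `ψ` turns it into `ψ ▷ Z =
Z_<0> Z_<1>(ψ)`, here called `twist`. Since the functions `η` are additive on `N`, successive twists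
simply add (`twist_twist`). Three compatibilities carry the argument. Functions:
`derivation_eval_mul` differentiates a composite of points, and yields the equivariance of the
iterated coproduct (`Tens.bullet_iterComul`). Exterior algebra: `extDer_coactExt` says that the
coaction on `⋀ s^*` intertwines the differentials, by the symmetry of second and third derivatives.
Forms: `Forms.act_add_map_pull` differentiates a pull-back along a moving point. The first and the
third rest on the chain rule `Forms.derivation_subst` and on `derivation_comp_iff`, which describes
the action of `s` on functions as the motion of a point of `N` with prescribed velocity.

The sign `(-1)^{qp'}` in the product then turns the two separate Leibniz rules, with signs `(-1)^p`
and `(-1)^q`, into a single one for the total differential. -/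

noncomputable section

namespace HopfCyclic

open scoped TensorProduct Matrix

universe u v w

/-! ### Derivations of power series and the chain rule -/

namespace Forms

variable {n : ℕ} {𝕜 : Type u} [Field 𝕜] {R : Type v} {A : Type w} [CommRing R] [Algebra 𝕜 R]
  [CommRing A] [Algebra 𝕜 A]

theorem psMap_C (u : R →ₗ[𝕜] A) (r : R) :
    psMap (n := n) u (MvPowerSeries.C r) = MvPowerSeries.C (u r) := by
  ext J
  rw [coeff_psMap, MvPowerSeries.coeff_C, MvPowerSeries.coeff_C]
  split_ifs <;> simp

/-- Partial derivatives multiply coefficients by natural numbers, so any additive map of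
coefficients commutes with them, multiplicative or not. This matters because `u` will often be a
derivation. -/
theorem psMap_pderiv (u : R →ₗ[𝕜] A) (f : PS n R) (j : Fin n) :
    psMap u (MvPowerSeries.pderiv R j f) = MvPowerSeries.pderiv A j (psMap u f) := by
  ext J
  have h : ∀ b : R, b * ((J j : R) + 1) = (J j + 1) • b := fun b => by
    rw [nsmul_eq_mul]; push_cast; ring
  rw [coeff_psMap, MvPowerSeries.coeff_pderiv, MvPowerSeries.coeff_pderiv, coeff_psMap, h,
    map_nsmul, nsmul_eq_mul]
  push_cast; ring

theorem pderiv_comm (f : PS n R) (i j : Fin n) :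
    MvPowerSeries.pderiv R i (MvPowerSeries.pderiv R j f) =
      MvPowerSeries.pderiv R j (MvPowerSeries.pderiv R i f) := by
  ext J
  simp only [MvPowerSeries.coeff_pderiv]
  by_cases h : i = j
  · subst h; rfl
  · simp only [Finsupp.add_apply, Finsupp.single_apply, h, Ne.symm h, if_false, add_zero]
    rw [add_right_comm]
    ring

/-- The coefficientwise extension of a derivation to power series. -/
def psDer (D : Derivation 𝕜 R R) : Derivation 𝕜 (PS n R) (PS n R) :=
  Derivation.mk' (psMap D.toLinearMap) fun f g => by
    ext J
    classical
    simp only [coeff_psMap, map_add, smul_eq_mul, MvPowerSeries.coeff_mul, map_sum,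
      Derivation.coeFn_coe, Derivation.leibniz,
      Finset.sum_add_distrib]
    congr 1
    exact Finset.sum_equiv (Equiv.prodComm _ _) (fun x => by simp [add_comm]) fun x _ => rfl

theorem psDer_apply (D : Derivation 𝕜 R R) (f : PS n R) :
    psDer D f = psMap D.toLinearMap f := rfl

theorem coeff_psDer (D : Derivation 𝕜 R R) (f : PS n R) (J : Fin n →₀ ℕ) :
    MvPowerSeries.coeff J (psDer D f) = D (MvPowerSeries.coeff J f) := rfl

theorem le_order_psDer (D : Derivation 𝕜 R R) (f : PS n R) : f.order ≤ (psDer D f).order :=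
  MvPowerSeries.le_order fun d hd => by
    rw [coeff_psDer, MvPowerSeries.coeff_of_lt_order hd, map_zero]

theorem le_order_pderiv (j : Fin n) {f : PS n R} {d : ℕ} (hf : ((d + 1 : ℕ) : ℕ∞) ≤ f.order) :
    (d : ℕ∞) ≤ (MvPowerSeries.pderiv R j f).order :=
  MvPowerSeries.le_order fun e he => by
    have he' : e.degree < d := by exact_mod_cast he
    rw [MvPowerSeries.coeff_pderiv, MvPowerSeries.coeff_of_lt_order, zero_mul]
    refine lt_of_lt_of_le ?_ hf
    rw [map_add, Finsupp.degree_single]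
    exact_mod_cast Nat.succ_lt_succ he'

/-- The chain rule for a derivation of the algebra of power series lowering orders by at most one,
applied to a composition with an element of `N`. -/
theorem derivation_subst (φ : Diffeo n R) (𝔇 : Derivation 𝕜 (PS n R) (PS n R))
    (D : Derivation 𝕜 R R) (hC : ∀ r, 𝔇 (MvPowerSeries.C r) = MvPowerSeries.C (D r))
    (hord : ∀ (f : PS n R) (d : ℕ), ((d + 1 : ℕ) : ℕ∞) ≤ f.order → (d : ℕ∞) ≤ (𝔇 f).order)
    (f : PS n R) :
    𝔇 (MvPowerSeries.substAlgHom φ.hasSubst f) =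
      MvPowerSeries.substAlgHom φ.hasSubst (psDer D f) +
      ∑ i, MvPowerSeries.substAlgHom φ.hasSubst (MvPowerSeries.pderiv R i f) * 𝔇 (φ.toFun i) := by
  set s : PS n R →ₐ[R] PS n R := MvPowerSeries.substAlgHom φ.hasSubst with hs
  have hsC : ∀ r : R, s (MvPowerSeries.C r) = MvPowerSeries.C r := fun r => by
    rw [hs, MvPowerSeries.coe_substAlgHom, MvPowerSeries.subst_C]
  -- `E` is the defect of the chain rule. It vanishes on polynomials by induction and lowers orders
  -- by at most one, so approximation by truncations kills it on all series.
  let E : PS n R →+ PS n R :=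
    { toFun := fun f => 𝔇 (s f) - (s (psDer D f) +
        ∑ i, s (MvPowerSeries.pderiv R i f) * 𝔇 (φ.toFun i))
      map_zero' := by simp
      map_add' := fun f g => by
        simp only [map_add, add_mul, Finset.sum_add_distrib]
        abel }
  have hE : ∀ f, E f = 𝔇 (s f) - (s (psDer D f) +
        ∑ i, s (MvPowerSeries.pderiv R i f) * 𝔇 (φ.toFun i)) := fun f => rfl
  have hpoly : ∀ p : MvPolynomial (Fin n) R, E p = 0 := by
    intro p
    induction p using MvPolynomial.induction_on with
    | C r =>
      rw [MvPolynomial.coe_C, hE, hsC, hC, psDer_apply, psMap_C, hsC]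
      simp
    | add p q hp hq => rw [MvPolynomial.coe_add, map_add, hp, hq, add_zero]
    | mul_X p i hp =>
      rw [hE, sub_eq_zero] at hp
      have hX : psDer D (MvPowerSeries.X i : PS n R) = 0 := by
        ext J
        classical
        rw [coeff_psDer, MvPowerSeries.coeff_X]
        split_ifs <;> simp
      rw [MvPolynomial.coe_mul, MvPolynomial.coe_X, hE, sub_eq_zero, map_mul, Derivation.leibniz,
        hp, Derivation.leibniz, hX]
      have hsX : s (MvPowerSeries.X i) = φ.toFun i := MvPowerSeries.substAlgHom_X _ _
      have hsum : ∑ j, s p * (s (MvPowerSeries.pderiv R j (MvPowerSeries.X i)) * 𝔇 (φ.toFun j)) =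
          s p * 𝔇 (φ.toFun i) := by
        rw [Finset.sum_eq_single i]
        · rw [MvPowerSeries.pderiv_X_self, map_one, one_mul]
        · intro j _ hj
          rw [MvPowerSeries.pderiv_X_of_ne hj.symm, map_zero, zero_mul, mul_zero]
        · simp
      simp only [Derivation.leibniz, smul_eq_mul, map_add, map_mul, hsX, mul_zero, zero_add,
        add_mul, Finset.sum_add_distrib, mul_add, Finset.mul_sum, mul_assoc, hsum]
      abel
  have hEord : ∀ (f : PS n R) (d : ℕ), ((d + 1 : ℕ) : ℕ∞) ≤ f.order → (d : ℕ∞) ≤ (E f).order := by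
    intro f d hf
    have hs_ord : ∀ g : PS n R, g.order ≤ (s g).order := fun g => by
      rw [hs, MvPowerSeries.coe_substAlgHom]
      exact φ.le_order_comp g
    have hd : (d : ℕ∞) ≤ f.order := le_trans (by exact_mod_cast Nat.le_succ d) hf
    rw [hE, sub_eq_add_neg]
    refine le_trans (le_min (hord _ _ (hf.trans (hs_ord f))) ?_) MvPowerSeries.min_order_le_add
    rw [MvPowerSeries.order_neg]
    refine le_trans (le_min (hd.trans ((le_order_psDer D f).trans (hs_ord _))) ?_)
      MvPowerSeries.min_order_le_add
    refine Finset.sum_induction _ (fun g : PS n R => (d : ℕ∞) ≤ g.order)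
      (fun a b ha hb => le_trans (le_min ha hb) MvPowerSeries.min_order_le_add) (by simp) ?_
    intro i _
    refine le_trans ?_ MvPowerSeries.le_order_mul
    exact ((le_order_pderiv i hf).trans (hs_ord _)).trans le_self_add
  rw [← sub_eq_zero]
  change E f = 0
  rw [← MvPowerSeries.order_eq_top_iff, ENat.eq_top_iff_forall_ge]
  intro d
  -- Truncation at total degree `d + 1` leaves a remainder of order at least `d + 1`, whose defect
  -- has order at least `d`; and `d` is arbitrary.
  have : f = ((MvPowerSeries.truncTotal (d + 1) f : MvPolynomial (Fin n) R) : PS n R) +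
      (f - (MvPowerSeries.truncTotal (d + 1) f : MvPolynomial (Fin n) R)) := by abel
  rw [this, map_add, hpoly, zero_add]
  refine hEord _ _ (MvPowerSeries.le_order fun e he => ?_)
  rw [map_sub, MvPolynomial.coeff_coe, MvPowerSeries.coeff_truncTotal _ (by exact_mod_cast he),
    sub_self]

theorem psDer_subst (φ : Diffeo n R) (D : Derivation 𝕜 R R) (f : PS n R) :
    psDer D (MvPowerSeries.substAlgHom φ.hasSubst f) =
      MvPowerSeries.substAlgHom φ.hasSubst (psDer D f) +
      ∑ i, MvPowerSeries.substAlgHom φ.hasSubst (MvPowerSeries.pderiv R i f) *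
        psDer D (φ.toFun i) :=
  derivation_subst φ (psDer D) D (fun r => psMap_C _ r)
    (fun f d hf => le_trans (le_trans (by exact_mod_cast Nat.le_succ d) hf) (le_order_psDer D f)) f

/-- The case `D = 0` of `derivation_subst`, since `∂_j` kills constant series. The field `𝕜` does
not occur in the conclusion and has to be supplied. -/
theorem pderiv_subst (𝕜 : Type u) [Field 𝕜] [Algebra 𝕜 R] (φ : Diffeo n R) (j : Fin n)
    (f : PS n R) :
    MvPowerSeries.pderiv R j (MvPowerSeries.substAlgHom φ.hasSubst f) =
      ∑ i, MvPowerSeries.substAlgHom φ.hasSubst (MvPowerSeries.pderiv R i f) *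
        MvPowerSeries.pderiv R j (φ.toFun i) := by
  have h := derivation_subst (𝕜 := 𝕜) φ ((MvPowerSeries.pderiv R j).restrictScalars 𝕜) 0
    (fun r => MvPowerSeries.pderiv_C.trans (map_zero _).symm)
    (fun f d hf => le_order_pderiv j hf) f
  have h0 : psDer (0 : Derivation 𝕜 R R) f = 0 := by
    ext J
    rw [coeff_psDer]; rfl
  rwa [h0, map_zero, zero_add] at h

end Forms

/-! ### Points of `N`, additivity of the functions `η`, and twisting -/

section Points

variable {n : ℕ} {𝕜 : Type u} [Field 𝕜] {A : Type v} [CommRing A] [Algebra 𝕜 A]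
  {B : Type w} [CommRing B] [Algebra 𝕜 B]

theorem FN.induction {P : FN n 𝕜 → Prop} (hC : ∀ c : 𝕜, P (algebraMap 𝕜 _ c))
    (hadd : ∀ f g, P f → P g → P (f + g)) (hmul : ∀ f a, P f → P (f * FN.coord a))
    (f : FN n 𝕜) : P f :=
  MvPolynomial.induction_on (motive := P) f hC hadd hmul

/-- The point of `N` corresponding to an algebra map out of `F(N)`. -/
def FN.point (g : FN n 𝕜 →ₐ[𝕜] B) : Diffeo n B := Diffeo.map g.toRingHom (FN.univ n 𝕜)

theorem FN.point_comp (f : FN n 𝕜 →ₐ[𝕜] A) (g : A →ₐ[𝕜] B) :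
    FN.point (g.comp f) = Diffeo.map g.toRingHom (FN.point f) := FN.map_comp_univ f g

theorem FN.point_toFun (g : FN n 𝕜 →ₐ[𝕜] B) (i : Fin n) :
    (FN.point g).toFun i = MvPowerSeries.map g.toRingHom ((FN.univ n 𝕜).toFun i) := rfl

theorem FN.eval_point [CharZero 𝕜] (g : FN n 𝕜 →ₐ[𝕜] B) : FN.eval (FN.point g) = g :=
  FN.eval_map_univ g

theorem FN.point_eval [CharZero 𝕜] (φ : Diffeo n B) : FN.point (FN.eval (𝕜 := 𝕜) φ) = φ :=
  FN.map_eval_univ φ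

theorem FN.point_injective [CharZero 𝕜] {f g : FN n 𝕜 →ₐ[𝕜] B}
    (h : FN.point f = FN.point g) : f = g := FN.algHom_ext_univ h

/-- The function `η^i_{jk}`, indexed by triples. -/
def etaT (t : Fin n × Fin n × Fin n) : FN n 𝕜 := eta t.1 t.2.1 t.2.2

theorem eta_symm (i j k : Fin n) : (eta i j k : FN n 𝕜) = eta i k j := by
  unfold eta
  congr 3
  exact add_comm _ _

theorem multiFactorial_single_add_single (j k : Fin n) :
    multiFactorial (Finsupp.single j 1 + Finsupp.single k 1) = if j = k then 2 else 1 := by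
  unfold multiFactorial
  split_ifs with h
  · subst h
    rw [← Finsupp.single_add, Finset.prod_eq_single j]
    · simp
    · intro b _ hb
      simp [hb.symm]
    · simp
  · refine Finset.prod_eq_one fun i _ => ?_
    simp only [Finsupp.add_apply, Finsupp.single_apply]
    split_ifs with h1 h2 <;> simp
    exact absurd (h1.trans h2.symm) h

theorem constantCoeff_pderiv (f : PS n B) (j : Fin n) :
    MvPowerSeries.constantCoeff (MvPowerSeries.pderiv B j f) =
      MvPowerSeries.coeff (Finsupp.single j 1) f := by
  rw [← MvPowerSeries.coeff_zero_eq_constantCoeff_apply, MvPowerSeries.coeff_pderiv]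
  simp

/-- The factorial `J!` absorbs the factor `2` that appears exactly when `j = k`, which is the
normalisation of the jet coordinates. -/
theorem constantCoeff_pderiv_pderiv (f : PS n B) (j k : Fin n) :
    MvPowerSeries.constantCoeff (MvPowerSeries.pderiv B j (MvPowerSeries.pderiv B k f)) =
      multiFactorial (Finsupp.single j 1 + Finsupp.single k 1) •
        MvPowerSeries.coeff (Finsupp.single j 1 + Finsupp.single k 1) f := by
  rw [constantCoeff_pderiv, MvPowerSeries.coeff_pderiv, multiFactorial_single_add_single,
    Finsupp.single_apply]
  split_ifs with h
  · rw [nsmul_eq_mul]; push_cast; ring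
  · simp

theorem Diffeo.constantCoeff_pderiv (φ : Diffeo n B) (i j : Fin n) :
    MvPowerSeries.constantCoeff (MvPowerSeries.pderiv B j (φ.toFun i)) =
      if i = j then 1 else 0 := by
  rw [HopfCyclic.constantCoeff_pderiv, φ.deriv_zero]

theorem FN.eval_eta (φ : Diffeo n B) (i j k : Fin n) : FN.eval (𝕜 := 𝕜) φ (eta i j k) =
    MvPowerSeries.constantCoeff (MvPowerSeries.pderiv B j (MvPowerSeries.pderiv B k
      (φ.toFun i))) := by
  rw [constantCoeff_pderiv_pderiv]
  exact FN.eval_coord _ _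

/-- The functions `η^i_{jk}` are additive on `N`. -/
theorem FN.eval_mul_etaT (φ ψ : Diffeo n B) (t : Fin n × Fin n × Fin n) :
    FN.eval (𝕜 := 𝕜) (φ * ψ) (etaT t) =
      FN.eval (𝕜 := 𝕜) φ (etaT t) + FN.eval (𝕜 := 𝕜) ψ (etaT t) := by
  obtain ⟨i, j, k⟩ := t
  simp only [etaT, FN.eval_eta, constantCoeff_pderiv_pderiv, ← smul_add]
  congr 1
  set J : Fin n →₀ ℕ := Finsupp.single j 1 + Finsupp.single k 1 with hJ
  have hd : J.degree = 2 := by rw [hJ, map_add, Finsupp.degree_single, Finsupp.degree_single]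
  -- Write `φ = x + (φ - x)`. The second summand has order at least two, so composition with `ψ`
  -- alters it only from degree three on, and the quadratic terms of `φ` and `ψ` add up.
  have h1 : (φ * ψ).toFun i = MvPowerSeries.subst ψ.toFun (φ.toFun i - MvPowerSeries.X i) +
      ψ.toFun i := by
    rw [MvPowerSeries.subst_sub ψ.hasSubst, MvPowerSeries.subst_X ψ.hasSubst, Diffeo.mul_toFun]
    abel
  have h2 := MvPowerSeries.coeff_of_lt_order (d := J) (lt_of_lt_of_le (by rw [hd]; norm_num)
    (ψ.order_sub_comp _ (d := 2) (φ.two_le_order_sub i)))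
  have h3 : MvPowerSeries.coeff J (MvPowerSeries.X i : PS n B) = 0 := by
    rw [MvPowerSeries.coeff_X, if_neg]
    intro h
    rw [h, Finsupp.degree_single] at hd
    omega
  rw [map_sub, sub_eq_zero, map_sub, h3, sub_zero] at h2
  rw [h1, map_add, ← h2]

theorem FN.eval_one_etaT (t : Fin n × Fin n × Fin n) :
    FN.eval (𝕜 := 𝕜) (1 : Diffeo n B) (etaT t) = 0 := by
  have h := FN.eval_mul_etaT (𝕜 := 𝕜) (1 : Diffeo n B) 1 t
  rw [one_mul] at h
  exact left_eq_add.1 h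

/-- `Z ↦ Z_<1> L(Z_<0>)` for the coaction on `gl_n^aff` whose coefficients `η` are replaced by
the values `E`. -/
def twist {M : Type*} [AddCommGroup M] [Module B M] (E : Fin n × Fin n × Fin n → B)
    (L : GlAff n 𝕜 → M) (Z : GlAff n 𝕜) : M :=
  L Z + ∑ t : Fin n × Fin n × Fin n,
    (GlAff.transl Z t.2.2 • E t) • L (GlAff.Y 𝕜 t.1 t.2.1)

theorem GlAff.transl_Y (i j : Fin n) : GlAff.transl (GlAff.Y 𝕜 i j) = 0 := rfl

theorem GlAff.lin_Y (i j : Fin n) : GlAff.lin (GlAff.Y 𝕜 i j) = Matrix.single i j 1 := rfl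

theorem GlAff.transl_X (k : Fin n) : GlAff.transl (GlAff.X 𝕜 k) = Pi.single k 1 := rfl

theorem GlAff.lin_X (k : Fin n) : GlAff.lin (GlAff.X 𝕜 k) = 0 := rfl

section Twist

variable {M : Type*} [AddCommGroup M] [Module B M]

theorem twist_Y (E : Fin n × Fin n × Fin n → B) (L : GlAff n 𝕜 → M) (i j : Fin n) :
    twist E L (GlAff.Y 𝕜 i j) = L (GlAff.Y 𝕜 i j) := by
  simp [twist, GlAff.transl_Y]

/-- A twist only adds multiples of the `Y_i^j`, which are themselves untwisted, so no quadratic term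
in the coefficients arises. Together with the additivity of `η` this is the comodule axiom for the
coaction on `s`. -/
theorem twist_twist (E E' : Fin n × Fin n × Fin n → B) (L : GlAff n 𝕜 → M) (Z : GlAff n 𝕜) :
    twist E (twist E' L) Z = twist (E + E') L Z := by
  conv_lhs => rw [twist]
  simp only [twist_Y]
  simp only [twist, Pi.add_apply, smul_add, add_smul, Finset.sum_add_distrib]
  abel

theorem twist_zero (L : GlAff n 𝕜 → M) : twist (0 : Fin n × Fin n × Fin n → B) L = L := by
  funext Z
  simp [twist]

theorem map_twist {M' : Type*} [AddCommGroup M'] [Module B M'] (u : M →ₗ[B] M')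
    (E : Fin n × Fin n × Fin n → B) (L : GlAff n 𝕜 → M) (Z : GlAff n 𝕜) :
    u (twist E L Z) = twist E (fun Z => u (L Z)) Z := by
  simp [twist]

end Twist

theorem coactS_apply (Z : GlAff n 𝕜) : coactS n 𝕜 Z = Z ⊗ₜ[𝕜] (1 : FN n 𝕜) +
    ∑ t : Fin n × Fin n × Fin n,
      GlAff.transl Z t.2.2 • (GlAff.Y 𝕜 t.1 t.2.1 ⊗ₜ[𝕜] (etaT t : FN n 𝕜)) := by
  have h : coactS n 𝕜 = (TensorProduct.mk 𝕜 (GlAff n 𝕜) (FN n 𝕜)).flip 1 +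
      ∑ t : Fin n × Fin n × Fin n, (LinearMap.proj t.2.2 ∘ₗ GlAff.transl).smulRight
        (GlAff.Y 𝕜 t.1 t.2.1 ⊗ₜ[𝕜] (etaT t : FN n 𝕜)) := by
    refine (GlAff.basis n 𝕜).ext fun b => ?_
    rcases b with k | ⟨i, j⟩
    · rw [GlAff.basis_inl, coactS_X]
      simp only [LinearMap.add_apply, LinearMap.flip_apply, TensorProduct.mk_apply,
        LinearMap.sum_apply, LinearMap.smulRight_apply, LinearMap.comp_apply,
        LinearMap.proj_apply, GlAff.transl_X, Pi.single_apply, Fintype.sum_prod_type, ite_smul,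
        one_smul, zero_smul, Finset.sum_ite_eq', Finset.mem_univ, if_true]
      rfl
    · rw [GlAff.basis_inr, coactS_Y]
      simp [GlAff.transl_Y]
  rw [h]
  simp

/-- `Z ↦ Z_<1>(φ) L(Z_<0>)` in terms of the coaction on `gl_n^aff`. -/
theorem lift_coactS {M : Type*} [AddCommGroup M] [Module 𝕜 M] [Module B M] [IsScalarTower 𝕜 B M]
    (T : GlAff n 𝕜 ⊗[𝕜] FN n 𝕜 →ₗ[𝕜] M) (g : FN n 𝕜 →ₐ[𝕜] B) (L : GlAff n 𝕜 → M)
    (hT : ∀ Z h, T (Z ⊗ₜ h) = g h • L Z) (Z : GlAff n 𝕜) :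
    T (coactS n 𝕜 Z) = twist (fun t => g (etaT t)) L Z := by
  rw [coactS_apply, map_add, hT, map_one, one_smul, map_sum, twist]
  congr 1
  refine Finset.sum_congr rfl fun t _ => ?_
  rw [map_smul, hT, smul_assoc]

end Points

/-! ### The infinitesimal motion of points of `N` -/

section Velocity

variable {n : ℕ} {𝕜 : Type u} [Field 𝕜] {A : Type v} [CommRing A] [Algebra 𝕜 A]
  {B : Type w} [CommRing B] [Algebra 𝕜 B]

theorem map_affineField (g : A →ₐ[𝕜] B) (Z : GlAff n 𝕜) (i : Fin n) :
    MvPowerSeries.map g.toRingHom (affineField n Z i) = affineField n (R := B) Z i := by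
  have h : ∀ c : 𝕜, MvPowerSeries.map g.toRingHom (algebraMap 𝕜 (PS n A) c) =
      algebraMap 𝕜 (PS n B) c := fun c => by
    rw [MvPowerSeries.algebraMap_apply, MvPowerSeries.algebraMap_apply, MvPowerSeries.map_C]
    congr 1
    exact g.commutes c
  simp only [affineField, LinearMap.coe_mk, AddHom.coe_mk, map_add, map_sum, map_mul,
    MvPowerSeries.map_X, h]

theorem map_pderiv (g : A →ₐ[𝕜] B) (f : PS n A) (j : Fin n) :
    MvPowerSeries.map g.toRingHom (MvPowerSeries.pderiv A j f) =
      MvPowerSeries.pderiv B j (MvPowerSeries.map g.toRingHom f) :=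
  Forms.psMap_pderiv g.toLinearMap f j

theorem map_substAlgHom (g : A →ₐ[𝕜] B) (φ : Diffeo n A) (f : PS n A) :
    MvPowerSeries.map g.toRingHom (MvPowerSeries.substAlgHom φ.hasSubst f) =
      MvPowerSeries.substAlgHom (Diffeo.map g.toRingHom φ).hasSubst
        (MvPowerSeries.map g.toRingHom f) := by
  rw [MvPowerSeries.coe_substAlgHom, MvPowerSeries.coe_substAlgHom,
    MvPowerSeries.map_subst φ.hasSubst]
  rfl

theorem pderiv_affineField (Z : GlAff n 𝕜) (i j : Fin n) :
    MvPowerSeries.pderiv B j (affineField n Z i) =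
      MvPowerSeries.C (algebraMap 𝕜 B (GlAff.lin Z i j)) := by
  have h : ∀ c : 𝕜, algebraMap 𝕜 (PS n B) c = MvPowerSeries.C (algebraMap 𝕜 B c) := fun c =>
    MvPowerSeries.algebraMap_apply
  simp only [affineField, LinearMap.coe_mk, AddHom.coe_mk, h, map_add, map_sum,
    MvPowerSeries.pderiv_C, Derivation.leibniz, smul_eq_mul, mul_zero, add_zero, zero_add]
  rw [Finset.sum_eq_single j]
  · rw [MvPowerSeries.pderiv_X_self, mul_one]
  · intro k _ hk
    rw [MvPowerSeries.pderiv_X_of_ne hk, mul_zero]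
  · simp

theorem constantCoeff_affineField (Z : GlAff n 𝕜) (i : Fin n) :
    MvPowerSeries.constantCoeff (affineField n (R := B) Z i) =
      algebraMap 𝕜 B (GlAff.transl Z i) := by
  have h : ∀ c : 𝕜, algebraMap 𝕜 (PS n B) c = MvPowerSeries.C (algebraMap 𝕜 B c) := fun c =>
    MvPowerSeries.algebraMap_apply
  simp [affineField, h]

/-- The infinitesimal motion of `φ ∈ N` in direction `Z`: the derivative of `φ` along `Z` minus the
affine field `φ ▷ Z` at `φ`, where `E` are the values of the `η` at `φ`. -/
def motion (φ : Diffeo n B) (E : Fin n × Fin n × Fin n → B) (Z : GlAff n 𝕜) (i : Fin n) : PS n B :=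
  (∑ j, affineField n Z j * MvPowerSeries.pderiv B j (φ.toFun i)) -
    MvPowerSeries.substAlgHom φ.hasSubst (twist E (affineField n (R := B)) Z i)

theorem actField_eq (Z : GlAff n 𝕜) :
    actField n 𝕜 Z = twist (etaT (𝕜 := 𝕜)) (affineField n (R := FN n 𝕜)) Z := by
  rw [actField, LinearMap.comp_apply]
  exact lift_coactS _ (AlgHom.id 𝕜 _) _ (fun Z h => rfl) Z

theorem velocity_eq (Z : GlAff n 𝕜) (i : Fin n) :
    velocity n 𝕜 Z i = motion (FN.univ n 𝕜) (etaT (𝕜 := 𝕜)) Z i := by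
  rw [motion, ← actField_eq]
  rfl

/-- Everything in the formula for the velocity is natural in the coefficient ring, so the universal
case specialises to every point. -/
theorem map_velocity (g : FN n 𝕜 →ₐ[𝕜] B) (Z : GlAff n 𝕜) (i : Fin n) :
    MvPowerSeries.map g.toRingHom (velocity n 𝕜 Z i) =
      motion (FN.point g) (fun t => g (etaT t)) Z i := by
  rw [velocity_eq, motion, motion, map_sub, map_sum, map_substAlgHom]
  congr 1
  · refine Finset.sum_congr rfl fun j _ => ?_
    rw [map_mul, map_affineField, map_pderiv, FN.point_toFun]
  · congr 1
    simp only [twist, Pi.add_apply, map_add, Finset.sum_apply, map_sum, Pi.smul_apply,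
      map_affineField]
    congr 1
    refine Finset.sum_congr rfl fun t _ => ?_
    rw [MvPowerSeries.smul_eq_C_mul, MvPowerSeries.smul_eq_C_mul, map_mul, map_affineField,
      MvPowerSeries.map_C]
    congr 2
    exact map_smul g _ _

theorem pderiv_twist_affineField (E : Fin n × Fin n × Fin n → B) (Z : GlAff n 𝕜) (i j : Fin n) :
    MvPowerSeries.pderiv B j (twist E (affineField n (R := B)) Z i) =
      MvPowerSeries.C (algebraMap 𝕜 B (GlAff.lin Z i j) +
        ∑ k, GlAff.transl Z k • E (i, j, k)) := by
  simp only [twist, Pi.add_apply, Finset.sum_apply, Pi.smul_apply, map_add, map_sum,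
    Derivation.map_smul, pderiv_affineField, GlAff.lin_Y]
  congr 1
  simp only [Fintype.sum_prod_type, MvPowerSeries.smul_eq_C_mul, ← map_mul, ← map_sum]
  rw [Finset.sum_eq_single i _ (by simp), Finset.sum_eq_single j _ (by simp)]
  · simp
  · intro b _ hb
    simp [hb]
  · intro a _ ha
    simp [ha]

theorem constantCoeff_twist_affineField (E : Fin n × Fin n × Fin n → B) (Z : GlAff n 𝕜)
    (i : Fin n) : MvPowerSeries.constantCoeff (twist E (affineField n (R := B)) Z i) =
      algebraMap 𝕜 B (GlAff.transl Z i) := by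
  simp only [twist, Pi.add_apply, Finset.sum_apply, Pi.smul_apply, map_add, map_sum,
    MvPowerSeries.smul_eq_C_mul, map_mul, constantCoeff_affineField, GlAff.transl_Y]
  simp

/-- Elements of `N` fix the origin. -/
theorem constantCoeff_substAlgHom (φ : Diffeo n B) (f : PS n B) :
    MvPowerSeries.constantCoeff (MvPowerSeries.substAlgHom φ.hasSubst f) =
      MvPowerSeries.constantCoeff f := by
  have h := MvPowerSeries.coeff_of_lt_order (d := 0) (lt_of_lt_of_le (by simp)
    (φ.order_sub_comp f (d := 0) (by simp)))
  rw [map_sub, sub_eq_zero] at h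
  rw [MvPowerSeries.coe_substAlgHom]
  exact h.symm

theorem pderiv_substAlgHom_twist (φ : Diffeo n B) (E : Fin n × Fin n × Fin n → B) (Z : GlAff n 𝕜)
    (i j : Fin n) : MvPowerSeries.pderiv B j
      (MvPowerSeries.substAlgHom φ.hasSubst (twist E (affineField n (R := B)) Z i)) =
      ∑ l, MvPowerSeries.C (algebraMap 𝕜 B (GlAff.lin Z i l) +
        ∑ k, GlAff.transl Z k • E (i, l, k)) * MvPowerSeries.pderiv B j (φ.toFun l) := by
  rw [Forms.pderiv_subst 𝕜]
  refine Finset.sum_congr rfl fun l _ => ?_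
  rw [pderiv_twist_affineField, MvPowerSeries.coe_substAlgHom, MvPowerSeries.subst_C]

/-- Affine fields have constant first derivatives, so differentiation leaves an explicit expression.
Evaluated at the origin it gives the tangency `two_le_order_velocity`, and after one more derivative
the action on `η` (`tri_eta`). -/
theorem pderiv_motion (φ : Diffeo n B) (E : Fin n × Fin n × Fin n → B) (Z : GlAff n 𝕜)
    (i j : Fin n) : MvPowerSeries.pderiv B j (motion φ E Z i) =
      ∑ l, (affineField n Z l * MvPowerSeries.pderiv B j (MvPowerSeries.pderiv B l (φ.toFun i)) +
        MvPowerSeries.C (algebraMap 𝕜 B (GlAff.lin Z l j)) *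
          MvPowerSeries.pderiv B l (φ.toFun i)) -
      ∑ l, MvPowerSeries.C (algebraMap 𝕜 B (GlAff.lin Z i l) +
        ∑ k, GlAff.transl Z k • E (i, l, k)) * MvPowerSeries.pderiv B j (φ.toFun l) := by
  rw [motion, map_sub, map_sum, pderiv_substAlgHom_twist]
  congr 1
  refine Finset.sum_congr rfl fun l _ => ?_
  rw [Derivation.leibniz, pderiv_affineField, smul_eq_mul, smul_eq_mul,
    mul_comm (MvPowerSeries.pderiv B l _)]

variable [CharZero 𝕜]

theorem FN.eval_univ : FN.eval (FN.univ n 𝕜) = AlgHom.id 𝕜 (FN n 𝕜) := by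
  have h := FN.eval_map_univ (AlgHom.id 𝕜 (FN n 𝕜))
  rwa [FN.map_id_univ] at h

theorem constantCoeff_pderiv_pderiv_univ (i j k : Fin n) :
    MvPowerSeries.constantCoeff (MvPowerSeries.pderiv (FN n 𝕜) j
      (MvPowerSeries.pderiv (FN n 𝕜) k ((FN.univ n 𝕜).toFun i))) = eta i j k := by
  rw [← FN.eval_eta (𝕜 := 𝕜), FN.eval_univ, AlgHom.id_apply]

/-- The velocity is tangent to `N`. As `ψ'(0) = Id`, the constant terms are both `v`, and the linear
terms are both `A + ψ''(0)(v, ·)`; the coaction on `s` is designed to produce the latter. -/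
theorem two_le_order_velocity (Z : GlAff n 𝕜) (i : Fin n) :
    2 ≤ (velocity n 𝕜 Z i).order := by
  refine MvPowerSeries.le_order (n := 2) fun d hd => ?_
  have hd' : d.degree < 2 := by exact_mod_cast hd
  rcases Nat.lt_succ_iff_lt_or_eq.1 hd' with h | h
  · have h0 : d = 0 := (Finsupp.degree_eq_zero_iff d).1 (Nat.lt_one_iff.1 h)
    subst h0
    rw [MvPowerSeries.coeff_zero_eq_constantCoeff_apply, velocity_eq, motion, map_sub,
      constantCoeff_substAlgHom, constantCoeff_twist_affineField, map_sum]
    simp only [map_mul, Diffeo.constantCoeff_pderiv, constantCoeff_affineField]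
    simp
  · obtain ⟨j, rfl⟩ := (Finsupp.sum_eq_one_iff d).1 h
    rw [← constantCoeff_pderiv, velocity_eq, pderiv_motion]
    simp only [map_sub, map_sum, map_add, map_mul, Diffeo.constantCoeff_pderiv,
      constantCoeff_affineField, MvPowerSeries.constantCoeff_C]
    simp only [mul_ite, mul_one, mul_zero, Finset.sum_add_distrib, Finset.sum_ite_eq,
      Finset.sum_ite_eq', Finset.mem_univ, if_true]
    rw [sub_eq_zero, add_comm]
    congr 1
    refine Finset.sum_congr rfl fun l _ => ?_
    rw [constantCoeff_pderiv_pderiv_univ, Algebra.smul_def]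
    rfl

/-- The derivation `Z ▷` of `F(N)` moves the universal point of `N` with velocity `velocity Z`. -/
theorem psDer_tri_univ (Z : GlAff n 𝕜) (i : Fin n) :
    Forms.psDer (tri n 𝕜 Z) ((FN.univ n 𝕜).toFun i) = velocity n 𝕜 Z i := by
  ext J
  rw [Forms.coeff_psDer]
  by_cases hJ : 2 ≤ J.degree
  · rw [FN.coeff_univ i J hJ, Derivation.map_smul, tri_coord, ← Nat.cast_smul_eq_nsmul 𝕜,
      smul_smul, inv_mul_cancel₀ (Nat.cast_ne_zero.2 (multiFactorial_ne_zero _)), one_smul]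
  -- Below degree two the coefficients of the universal point are the constants `0` and `1`, which a
  -- derivation kills, and the velocity vanishes there too.
  · have hJ' : (J.degree : ℕ∞) < 2 := by exact_mod_cast not_le.1 hJ
    rw [MvPowerSeries.coeff_of_lt_order (lt_of_lt_of_le hJ' (two_le_order_velocity Z i))]
    have h := MvPowerSeries.coeff_of_lt_order
      (lt_of_lt_of_le hJ' ((FN.univ n 𝕜).two_le_order_sub i))
    rw [map_sub, sub_eq_zero] at h
    classical
    rw [h, MvPowerSeries.coeff_X]
    split_ifs <;> simp

/-- A derivation `D` is intertwined with `Z ▷` by `g : F(N) → B` if and only if it moves the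
corresponding point of `N` with the velocity prescribed by `Z`. -/
theorem derivation_comp_iff (D : Derivation 𝕜 B B) (g : FN n 𝕜 →ₐ[𝕜] B) (Z : GlAff n 𝕜) :
    (∀ h, D (g h) = g (tri n 𝕜 Z h)) ↔
      ∀ i, Forms.psDer D ((FN.point g).toFun i) =
        motion (FN.point g) (fun t => g (etaT t)) Z i := by
  constructor
  · intro h i
    rw [← map_velocity, ← psDer_tri_univ]
    ext J
    exact h _
  · intro h f
    induction f using FN.induction with
    | hC c => rw [AlgHom.commutes, Derivation.map_algebraMap, Derivation.map_algebraMap, map_zero]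
    | hadd f f' hf hf' => simp only [map_add, hf, hf']
    | hmul f a hf =>
      -- A jet coordinate is `J!` times a coefficient of the universal point, so the hypothesis on
      -- points gives the claim on generators after cancelling the nonzero scalar `1 / J!`.
      have ha : D (g (FN.coord a)) = g (tri n 𝕜 Z (FN.coord a)) := by
        have h1 := congrArg (MvPowerSeries.coeff a.1.2) (h a.1.1)
        rw [← map_velocity, ← psDer_tri_univ, Forms.coeff_psDer, FN.point_toFun] at h1
        rw [MvPowerSeries.coeff_map, MvPowerSeries.coeff_map, Forms.coeff_psDer,
          FN.coeff_univ _ _ a.2] at h1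
        change D (g (_ • FN.coord a)) = g (tri n 𝕜 Z (_ • FN.coord a)) at h1
        rw [map_smul, Derivation.map_smul, Derivation.map_smul, map_smul] at h1
        exact smul_right_injective _
          (inv_ne_zero (Nat.cast_ne_zero.2 (multiFactorial_ne_zero a.1.2))) h1
      simp only [map_mul, Derivation.leibniz, smul_eq_mul, map_add, hf, ha]

/-- Differentiate the velocity of the universal point twice at the origin. Translations bring in
third derivatives of `ψ`; these are symmetric in all lower indices, which is what removes them in
`extDer_coactExt_thetaY`. -/
theorem tri_eta (Z : GlAff n 𝕜) (i j k : Fin n) : tri n 𝕜 Z (eta i j k) =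
    ∑ l, (GlAff.transl Z l • MvPowerSeries.constantCoeff (MvPowerSeries.pderiv (FN n 𝕜) j
        (MvPowerSeries.pderiv (FN n 𝕜) k (MvPowerSeries.pderiv (FN n 𝕜) l
          ((FN.univ n 𝕜).toFun i)))) +
      GlAff.lin Z l j • eta i k l + GlAff.lin Z l k • eta i j l) -
    ∑ l, (algebraMap 𝕜 (FN n 𝕜) (GlAff.lin Z i l) +
      ∑ m, GlAff.transl Z m • eta i l m) * eta l j k := by
  have h : ∀ f : PS n (FN n 𝕜), tri n 𝕜 Z (MvPowerSeries.constantCoeff f) =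
      MvPowerSeries.constantCoeff (Forms.psDer (tri n 𝕜 Z) f) := fun f => rfl
  have hp : ∀ (f : PS n (FN n 𝕜)) (j : Fin n), Forms.psDer (tri n 𝕜 Z)
      (MvPowerSeries.pderiv (FN n 𝕜) j f) =
        MvPowerSeries.pderiv (FN n 𝕜) j (Forms.psDer (tri n 𝕜 Z) f) := fun f j =>
    Forms.psMap_pderiv _ f j
  rw [← constantCoeff_pderiv_pderiv_univ, h, hp, hp, psDer_tri_univ, velocity_eq, pderiv_motion]
  simp only [map_sub, map_sum, map_add, Derivation.leibniz, smul_eq_mul, pderiv_affineField,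
    MvPowerSeries.pderiv_C, mul_zero, add_zero, map_mul, constantCoeff_affineField,
    MvPowerSeries.constantCoeff_C, constantCoeff_pderiv_pderiv_univ, Algebra.smul_def,
    Finset.sum_const_zero, etaT]
  congr 1
  refine Finset.sum_congr rfl fun l _ => ?_
  ring

end Velocity

/-! ### Compatibility of the action of `s` with composition in `N` -/

section PointProduct

variable {n : ℕ} {𝕜 : Type u} [Field 𝕜] {A : Type v} [CommRing A] [Algebra 𝕜 A]
  {B : Type w} [CommRing B] [Algebra 𝕜 B]

theorem Diffeo.substAlgHom_mul (φ ψ : Diffeo n B) (f : PS n B) :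
    MvPowerSeries.substAlgHom (φ * ψ).hasSubst f =
      MvPowerSeries.substAlgHom ψ.hasSubst (MvPowerSeries.substAlgHom φ.hasSubst f) := by
  simp only [MvPowerSeries.coe_substAlgHom]
  rw [MvPowerSeries.subst_comp_subst_apply φ.hasSubst ψ.hasSubst]
  rfl

theorem twist_sub {M : Type*} [AddCommGroup M] [Module B M] (E : Fin n × Fin n × Fin n → B)
    (L L' : GlAff n 𝕜 → M) (Z : GlAff n 𝕜) :
    twist E (fun Z => L Z - L' Z) Z = twist E L Z - twist E L' Z := by
  simp only [twist, smul_sub, Finset.sum_sub_distrib]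
  abel

theorem twist_add {M : Type*} [AddCommGroup M] [Module B M] (E : Fin n × Fin n × Fin n → B)
    (L L' : GlAff n 𝕜 → M) (Z : GlAff n 𝕜) :
    twist E (fun Z => L Z + L' Z) Z = twist E L Z + twist E L' Z := by
  simp only [twist, smul_add, Finset.sum_add_distrib]
  abel

theorem twist_mul (E : Fin n × Fin n × Fin n → B) (b : B) (L : GlAff n 𝕜 → B) (Z : GlAff n 𝕜) :
    twist E (fun Z => b * L Z) Z = b * twist E L Z :=
  (map_twist (LinearMap.mulLeft B b) E L Z).symm

theorem algHom_twist (k : A →ₐ[𝕜] B) (E : Fin n × Fin n × Fin n → A) (L : GlAff n 𝕜 → A)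
    (Z : GlAff n 𝕜) : k (twist E L Z) = twist (fun t => k (E t)) (fun Z => k (L Z)) Z := by
  simp [twist]

/-- Contraction of a vector field with the differential of the `i`-th component of `φ`. -/
def fieldDeriv (φ : Diffeo n B) (i : Fin n) : (Fin n → PS n B) →ₗ[B] PS n B where
  toFun V := ∑ j, V j * MvPowerSeries.pderiv B j (φ.toFun i)
  map_add' V W := by simp [add_mul, Finset.sum_add_distrib]
  map_smul' c V := by simp [Finset.smul_sum]

/-- The composition of the `i`-th component of a vector field with `φ`. -/
def fieldSubst (φ : Diffeo n B) (i : Fin n) : (Fin n → PS n B) →ₗ[B] PS n B :=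
  (MvPowerSeries.substAlgHom φ.hasSubst).toLinearMap ∘ₗ LinearMap.proj i

/-- The motion depends on `Z` linearly over `B` through its affine field and the `E`-twist of that
field. A further twist by `E'` acts on both, and on the second one the coefficients add. -/
theorem twist_motion (φ : Diffeo n B) (E E' : Fin n × Fin n × Fin n → B) (Z : GlAff n 𝕜)
    (i : Fin n) : twist E' (fun Z => motion φ E Z i) Z =
      ∑ j, twist E' (affineField n (R := B)) Z j * MvPowerSeries.pderiv B j (φ.toFun i) -
        MvPowerSeries.substAlgHom φ.hasSubst
          (twist (E' + E) (affineField n (R := B)) Z i) := by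
  have h : (fun Z => motion φ E Z i) = fun Z : GlAff n 𝕜 =>
      fieldDeriv φ i (affineField n (R := B) Z) -
        fieldSubst φ i (twist E (affineField n (R := B)) Z) := rfl
  rw [h, twist_sub, ← map_twist, ← map_twist, twist_twist]
  rfl

/-- The twisted form of the forward direction of `derivation_comp_iff`, needed for the left factor
of a product: that factor does not move along `Z` but along `Z` transported through the right
factor. -/
theorem psDer_point_toFun (D : Derivation 𝕜 B B) (g : FN n 𝕜 →ₐ[𝕜] B) [CharZero 𝕜]
    (E : Fin n × Fin n × Fin n → B) (Z : GlAff n 𝕜)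
    (h : ∀ f, D (g f) = twist E (fun Z => g (tri n 𝕜 Z f)) Z) (i : Fin n) :
    Forms.psDer D ((FN.point g).toFun i) =
      twist E (fun Z => motion (FN.point g) (fun t => g (etaT t)) Z i) Z := by
  ext J
  simp only [← map_velocity, ← psDer_tri_univ]
  rw [Forms.coeff_psDer, FN.point_toFun, MvPowerSeries.coeff_map]
  refine (h _).trans ?_
  simp only [twist, map_add, map_sum, MvPowerSeries.coeff_smul, MvPowerSeries.coeff_map,
    Forms.coeff_psDer, smul_eq_mul]
  rfl

variable [CharZero 𝕜]

/-- The action of `gl_n^aff` on functions is compatible with products in `N`. -/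
theorem derivation_eval_mul (D : Derivation 𝕜 B B) (g₁ g₂ : FN n 𝕜 →ₐ[𝕜] B) (Z : GlAff n 𝕜)
    (h₁ : ∀ f, D (g₁ f) = twist (fun t => g₂ (etaT t)) (fun Z => g₁ (tri n 𝕜 Z f)) Z)
    (h₂ : ∀ f, D (g₂ f) = g₂ (tri n 𝕜 Z f)) (f : FN n 𝕜) :
    D (FN.eval (FN.point g₁ * FN.point g₂) f) =
      FN.eval (FN.point g₁ * FN.point g₂) (tri n 𝕜 Z f) := by
  revert f
  rw [derivation_comp_iff] at h₂ ⊢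
  rw [FN.point_eval]
  intro i
  have e1 : (FN.point g₁ * FN.point g₂).toFun i =
      MvPowerSeries.substAlgHom (FN.point g₂).hasSubst ((FN.point g₁).toFun i) := by
    rw [MvPowerSeries.coe_substAlgHom]; rfl
  have e2 : (fun t => FN.eval (𝕜 := 𝕜) (FN.point g₁ * FN.point g₂) (etaT t)) =
      (fun t => g₂ (etaT t)) + fun t => g₁ (etaT t) := by
    funext t
    rw [FN.eval_mul_etaT, FN.eval_point, FN.eval_point, Pi.add_apply, add_comm]
  rw [e2, motion, e1, Forms.psDer_subst, psDer_point_toFun D g₁ _ Z h₁, twist_motion,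
    Diffeo.substAlgHom_mul, map_sub, map_sum]
  -- The contribution of the moving inner point. It yields the derivative of the composite along
  -- `Z`, minus the outer differential contracted with the field `g₂ ▷ Z`; this last sum cancels
  -- against the first half of the twisted motion of the outer point.
  have h₃ : ∑ l, MvPowerSeries.substAlgHom (FN.point g₂).hasSubst
      (MvPowerSeries.pderiv B l ((FN.point g₁).toFun i)) *
        Forms.psDer D ((FN.point g₂).toFun l) =
      ∑ j, affineField n Z j * MvPowerSeries.pderiv B j
        (MvPowerSeries.substAlgHom (FN.point g₂).hasSubst ((FN.point g₁).toFun i)) -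
      ∑ l, MvPowerSeries.substAlgHom (FN.point g₂).hasSubst
        (twist (fun t => g₂ (etaT t)) (affineField n (R := B)) Z l) *
          MvPowerSeries.substAlgHom (FN.point g₂).hasSubst
            (MvPowerSeries.pderiv B l ((FN.point g₁).toFun i)) := by
    simp only [Forms.pderiv_subst 𝕜, Finset.mul_sum]
    rw [Finset.sum_comm, ← Finset.sum_sub_distrib]
    refine Finset.sum_congr rfl fun l _ => ?_
    rw [h₂ l, motion, mul_sub, Finset.mul_sum]
    refine congrArg₂ _ (Finset.sum_congr rfl fun j _ => mul_left_comm _ _ _) (mul_comm _ _)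
  rw [h₃]
  simp only [map_mul]
  exact sub_add_sub_cancel' _ _ _

theorem FN.productMap_comp_comul (f g : FN n 𝕜 →ₐ[𝕜] B) :
    (Algebra.TensorProduct.productMap f g).comp (Bialgebra.comulAlgHom 𝕜 (FN n 𝕜)) =
      FN.eval (FN.point f * FN.point g) :=
  FN.lift_comp_comulHom f g fun _ _ => Commute.all _ _

theorem FN.point_productMap_comp_comul (f g : FN n 𝕜 →ₐ[𝕜] B) :
    FN.point ((Algebra.TensorProduct.productMap f g).comp
      (Bialgebra.comulAlgHom 𝕜 (FN n 𝕜))) = FN.point f * FN.point g := by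
  rw [FN.productMap_comp_comul, FN.point_eval]

end PointProduct

/-! ### The action of `s` on tensor powers of `F(N)` -/

namespace Tens

variable {n : ℕ} {𝕜 : Type u} [Field 𝕜] {q r : ℕ} {S : Type v} [CommRing S] [Algebra 𝕜 S]

theorem slot_apply (i : Fin q) (f : FN n 𝕜) :
    slot n 𝕜 i f = PiTensorProduct.tprod 𝕜 (Pi.mulSingle i f) := rfl

theorem tprod_eq_prod_slot (f : Fin q → FN n 𝕜) :
    PiTensorProduct.tprod 𝕜 f = ∏ i, slot n 𝕜 i (f i) := by
  have h : ∀ s : Finset (Fin q), ∏ i ∈ s, slot n 𝕜 i (f i) =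
      PiTensorProduct.tprod 𝕜 (∏ i ∈ s, Pi.mulSingle i (f i)) := by
    classical
    intro s
    induction s using Finset.induction_on with
    | empty => rfl
    | insert a s ha ih =>
      rw [Finset.prod_insert ha, Finset.prod_insert ha, ih, slot_apply,
        PiTensorProduct.tprod_mul_tprod]
  rw [h, Finset.univ_prod_mulSingle]

/-- A pure tensor is the product of its slots, so the slots generate the algebra. Identities between
algebra maps or derivations then need checking only on a single slot. -/
theorem induction {P : Tens n 𝕜 q → Prop} (hC : ∀ c : 𝕜, P (algebraMap 𝕜 _ c))
    (hslot : ∀ i f, P (slot n 𝕜 i f)) (hadd : ∀ x y, P x → P y → P (x + y))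
    (hmul : ∀ x y, P x → P y → P (x * y)) (x : Tens n 𝕜 q) : P x := by
  induction x using PiTensorProduct.induction_on with
  | smul_tprod c f =>
    rw [Algebra.smul_def, tprod_eq_prod_slot]
    refine hmul _ _ (hC c) (Finset.prod_induction _ P hmul ?_ fun i _ => hslot i _)
    have h := hC 1
    rwa [map_one] at h
  | add x y hx hy => exact hadd x y hx hy

theorem algHom_ext {f g : Tens n 𝕜 q →ₐ[𝕜] S}
    (h : ∀ i, f.comp (slot n 𝕜 i) = g.comp (slot n 𝕜 i)) : f = g :=
  AlgHom.ext fun x => by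
    induction x using Tens.induction with
    | hC c => rw [AlgHom.commutes, AlgHom.commutes]
    | hslot i a => exact AlgHom.congr_fun (h i) a
    | hadd x y hx hy => rw [map_add, map_add, hx, hy]
    | hmul x y hx hy => rw [map_mul, map_mul, hx, hy]

theorem lift_comp_slot (g : Fin q → FN n 𝕜 →ₐ[𝕜] S) (i : Fin q) :
    (lift g).comp (slot n 𝕜 i) = g i := AlgHom.ext fun f => lift_slot g i f

theorem place_slot (e : Fin q → Fin r) (i : Fin q) (f : FN n 𝕜) :
    place n 𝕜 e (slot n 𝕜 i f) = slot n 𝕜 (e i) f := lift_slot _ _ _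

theorem place_comp_slot (e : Fin q → Fin r) (i : Fin q) :
    (place n 𝕜 e).comp (slot n 𝕜 i) = slot n 𝕜 (e i) := lift_comp_slot _ _

theorem place_comp_place {m : ℕ} (e : Fin q → Fin r) (e' : Fin r → Fin m) :
    (place n 𝕜 e').comp (place n 𝕜 e) = place n 𝕜 (e' ∘ e) :=
  algHom_ext fun i => by rw [AlgHom.comp_assoc, place_comp_slot, place_comp_slot, place_comp_slot]; rfl

theorem applyAt_tprod (i : Fin q) (u : FN n 𝕜 →ₗ[𝕜] FN n 𝕜) (f : Fin q → FN n 𝕜) :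
    applyAt i u (PiTensorProduct.tprod 𝕜 f) =
      PiTensorProduct.tprod 𝕜 (Function.update f i (u (f i))) := by
  rw [applyAt, PiTensorProduct.map_tprod]
  congr 1
  funext j
  by_cases h : j = i
  · subst h; simp
  · simp [h]

theorem applyAt_slot (i j : Fin q) (D : Derivation 𝕜 (FN n 𝕜) (FN n 𝕜)) (f : FN n 𝕜) :
    applyAt i D.toLinearMap (slot n 𝕜 j f) = if i = j then slot n 𝕜 j (D f) else 0 := by
  rw [slot_apply, applyAt_tprod]
  split_ifs with h
  · subst h
    rw [slot_apply]
    congr 1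
    simp [Pi.mulSingle]
  · refine MultilinearMap.map_coord_zero _ i ?_
    rw [Function.update_self, Pi.mulSingle_eq_of_ne h]
    exact D.map_one_eq_zero

/-- The product of pure tensors is taken factorwise, so the Leibniz rule is only used in the `i`-th
factor, the remaining factors being carried along unchanged. -/
theorem applyAt_mul (i : Fin q) (D : Derivation 𝕜 (FN n 𝕜) (FN n 𝕜)) (x y : Tens n 𝕜 q) :
    applyAt i D.toLinearMap (x * y) =
      x * applyAt i D.toLinearMap y + y * applyAt i D.toLinearMap x := by
  induction x using PiTensorProduct.induction_on with
  | add x x' hx hx' => simp only [add_mul, mul_add, map_add, hx, hx']; ring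
  | smul_tprod c f =>
    simp only [smul_mul_assoc, map_smul, mul_smul_comm, ← smul_add]
    congr 1
    induction y using PiTensorProduct.induction_on with
    | add x x' hx hx' => simp only [add_mul, mul_add, map_add, hx, hx']; ring
    | smul_tprod c g =>
      simp only [smul_mul_assoc, map_smul, mul_smul_comm, ← smul_add]
      congr 1
      have e : ∀ (f g : Fin q → FN n 𝕜) (a : FN n 𝕜),
          Function.update (f * g) i (f i * a) = f * Function.update g i a := fun f g a => by
        funext j
        by_cases h : j = i
        · subst h; simp
        · simp [h]
      rw [PiTensorProduct.tprod_mul_tprod, applyAt_tprod, applyAt_tprod, applyAt_tprod,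
        PiTensorProduct.tprod_mul_tprod, PiTensorProduct.tprod_mul_tprod, ← e, ← e, mul_comm g f,
        ← MultilinearMap.map_update_add]
      congr 2
      exact D.leibniz _ _

variable [CharZero 𝕜]

theorem bullet_apply (Z : GlAff n 𝕜) (x : Tens n 𝕜 q) : bullet n 𝕜 q Z x =
    ∑ i, twist (fun t => diagAfter n 𝕜 i (etaT t))
      (fun Z => applyAt i (tri n 𝕜 Z).toLinearMap x) Z := by
  rw [bullet, LinearMap.sum_apply, LinearMap.sum_apply]
  refine Finset.sum_congr rfl fun i _ => ?_
  rw [LinearMap.comp_apply]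
  exact lift_coactS (LinearMap.applyₗ x ∘ₗ TensorProduct.lift _) (diagAfter n 𝕜 i) _
    (fun Z h => rfl) Z

/-- The action of `s` on `F(N)^{⊗ q}`, by derivations. -/
def bulletDer (Z : GlAff n 𝕜) : Derivation 𝕜 (Tens n 𝕜 q) (Tens n 𝕜 q) :=
  Derivation.mk' (bullet n 𝕜 q Z) fun x y => by
    -- Each summand is a derivation of one factor followed by multiplication by a fixed element,
    -- hence again a derivation of the commutative tensor algebra.
    simp only [bullet_apply, applyAt_mul, twist_add, twist_mul, Finset.sum_add_distrib,
      smul_eq_mul, Finset.mul_sum]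

theorem bulletDer_apply (Z : GlAff n 𝕜) (x : Tens n 𝕜 q) : bulletDer Z x = bullet n 𝕜 q Z x := rfl

theorem iterComul_succ (r : ℕ) : iterComul n 𝕜 (r + 1) =
    (Algebra.TensorProduct.productMap (slot n 𝕜 0)
      ((place n 𝕜 Fin.succ).comp (iterComul n 𝕜 r))).comp (Bialgebra.comulAlgHom 𝕜 (FN n 𝕜)) := rfl

/-- Additivity of `η` on `N` makes it primitive: it vanishes at the identity, and each further
factor contributes one summand. -/
theorem iterComul_etaT (r : ℕ) (t : Fin n × Fin n × Fin n) :
    iterComul n 𝕜 r (etaT t) = ∑ i, slot n 𝕜 i (etaT t) := by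
  induction r with
  | zero =>
    have h : Bialgebra.counitAlgHom 𝕜 (FN n 𝕜) (etaT t) = 0 := FN.eval_one_etaT t
    rw [iterComul, AlgHom.comp_apply, h, map_zero]
    rfl
  | succ r ih =>
    rw [iterComul_succ, FN.productMap_comp_comul, FN.eval_mul_etaT, FN.eval_point, FN.eval_point,
      AlgHom.comp_apply, ih, Fin.sum_univ_succ, map_sum]
    simp only [place_slot]

theorem diagAfter_etaT (i : Fin q) (t : Fin n × Fin n × Fin n) :
    diagAfter n 𝕜 i (etaT t) = ∑ l, if i < l then slot n 𝕜 l (etaT t) else 0 := by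
  rw [diagAfter, AlgHom.comp_apply, iterComul_etaT, map_sum, ← Finset.sum_filter]
  simp only [place_slot]
  refine Finset.sum_bij (fun k _ => ⟨i + 1 + k, by omega⟩) ?_ ?_ ?_ ?_
  · intro k _
    simp only [Finset.mem_filter, Finset.mem_univ, true_and, Fin.lt_def]
    omega
  · intro k _ k' _ h
    simp only [Fin.mk.injEq] at h
    exact Fin.ext (by omega)
  · intro l hl
    simp only [Finset.mem_filter, Finset.mem_univ, true_and, Fin.lt_def] at hl
    exact ⟨⟨l - (i + 1), by omega⟩, Finset.mem_univ _, Fin.ext (by simp; omega)⟩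
  · intro k _
    rfl

/-- A derivation kills the factors `1`, so only the summand at position `i` survives; its twist
collects `η` from all later positions. As the action is by derivations, this determines it
completely. -/
theorem bullet_slot (Z : GlAff n 𝕜) (i : Fin q) (f : FN n 𝕜) : bullet n 𝕜 q Z (slot n 𝕜 i f) =
    twist (fun t => ∑ l, if i < l then slot n 𝕜 l (etaT t) else 0)
      (fun Z => slot n 𝕜 i (tri n 𝕜 Z f)) Z := by
  rw [bullet_apply, Finset.sum_eq_single i]
  · simp only [applyAt_slot, if_true, diagAfter_etaT]
  · intro j _ hj
    simp [applyAt_slot, hj, twist]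
  · simp

theorem bullet_algebraMap (Z : GlAff n 𝕜) (c : 𝕜) :
    bullet n 𝕜 q Z (algebraMap 𝕜 _ c) = 0 := (bulletDer Z).map_algebraMap c

theorem bullet_mul (Z : GlAff n 𝕜) (x y : Tens n 𝕜 q) : bullet n 𝕜 q Z (x * y) =
    x * bullet n 𝕜 q Z y + y * bullet n 𝕜 q Z x := (bulletDer Z).leibniz x y

/-- The action on one factor sees only the factors after it. The condition `he` says that the
positions after `e i` are exactly the images of those after `i`, so the twists agree. -/
theorem bullet_place (e : Fin q → Fin r) (he : ∀ (i : Fin q) (F : Fin r → Tens n 𝕜 r),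
      (∑ l, if e i < l then F l else 0) = ∑ l, if i < l then F (e l) else 0)
    (Z : GlAff n 𝕜) (x : Tens n 𝕜 q) :
    bullet n 𝕜 r Z (place n 𝕜 e x) = place n 𝕜 e (bullet n 𝕜 q Z x) := by
  induction x using Tens.induction with
  | hC c => rw [AlgHom.commutes, bullet_algebraMap, bullet_algebraMap, map_zero]
  | hadd x y hx hy => simp only [map_add, hx, hy]
  | hmul x y hx hy => simp only [map_mul, map_add, bullet_mul, hx, hy]
  | hslot i f =>
    rw [place_slot, bullet_slot, bullet_slot, algHom_twist]
    simp only [place_slot, map_sum, apply_ite (place n 𝕜 e), map_zero, he]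

theorem bullet_place_natAdd (q q' : ℕ) (Z : GlAff n 𝕜) (x : Tens n 𝕜 q') :
    bullet n 𝕜 (q + q') Z (place n 𝕜 (Fin.natAdd q) x) =
      place n 𝕜 (Fin.natAdd q) (bullet n 𝕜 q' Z x) := by
  refine bullet_place _ (fun i F => ?_) Z x
  rw [Fin.sum_univ_add, Finset.sum_eq_zero, zero_add]
  · simp
  · intro l _
    rw [if_neg]
    simp only [Fin.lt_def, Fin.val_natAdd, Fin.val_castAdd]
    omega

theorem bullet_place_succ (q : ℕ) (Z : GlAff n 𝕜) (x : Tens n 𝕜 q) :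
    bullet n 𝕜 (q + 1) Z (place n 𝕜 Fin.succ x) =
      place n 𝕜 Fin.succ (bullet n 𝕜 q Z x) := by
  refine bullet_place _ (fun i F => ?_) Z x
  rw [Fin.sum_univ_succ]
  simp

/-- An initial block is followed by `q'` further factors. On a slot, the positions after it split
into those in its own block and the final ones; the latter contribute `Δ^{(q')}(η)`, and this extra
twist is added to the inner one by `twist_twist`. -/
theorem bullet_place_castAdd (q q' : ℕ) (Z : GlAff n 𝕜) (x : Tens n 𝕜 q) :
    bullet n 𝕜 (q + q') Z (place n 𝕜 (Fin.castAdd q') x) =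
      twist (fun t => place n 𝕜 (Fin.natAdd q) (iterComul n 𝕜 q' (etaT t)))
        (fun Z => place n 𝕜 (Fin.castAdd q') (bullet n 𝕜 q Z x)) Z := by
  induction x using Tens.induction with
  | hC c => simp [bullet_algebraMap, twist]
  | hadd x y hx hy => simp only [map_add, hx, hy, twist_add]
  | hmul x y hx hy => simp only [map_mul, map_add, bullet_mul, hx, hy, twist_add, twist_mul]
  | hslot i f =>
    rw [place_slot, bullet_slot]
    simp only [bullet_slot, algHom_twist]
    rw [twist_twist]
    simp only [place_slot, map_sum, Fin.sum_univ_add, apply_ite (place n 𝕜 (Fin.castAdd q')),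
      map_zero, iterComul_etaT]
    congr 1
    funext t
    refine (add_comm _ _).trans (congrArg₂ _ (Finset.sum_congr rfl fun l _ => ?_)
      (Finset.sum_congr rfl fun l _ => ?_))
    · rw [if_pos]
      simp only [Fin.lt_def, Fin.val_natAdd, Fin.val_castAdd]
      omega
    · simp only [Fin.lt_def, Fin.val_castAdd]

/-- The identity of `N` is fixed by the flow: there `η` vanishes, and the derivative of the identity
along `Z` equals `Z` itself. This is `derivation_comp_iff` with the zero derivation of `𝕜`. -/
theorem tri_counit (Z : GlAff n 𝕜) (f : FN n 𝕜) :
    Bialgebra.counitAlgHom 𝕜 (FN n 𝕜) (tri n 𝕜 Z f) = 0 := by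
  have h : FN.point (Bialgebra.counitAlgHom 𝕜 (FN n 𝕜)) = 1 := FN.point_eval _
  have h0 : ∀ f, (0 : Derivation 𝕜 𝕜 𝕜) (Bialgebra.counitAlgHom 𝕜 (FN n 𝕜) f) =
      Bialgebra.counitAlgHom 𝕜 (FN n 𝕜) (tri n 𝕜 Z f) := by
    rw [derivation_comp_iff, h]
    have hE : (fun t => Bialgebra.counitAlgHom 𝕜 (FN n 𝕜) (etaT t)) = 0 :=
      funext fun t => FN.eval_one_etaT t
    intro i
    rw [hE, motion, twist_zero]
    have h1 : MvPowerSeries.substAlgHom (1 : Diffeo n 𝕜).hasSubst (affineField n (R := 𝕜) Z i) =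
        affineField n (R := 𝕜) Z i := by
      rw [MvPowerSeries.coe_substAlgHom]
      exact congrFun (MvPowerSeries.subst_self (σ := Fin n) (R := 𝕜)) _
    rw [h1, Finset.sum_eq_single i]
    · rw [Diffeo.one_toFun, MvPowerSeries.pderiv_X_self, mul_one, sub_self]
      ext J
      rw [Forms.coeff_psDer]; rfl
    · intro j _ hj
      rw [Diffeo.one_toFun, MvPowerSeries.pderiv_X_of_ne hj.symm, mul_zero]
    · simp
  exact (h0 f).symm

/-- The iterated comultiplication is equivariant. -/
theorem bullet_iterComul (r : ℕ) (Z : GlAff n 𝕜) (f : FN n 𝕜) :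
    bullet n 𝕜 r Z (iterComul n 𝕜 r f) = iterComul n 𝕜 r (tri n 𝕜 Z f) := by
  induction r generalizing f Z with
  | zero =>
    rw [iterComul, AlgHom.comp_apply, AlgHom.comp_apply, tri_counit, map_zero]
    exact bullet_algebraMap _ _
  | succ r ih =>
    rw [iterComul_succ, FN.productMap_comp_comul, ← bulletDer_apply]
    -- The point of `Δ^{(r+1)}` is the first factor times the product of the later ones. The first
    -- factor is twisted by all later `η`, as `derivation_eval_mul` requires of a left factor; the
    -- induction hypothesis handles the right factor.
    refine derivation_eval_mul _ _ _ Z (fun f => ?_) (fun f => ?_) f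
    · rw [bulletDer_apply, bullet_slot]
      congr 1
      funext t
      rw [AlgHom.comp_apply, iterComul_etaT, map_sum, Fin.sum_univ_succ]
      simp [place_slot]
    · rw [bulletDer_apply, AlgHom.comp_apply, bullet_place_succ, ih]
      rfl

end Tens

/-! ### The coaction on `⋀ s^*` as a map of differential algebras -/

section ExteriorCoaction

variable {n : ℕ} {𝕜 : Type u} [Field 𝕜]

theorem ι_mul_eq_parity_mul_ι (θ : DualS n 𝕜) (η : ExtS n 𝕜) :
    ExteriorAlgebra.ι 𝕜 θ * η = parity n 𝕜 η * ExteriorAlgebra.ι 𝕜 θ := by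
  induction η using ExteriorAlgebra.induction with
  | algebraMap r => rw [AlgHom.commutes, Algebra.commutes]
  | ι τ =>
    rw [parity_ι, neg_mul, ← add_eq_zero_iff_eq_neg]
    exact ExteriorAlgebra.ι_add_mul_swap θ τ
  | mul a b ha hb => rw [← mul_assoc, ha, mul_assoc, hb, map_mul, mul_assoc]
  | add a b ha hb => rw [mul_add, ha, hb, map_add, add_mul]

variable (n 𝕜) in
/-- The grading involution of `F(N) ⊗ ⋀ s^*`. -/
def parityF : FN n 𝕜 ⊗[𝕜] ExtS n 𝕜 →ₐ[𝕜] FN n 𝕜 ⊗[𝕜] ExtS n 𝕜 :=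
  Algebra.TensorProduct.map (AlgHom.id 𝕜 _) (parity n 𝕜)

/-- The coaction sends generators to combinations of generators, hence respects the parity of
degrees. -/
theorem coactExt_parity (η : ExtS n 𝕜) :
    coactExt n 𝕜 (parity n 𝕜 η) = parityF n 𝕜 (coactExt n 𝕜 η) := by
  have h : (coactExt n 𝕜).comp (parity n 𝕜) = (parityF n 𝕜).comp (coactExt n 𝕜) := by
    refine ExteriorAlgebra.hom_ext (LinearMap.ext fun θ => ?_)
    change coactExt n 𝕜 (parity n 𝕜 (ExteriorAlgebra.ι 𝕜 θ)) =
      parityF n 𝕜 (coactExt n 𝕜 (ExteriorAlgebra.ι 𝕜 θ))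
    rw [parity_ι, map_neg, coactExt_ι]
    induction coactDual n 𝕜 θ with
    | zero => simp
    | tmul f τ => simp [parityF, parity_ι, TensorProduct.tmul_neg]
    | add x y hx hy => rw [map_add, map_add, neg_add, hx, hy]
  exact AlgHom.congr_fun h η

variable (n 𝕜) in
/-- The odd derivation `f ⊗ η ↦ f ⊗ dη - X_i ▷ f ⊗ v^i ∧ η` of `F(N) ⊗ ⋀ s^*`. -/
def extDer : FN n 𝕜 ⊗[𝕜] ExtS n 𝕜 →ₗ[𝕜] FN n 𝕜 ⊗[𝕜] ExtS n 𝕜 :=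
  TensorProduct.map LinearMap.id (deRham n 𝕜) -
    ∑ b, TensorProduct.map (tri n 𝕜 (GlAff.basis n 𝕜 b)).toLinearMap
      (LinearMap.mulLeft 𝕜 (ExteriorAlgebra.ι 𝕜 (dualBasis n 𝕜 b)))

theorem extDer_tmul (f : FN n 𝕜) (η : ExtS n 𝕜) : extDer n 𝕜 (f ⊗ₜ η) =
    f ⊗ₜ deRham n 𝕜 η - ∑ b, tri n 𝕜 (GlAff.basis n 𝕜 b) f ⊗ₜ
      (ExteriorAlgebra.ι 𝕜 (dualBasis n 𝕜 b) * η) := by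
  simp [extDer]

/-- When `X_i` differentiates the function of the second factor, the one-form `v^i` has to cross the
exterior part of the first; this produces the grading involution. -/
theorem extDer_mul (x y : FN n 𝕜 ⊗[𝕜] ExtS n 𝕜) :
    extDer n 𝕜 (x * y) = extDer n 𝕜 x * y + parityF n 𝕜 x * extDer n 𝕜 y := by
  induction x with
  | zero => simp
  | add x x' hx hx' => simp only [add_mul, map_add, hx, hx']; abel
  | tmul f η =>
    induction y with
    | zero => simp
    | add y y' hy hy' => simp only [mul_add, map_add, hy, hy']; abel
    | tmul g ζ =>
      have hp : parityF n 𝕜 (f ⊗ₜ η) = f ⊗ₜ parity n 𝕜 η := by simp [parityF]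
      rw [hp, Algebra.TensorProduct.tmul_mul_tmul, extDer_tmul, extDer_tmul, extDer_tmul, sub_mul,
        mul_sub, Finset.sum_mul, Finset.mul_sum]
      simp only [Algebra.TensorProduct.tmul_mul_tmul, Derivation.leibniz, smul_eq_mul,
        TensorProduct.add_tmul, Finset.sum_add_distrib, deRham_mul, TensorProduct.tmul_add]
      have h1 : ∀ b, (f * tri n 𝕜 (GlAff.basis n 𝕜 b) g) ⊗ₜ[𝕜]
          (ExteriorAlgebra.ι 𝕜 (dualBasis n 𝕜 b) * (η * ζ)) =
          (f * tri n 𝕜 (GlAff.basis n 𝕜 b) g) ⊗ₜ[𝕜]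
            (parity n 𝕜 η * (ExteriorAlgebra.ι 𝕜 (dualBasis n 𝕜 b) * ζ)) := fun b => by
        rw [← mul_assoc, ι_mul_eq_parity_mul_ι, mul_assoc]
      have h2 : ∀ b, (g * tri n 𝕜 (GlAff.basis n 𝕜 b) f) ⊗ₜ[𝕜]
          (ExteriorAlgebra.ι 𝕜 (dualBasis n 𝕜 b) * (η * ζ)) =
          (tri n 𝕜 (GlAff.basis n 𝕜 b) f * g) ⊗ₜ[𝕜]
            (ExteriorAlgebra.ι 𝕜 (dualBasis n 𝕜 b) * η * ζ) := fun b => by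
        rw [mul_comm g, mul_assoc]
      simp only [h1, h2]
      abel

theorem dualBasis_X (a : Fin n ⊕ Fin n × Fin n) (k : Fin n) :
    dualBasis n 𝕜 a (GlAff.X 𝕜 k) = if Sum.inl k = a then 1 else 0 := by
  rw [← GlAff.basis_inl, dualBasis, Module.Basis.coord_apply, Module.Basis.repr_self,
    Finsupp.single_apply]

variable (n 𝕜) in
/-- The generator `θ^k` of `⋀ s^*`. -/
def thetaX (k : Fin n) : ExtS n 𝕜 := ExteriorAlgebra.ι 𝕜 (dualBasis n 𝕜 (Sum.inl k))

variable (n 𝕜) in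
/-- The generator `θ^i_j` of `⋀ s^*`. -/
def thetaY (i j : Fin n) : ExtS n 𝕜 := ExteriorAlgebra.ι 𝕜 (dualBasis n 𝕜 (Sum.inr (i, j)))

theorem ι_anticomm (θ τ : DualS n 𝕜) : ExteriorAlgebra.ι 𝕜 θ * ExteriorAlgebra.ι 𝕜 τ =
    -(ExteriorAlgebra.ι 𝕜 τ * ExteriorAlgebra.ι 𝕜 θ) :=
  eq_neg_of_add_eq_zero_left (ExteriorAlgebra.ι_add_mul_swap θ τ)

theorem thetaX_mul_thetaY (k i j : Fin n) :
    thetaX n 𝕜 k * thetaY n 𝕜 i j = -(thetaY n 𝕜 i j * thetaX n 𝕜 k) := ι_anticomm _ _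

theorem lie_X_Y (i j k : Fin n) :
    ⁅GlAff.X 𝕜 k, GlAff.Y 𝕜 i j⁆ = -if k = j then GlAff.X 𝕜 i else 0 := by
  rw [← lie_skew, GlAff.lie_Y_X]

theorem coactExt_thetaX (k : Fin n) :
    coactExt n 𝕜 (thetaX n 𝕜 k) = (1 : FN n 𝕜) ⊗ₜ[𝕜] thetaX n 𝕜 k := by
  rw [thetaX, coactExt_ι, coactDual_inl]
  rfl

theorem coactExt_thetaY (i j : Fin n) : coactExt n 𝕜 (thetaY n 𝕜 i j) =
    (1 : FN n 𝕜) ⊗ₜ[𝕜] thetaY n 𝕜 i j + ∑ k, (eta i j k : FN n 𝕜) ⊗ₜ[𝕜] thetaX n 𝕜 k := by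
  rw [thetaY, coactExt_ι, coactDual_inr, map_add, map_sum]
  rfl

variable [CharZero 𝕜]

/-- The double sum in `deRhamOne` yields every product of generators twice, once in each order up to
sign, each time with coefficient one half; this recombines the halves. -/
theorem half_smul_add_self {M : Type*} [AddCommGroup M] [Module 𝕜 M] (m : M) :
    (2 : 𝕜)⁻¹ • m + (2 : 𝕜)⁻¹ • m = m := by
  rw [← add_smul, ← two_mul, mul_inv_cancel₀ two_ne_zero, one_smul]

theorem deRham_thetaX (k : Fin n) :
    deRham n 𝕜 (thetaX n 𝕜 k) = ∑ j, thetaY n 𝕜 k j * thetaX n 𝕜 j := by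
  rw [thetaX, deRham_ι]
  simp only [deRhamOne, LinearMap.coe_mk, AddHom.coe_mk, Fintype.sum_sum_type, GlAff.basis_inl,
    GlAff.lie_X_X, Fintype.sum_prod_type, GlAff.basis_inr, lie_X_Y, GlAff.lie_Y_X, GlAff.lie_Y_Y,
    map_zero, map_neg, map_sub, mul_zero, zero_smul, Finset.sum_const_zero, zero_add,
    apply_ite (dualBasis n 𝕜 (Sum.inl k)), dualBasis_X, dualBasis_Y, reduceCtorEq, if_false,
    ite_self, sub_zero, add_zero, Sum.inl.injEq]
  change ∑ l, ∑ i, ∑ j, _ • (thetaX n 𝕜 l * thetaY n 𝕜 i j) +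
    ∑ i, ∑ j, ∑ l, _ • (thetaY n 𝕜 i j * thetaX n 𝕜 l) = _
  simp only [mul_neg, mul_ite, mul_one, mul_zero, neg_smul, ite_smul, zero_smul,
    thetaX_mul_thetaY, smul_neg]
  simp only [neg_neg, Finset.sum_ite_irrel, Finset.sum_const_zero,
    Finset.sum_ite_eq, Finset.sum_ite_eq', Finset.mem_univ, if_true]
  rw [← Finset.sum_add_distrib]
  exact Finset.sum_congr rfl fun j _ => half_smul_add_self _

theorem deRham_thetaY (i j : Fin n) :
    deRham n 𝕜 (thetaY n 𝕜 i j) = ∑ k, thetaY n 𝕜 i k * thetaY n 𝕜 k j := by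
  rw [thetaY, deRham_ι]
  simp only [deRhamOne, LinearMap.coe_mk, AddHom.coe_mk, Fintype.sum_sum_type, GlAff.basis_inl,
    GlAff.lie_X_X, Fintype.sum_prod_type, GlAff.basis_inr, lie_X_Y, GlAff.lie_Y_X, GlAff.lie_Y_Y,
    map_zero, map_neg, map_sub, mul_zero, zero_smul, Finset.sum_const_zero, zero_add,
    apply_ite (dualBasis n 𝕜 (Sum.inr (i, j))), dualBasis_X, dualBasis_Y, reduceCtorEq, if_false,
    ite_self, Sum.inr.injEq, neg_zero, Prod.mk.injEq]
  change ∑ a, ∑ b, ∑ c, ∑ d, _ • (thetaY n 𝕜 a b * thetaY n 𝕜 c d) = _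
  simp only [ite_and, mul_sub, sub_smul, mul_ite, mul_one, mul_zero, ite_smul, zero_smul,
    Finset.sum_sub_distrib, Finset.sum_ite_irrel, Finset.sum_const_zero, Finset.sum_ite_eq,
    Finset.sum_ite_eq', Finset.mem_univ, if_true]
  rw [← Finset.sum_sub_distrib]
  refine Finset.sum_congr rfl fun k _ => ?_
  have h : thetaY n 𝕜 k j * thetaY n 𝕜 i k = -(thetaY n 𝕜 i k * thetaY n 𝕜 k j) := ι_anticomm _ _
  rw [h, smul_neg, sub_neg_eq_add, half_smul_add_self]

/-- A symmetric array contracted with anticommuting generators equals its own negative, and `2` is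
invertible. -/
theorem sum_symm_tmul_thetaX (c : Fin n → Fin n → FN n 𝕜) (hc : ∀ k l, c k l = c l k) :
    ∑ k, ∑ l, c k l ⊗ₜ[𝕜] (thetaX n 𝕜 k * thetaX n 𝕜 l) = 0 := by
  have h : ∑ k, ∑ l, c k l ⊗ₜ[𝕜] (thetaX n 𝕜 k * thetaX n 𝕜 l) =
      -∑ k, ∑ l, c k l ⊗ₜ[𝕜] (thetaX n 𝕜 k * thetaX n 𝕜 l) := by
    conv_lhs => rw [Finset.sum_comm]
    rw [← Finset.sum_neg_distrib]
    refine Finset.sum_congr rfl fun k _ => ?_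
    rw [← Finset.sum_neg_distrib]
    refine Finset.sum_congr rfl fun l _ => ?_
    rw [hc l k, ← TensorProduct.tmul_neg]
    congr 1
    exact ι_anticomm _ _
  rw [← half_smul_add_self (𝕜 := 𝕜) (∑ k, ∑ l, c k l ⊗ₜ[𝕜] (thetaX n 𝕜 k * thetaX n 𝕜 l)),
    ← smul_add]
  nth_rewrite 1 [h]
  rw [neg_add_cancel, smul_zero]

/-- The coaction changes `dθ^k` only by the terms `η^k_{jl} θ^l ∧ θ^j`, which vanish because `η` is
symmetric in its lower indices. -/
theorem extDer_coactExt_thetaX (k : Fin n) : extDer n 𝕜 (coactExt n 𝕜 (thetaX n 𝕜 k)) =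
    coactExt n 𝕜 (deRham n 𝕜 (thetaX n 𝕜 k)) := by
  rw [coactExt_thetaX, extDer_tmul, deRham_thetaX, map_sum]
  simp only [Derivation.map_one_eq_zero, TensorProduct.zero_tmul, Finset.sum_const_zero, sub_zero,
    map_mul, coactExt_thetaX, coactExt_thetaY, add_mul, Finset.sum_mul,
    Algebra.TensorProduct.tmul_mul_tmul, mul_one, Finset.sum_add_distrib, TensorProduct.tmul_sum]
  rw [Finset.sum_comm, sum_symm_tmul_thetaX (fun l j => eta k j l) fun l j => eta_symm _ _ _,
    add_zero]

theorem tri_X_eta (l i j k : Fin n) : tri n 𝕜 (GlAff.X 𝕜 l) (eta i j k) =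
    MvPowerSeries.constantCoeff (MvPowerSeries.pderiv (FN n 𝕜) j
        (MvPowerSeries.pderiv (FN n 𝕜) k (MvPowerSeries.pderiv (FN n 𝕜) l
          ((FN.univ n 𝕜).toFun i)))) - ∑ m, eta i m l * eta m j k := by
  rw [tri_eta]
  simp [GlAff.transl_X, GlAff.lin_X, Pi.single_apply]

theorem tri_Y_eta (a b i j k : Fin n) : tri n 𝕜 (GlAff.Y 𝕜 a b) (eta i j k) =
    (if b = j then eta i k a else 0) + (if b = k then eta i j a else 0) -
      if i = a then eta b j k else 0 := by
  rw [tri_eta]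
  simp only [GlAff.transl_Y, GlAff.lin_Y, Matrix.single_apply, Pi.zero_apply, zero_smul, zero_add,
    Finset.sum_const_zero, add_zero, ite_and, ite_smul, one_smul, apply_ite (algebraMap 𝕜 (FN n 𝕜)),
    map_one, map_zero, ite_mul, one_mul, zero_mul, Finset.sum_add_distrib, Finset.sum_ite_eq,
    Finset.sum_ite_irrel, Finset.mem_univ, if_true, eq_comm]

/-- Compare by degree in `η`. The terms linear in `η` match through the action of the `Y_a^b` on `η`
and the differential of the `θ^k`; the quadratic ones match the quadratic part of `X_l ▷ η`; the
third derivatives of `ψ` disappear by symmetry. -/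
theorem extDer_coactExt_thetaY (i j : Fin n) : extDer n 𝕜 (coactExt n 𝕜 (thetaY n 𝕜 i j)) =
    coactExt n 𝕜 (deRham n 𝕜 (thetaY n 𝕜 i j)) := by
  rw [coactExt_thetaY, deRham_thetaY, map_sum, map_add, map_sum]
  simp only [extDer_tmul, Derivation.map_one_eq_zero, TensorProduct.zero_tmul,
    Finset.sum_const_zero, sub_zero, map_mul, coactExt_thetaY, add_mul, mul_add, Finset.sum_mul,
    Finset.mul_sum, Algebra.TensorProduct.tmul_mul_tmul, mul_one, one_mul, Finset.sum_add_distrib,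
    TensorProduct.tmul_sum, deRham_thetaX, deRham_thetaY, Fintype.sum_sum_type, GlAff.basis_inl,
    GlAff.basis_inr, Fintype.sum_prod_type, tri_X_eta, tri_Y_eta, TensorProduct.sub_tmul,
    TensorProduct.add_tmul, Finset.sum_sub_distrib, ← thetaX.eq_1, ← thetaY.eq_1,
    TensorProduct.sum_tmul, TensorProduct.ite_tmul]
  have h1 := sum_symm_tmul_thetaX (n := n) (𝕜 := 𝕜) (fun l k => MvPowerSeries.constantCoeff
    (MvPowerSeries.pderiv (FN n 𝕜) j (MvPowerSeries.pderiv (FN n 𝕜) k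
      (MvPowerSeries.pderiv (FN n 𝕜) l ((FN.univ n 𝕜).toFun i))))) fun k l => by
    rw [Forms.pderiv_comm _ l k]
  rw [Finset.sum_comm] at h1
  rw [h1]
  simp only [Finset.sum_ite_irrel, Finset.sum_const_zero, Finset.sum_ite_eq, Finset.sum_ite_eq',
    Finset.mem_univ, if_true, thetaX_mul_thetaY, TensorProduct.tmul_neg, Finset.sum_neg_distrib]
  -- The remaining terms agree up to renaming summation indices and the symmetry of `η`; `h2` to
  -- `h5` bring them to a common form.
  have h2 : ∑ x, ∑ y, (eta i x y : FN n 𝕜) ⊗ₜ[𝕜] (thetaY n 𝕜 y j * thetaX n 𝕜 x) =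
      ∑ x, ∑ y, (eta i x y : FN n 𝕜) ⊗ₜ[𝕜] (thetaY n 𝕜 x j * thetaX n 𝕜 y) := by
    rw [Finset.sum_comm]
    simp only [eta_symm i]
  have h3 : ∑ x, ∑ y, (eta i j y : FN n 𝕜) ⊗ₜ[𝕜] (thetaY n 𝕜 y x * thetaX n 𝕜 x) =
      ∑ x, ∑ y, (eta i j x : FN n 𝕜) ⊗ₜ[𝕜] (thetaY n 𝕜 x y * thetaX n 𝕜 y) := Finset.sum_comm
  have h4 : ∑ x, ∑ y, (eta y j x : FN n 𝕜) ⊗ₜ[𝕜] (thetaY n 𝕜 i y * thetaX n 𝕜 x) =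
      ∑ x, ∑ y, (eta x j y : FN n 𝕜) ⊗ₜ[𝕜] (thetaY n 𝕜 i x * thetaX n 𝕜 y) := Finset.sum_comm
  have h5 : ∑ x, ∑ y, ∑ a, (eta i a y * eta a j x : FN n 𝕜) ⊗ₜ[𝕜] (thetaX n 𝕜 y * thetaX n 𝕜 x) =
      ∑ a, ∑ x, ∑ y, (eta i a y * eta a j x : FN n 𝕜) ⊗ₜ[𝕜]
        (thetaX n 𝕜 y * thetaX n 𝕜 x) := by
    rw [Finset.sum_comm_cycle]
  rw [h2, h3, h4, h5]
  abel

/-- Both sides are odd derivations along the algebra map `coactExt`, the sign being supplied by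
`coactExt_parity`, so agreement on the generators `θ^k` and `θ^i_j` suffices. -/
theorem extDer_coactExt (η : ExtS n 𝕜) :
    extDer n 𝕜 (coactExt n 𝕜 η) = coactExt n 𝕜 (deRham n 𝕜 η) := by
  induction η using ExteriorAlgebra.induction with
  | algebraMap r =>
    rw [AlgHom.commutes, Algebra.algebraMap_eq_smul_one, Algebra.algebraMap_eq_smul_one, map_smul,
      map_smul, deRham_one, Algebra.TensorProduct.one_def, extDer_tmul, deRham_one]
    simp
  | ι θ =>
    have h : extDer n 𝕜 ∘ₗ (coactExt n 𝕜).toLinearMap ∘ₗ ExteriorAlgebra.ι 𝕜 =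
        (coactExt n 𝕜).toLinearMap ∘ₗ deRham n 𝕜 ∘ₗ ExteriorAlgebra.ι 𝕜 := by
      refine (GlAff.basis n 𝕜).dualBasis.ext fun b => ?_
      rw [Module.Basis.coe_dualBasis]
      rcases b with k | ⟨i, j⟩
      · exact extDer_coactExt_thetaX k
      · exact extDer_coactExt_thetaY i j
    exact LinearMap.congr_fun h θ
  | mul a b ha hb => rw [map_mul, extDer_mul, ha, hb, deRham_mul, map_add, map_mul, map_mul,
      coactExt_parity]
  | add a b ha hb => simp only [map_add, ha, hb]

end ExteriorCoaction

/-! ### Pull-back of forms along a moving point of `N` -/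

namespace Forms

variable {n : ℕ} {𝕜 : Type u} [Field 𝕜] {A : Type v} [CommRing A] [Algebra 𝕜 A]
  {B : Type w} [CommRing B] [Algebra 𝕜 B]

theorem wedge_apply (m m' : Forms n B) : wedge (𝕜 := 𝕜) m m' =
    (m.1 * m'.1, fun i => m.1 * m'.2 i + m.2 i * m'.1) := rfl

theorem pullback_apply (φ : Diffeo n B) (m : Forms n B) : pullback φ m =
    (MvPowerSeries.substAlgHom φ.hasSubst m.1, fun j => ∑ i,
      MvPowerSeries.substAlgHom φ.hasSubst (m.2 i) * MvPowerSeries.pderiv B j (φ.toFun i)) := rfl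

theorem map_algHom_apply (g : A →ₐ[𝕜] B) (m : Forms n A) : map g.toLinearMap m =
    (MvPowerSeries.map g.toRingHom m.1, fun i => MvPowerSeries.map g.toRingHom (m.2 i)) := rfl

theorem map_derivation_apply (D : Derivation 𝕜 B B) (m : Forms n B) : map D.toLinearMap m =
    (psDer D m.1, fun i => psDer D (m.2 i)) := rfl

theorem lieDer_apply (V : Fin n → PS n B) (m : Forms n B) : lieDer V m =
    (∑ j, V j * MvPowerSeries.pderiv B j m.1, fun i => ∑ j,
      (V j * MvPowerSeries.pderiv B j (m.2 i) + m.2 j * MvPowerSeries.pderiv B i (V j))) := rfl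

theorem act_apply (Z : GlAff n 𝕜) (m : Forms n B) : act Z m = -lieDer (affineField n Z) m := rfl

theorem map_wedge (g : A →ₐ[𝕜] B) (m m' : Forms n A) : map g.toLinearMap (wedge (𝕜 := 𝕜) m m') =
    wedge (𝕜 := 𝕜) (map g.toLinearMap m) (map g.toLinearMap m') := by
  simp only [wedge_apply, map_algHom_apply, map_mul, map_add]

theorem pullback_wedge (φ : Diffeo n B) (m m' : Forms n B) : pullback φ (wedge (𝕜 := 𝕜) m m') =
    wedge (𝕜 := 𝕜) (pullback φ m) (pullback φ m') := by
  simp only [wedge_apply, pullback_apply, map_mul, map_add, add_mul, Finset.sum_add_distrib,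
    Finset.mul_sum, Finset.sum_mul]
  congr 1
  funext j
  congr 1
  · exact Finset.sum_congr rfl fun i _ => mul_assoc _ _ _
  · exact Finset.sum_congr rfl fun i _ => mul_right_comm _ _ _

theorem wedge_smul_smul (b b' : B) (m m' : Forms n B) :
    wedge (𝕜 := 𝕜) (b • m) (b' • m') = (b * b') • wedge (𝕜 := 𝕜) m m' := by
  ext1
  · exact smul_mul_smul_comm b m.1 b' m'.1
  · funext i
    change b • m.1 * b' • m'.2 i + b • m.2 i * b' • m'.1 =
      (b * b') • (m.1 * m'.2 i + m.2 i * m'.1)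
    rw [smul_mul_smul_comm, smul_mul_smul_comm, smul_add]

theorem lieDer_wedge (V : Fin n → PS n B) (m m' : Forms n B) :
    lieDer V (wedge (𝕜 := 𝕜) m m') =
      wedge (𝕜 := 𝕜) (lieDer V m) m' + wedge (𝕜 := 𝕜) m (lieDer V m') := by
  simp only [wedge_apply, lieDer_apply, Prod.mk_add_mk]
  congr 1
  · rw [Finset.sum_mul, Finset.mul_sum, ← Finset.sum_add_distrib]
    refine Finset.sum_congr rfl fun j _ => ?_
    rw [Derivation.leibniz, smul_eq_mul, smul_eq_mul]
    ring
  · funext i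
    simp only [Pi.add_apply, Finset.sum_mul, Finset.mul_sum, ← Finset.sum_add_distrib]
    refine Finset.sum_congr rfl fun j _ => ?_
    simp only [map_add, Derivation.leibniz, smul_eq_mul]
    ring

theorem map_derivation_wedge (D : Derivation 𝕜 B B) (m m' : Forms n B) :
    map D.toLinearMap (wedge (𝕜 := 𝕜) m m') = wedge (𝕜 := 𝕜) (map D.toLinearMap m) m' +
      wedge (𝕜 := 𝕜) m (map D.toLinearMap m') := by
  simp only [wedge_apply, map_derivation_apply, Prod.mk_add_mk, map_add, Derivation.leibniz,
    smul_eq_mul]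
  congr 1
  · ring
  · funext i
    simp only [Pi.add_apply]
    ring

theorem map_derivation_smul (D : Derivation 𝕜 B B) (b : B) (m : Forms n B) :
    map D.toLinearMap (b • m) = b • map D.toLinearMap m + D b • m := by
  have h : ∀ f : PS n B, psDer D (b • f) = b • psDer D f + D b • f := fun f => by
    ext J
    simp only [coeff_psDer, map_add, MvPowerSeries.coeff_smul, smul_eq_mul, Derivation.leibniz]
    ring
  simp only [map_derivation_apply, Prod.smul_fst, Prod.smul_snd, Pi.smul_apply, h]
  rfl

theorem lieDer_map (g : A →ₐ[𝕜] B) (Z : GlAff n 𝕜) (m : Forms n A) :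
    lieDer (affineField n Z) (map g.toLinearMap m) =
      map g.toLinearMap (lieDer (affineField n Z) m) := by
  simp only [map_algHom_apply, lieDer_apply, map_sum, map_add, map_mul, map_pderiv,
    map_affineField]

/-- The Lie derivative of a fixed form as a linear function of the vector field. -/
def lieDerOf (m : Forms n B) : (Fin n → PS n B) →ₗ[B] Forms n B where
  toFun V := lieDer V m
  map_add' V W := by
    simp only [lieDer_apply, Prod.mk_add_mk, Pi.add_apply, add_mul, Finset.sum_add_distrib, map_add,
      mul_add]
    congr 1
    funext i
    simp only [Pi.add_apply]
    abel
  map_smul' c V := by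
    simp only [lieDer_apply, Prod.smul_mk, Pi.smul_apply, smul_mul_assoc, Finset.smul_sum,
      RingHom.id_apply, Derivation.map_smul, mul_smul_comm]
    congr 1
    funext i
    simp only [Pi.smul_apply, Finset.smul_sum, smul_add]

/-- Infinitesimal naturality of the pull-back: if `φ` moves with velocity `V` applied to `φ` minus
`W` at `φ`, then `D - L_V` after `φ^*` equals `φ^*` after `D - L_W`. With `V = Z` and `W = φ ▷ Z`
this gives the equivariance of the pull-back by `N`. -/
theorem map_derivation_pullback (D : Derivation 𝕜 B B) (φ : Diffeo n B) (V W : Fin n → PS n B)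
    (h : ∀ i, psDer D (φ.toFun i) = ∑ j, V j * MvPowerSeries.pderiv B j (φ.toFun i) -
      MvPowerSeries.substAlgHom φ.hasSubst (W i)) (m : Forms n B) :
    map D.toLinearMap (pullback φ m) - lieDer V (pullback φ m) =
      pullback φ (map D.toLinearMap m - lieDer W m) := by
  set s : PS n B →ₐ[B] PS n B := MvPowerSeries.substAlgHom φ.hasSubst with hs
  -- The case of functions, by the two chain rules: the `V`-terms cancel and the `W`-terms remain.
  have h0 : ∀ f : PS n B, psDer D (s f) - ∑ j, V j * MvPowerSeries.pderiv B j (s f) =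
      s (psDer D f - ∑ j, W j * MvPowerSeries.pderiv B j f) := by
    intro f
    rw [hs, psDer_subst]
    simp only [pderiv_subst 𝕜, h, map_sub, map_sum, map_mul, mul_sub, Finset.sum_sub_distrib,
      Finset.mul_sum]
    rw [Finset.sum_comm, ← hs]
    simp only [mul_left_comm (V _), mul_comm (s (W _))]
    abel
  -- The same for the differentials `dφ^i`: apply `∂_k` to the equation of motion and use that
  -- partial derivatives commute with each other and with `D`.
  have h1 : ∀ i k, psDer D (MvPowerSeries.pderiv B k (φ.toFun i)) -
      ∑ j, (V j * MvPowerSeries.pderiv B j (MvPowerSeries.pderiv B k (φ.toFun i)) +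
        MvPowerSeries.pderiv B j (φ.toFun i) * MvPowerSeries.pderiv B k (V j)) =
      -∑ l, s (MvPowerSeries.pderiv B l (W i)) * MvPowerSeries.pderiv B k (φ.toFun l) := by
    intro i k
    have e : psDer D (MvPowerSeries.pderiv B k (φ.toFun i)) =
        MvPowerSeries.pderiv B k (psDer D (φ.toFun i)) := psMap_pderiv _ _ _
    rw [e, h, map_sub, hs, pderiv_subst 𝕜, map_sum]
    simp only [Derivation.leibniz, smul_eq_mul, pderiv_comm _ k]
    abel
  simp only [pullback_apply, map_derivation_apply, lieDer_apply, Prod.mk_sub_mk, ← hs, h0]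
  congr 1
  funext k
  simp only [Pi.sub_apply, map_sum, Derivation.leibniz, smul_eq_mul]
  -- The Leibniz rule for `(f_i ∘ φ) dφ^i`, grouped so that `h0` applies to the coefficients and
  -- `h1` to the differentials.
  have e1 : ∑ i, (s (m.2 i) * psDer D (MvPowerSeries.pderiv B k (φ.toFun i)) +
      MvPowerSeries.pderiv B k (φ.toFun i) * psDer D (s (m.2 i))) -
      ∑ j, (V j * ∑ i, (s (m.2 i) * MvPowerSeries.pderiv B j
          (MvPowerSeries.pderiv B k (φ.toFun i)) +
        MvPowerSeries.pderiv B k (φ.toFun i) * MvPowerSeries.pderiv B j (s (m.2 i))) +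
        (∑ i, s (m.2 i) * MvPowerSeries.pderiv B j (φ.toFun i)) * MvPowerSeries.pderiv B k (V j)) =
      ∑ i, (s (m.2 i) * (psDer D (MvPowerSeries.pderiv B k (φ.toFun i)) -
        ∑ j, (V j * MvPowerSeries.pderiv B j (MvPowerSeries.pderiv B k (φ.toFun i)) +
          MvPowerSeries.pderiv B j (φ.toFun i) * MvPowerSeries.pderiv B k (V j))) +
        MvPowerSeries.pderiv B k (φ.toFun i) *
          (psDer D (s (m.2 i)) - ∑ j, V j * MvPowerSeries.pderiv B j (s (m.2 i)))) := by
    simp only [Finset.mul_sum, Finset.sum_mul, ← Finset.sum_add_distrib]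
    rw [Finset.sum_comm, ← Finset.sum_sub_distrib]
    refine Finset.sum_congr rfl fun i _ => ?_
    rw [mul_sub, mul_sub, Finset.mul_sum, Finset.mul_sum, sub_add_sub_comm,
      ← Finset.sum_add_distrib]
    congr 1
    exact Finset.sum_congr rfl fun j _ => by ring
  rw [e1]
  simp only [h0, h1]
  have e2 : ∀ l, s (psDer D (m.2 l) - ∑ j, (W j * MvPowerSeries.pderiv B j (m.2 l) +
      m.2 j * MvPowerSeries.pderiv B l (W j))) =
      s (psDer D (m.2 l) - ∑ j, W j * MvPowerSeries.pderiv B j (m.2 l)) -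
        ∑ j, s (m.2 j) * s (MvPowerSeries.pderiv B l (W j)) := fun l => by
    rw [Finset.sum_add_distrib, ← sub_sub, map_sub, map_sum]
    simp only [map_mul]
  simp only [e2]
  simp only [sub_mul, mul_neg, Finset.sum_add_distrib, Finset.sum_sub_distrib,
    Finset.mul_sum, Finset.sum_mul, Finset.sum_neg_distrib]
  rw [neg_add_eq_sub, Finset.sum_comm (f := fun i l => s (m.2 i) *
    (s (MvPowerSeries.pderiv B l (W i)) * MvPowerSeries.pderiv B k (φ.toFun l)))]
  congr 1
  · exact Finset.sum_congr rfl fun i _ => mul_comm _ _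
  · exact Finset.sum_congr rfl fun i _ => Finset.sum_congr rfl fun j _ => (mul_assoc _ _ _).symm

/-- The pull-back of forms by the point of `N` given by `g`, after a change of coefficients. -/
def pull (j : A →ₐ[𝕜] B) (g : FN n 𝕜 →ₐ[𝕜] B) : Forms n A →ₗ[𝕜] Forms n B :=
  (pullback (FN.point g)).restrictScalars 𝕜 ∘ₗ map j.toLinearMap

theorem pull_apply (j : A →ₐ[𝕜] B) (g : FN n 𝕜 →ₐ[𝕜] B) (m : Forms n A) :
    pull j g m = pullback (FN.point g) (map j.toLinearMap m) := rfl

theorem map_smul_coeff (j : A →ₐ[𝕜] B) (a : A) (m : Forms n A) :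
    map j.toLinearMap (a • m) = j a • map j.toLinearMap m := by
  have h : ∀ f : PS n A, MvPowerSeries.map j.toRingHom (a • f) =
      j a • MvPowerSeries.map j.toRingHom f := fun f => by
    ext J
    simp only [MvPowerSeries.coeff_map, MvPowerSeries.coeff_smul, map_mul]
    rfl
  simp only [map_algHom_apply, Prod.smul_fst, Prod.smul_snd, Pi.smul_apply, h]
  rfl

theorem pull_smul_coeff (j : A →ₐ[𝕜] B) (g : FN n 𝕜 →ₐ[𝕜] B) (a : A) (m : Forms n A) :
    pull j g (a • m) = j a • pull j g m := by
  rw [pull_apply, map_smul_coeff, map_smul, pull_apply]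

theorem pull_wedge (j : A →ₐ[𝕜] B) (g : FN n 𝕜 →ₐ[𝕜] B) (m m' : Forms n A) :
    pull j g (wedge (𝕜 := 𝕜) m m') = wedge (𝕜 := 𝕜) (pull j g m) (pull j g m') := by
  rw [pull_apply, map_wedge, pullback_wedge]
  rfl

variable [CharZero 𝕜]

/-- Equivariance of the pull-back by points of `N`. -/
theorem act_add_map_pull (j : A →ₐ[𝕜] B) (g : FN n 𝕜 →ₐ[𝕜] B) (D : Derivation 𝕜 B B)
    (DA : GlAff n 𝕜 → A →ₗ[𝕜] A) (Z : GlAff n 𝕜)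
    (h₁ : ∀ a, D (j a) = twist (fun t => g (etaT t)) (fun Z => j (DA Z a)) Z)
    (h₂ : ∀ f, D (g f) = g (tri n 𝕜 Z f)) (m : Forms n A) :
    act Z (pull j g m) + map D.toLinearMap (pull j g m) =
      twist (fun t => g (etaT t)) (fun Z => pull j g (act Z m + map (DA Z) m)) Z := by
  rw [derivation_comp_iff] at h₂
  rw [act_apply, neg_add_eq_sub, pull_apply, map_derivation_pullback D _ _ _ h₂]
  have e1 : map D.toLinearMap (map j.toLinearMap m) =
      twist (fun t => g (etaT t)) (fun Z => map j.toLinearMap (map (DA Z) m)) Z := by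
    have e : ∀ f : PS n A, psDer D (psMap j.toLinearMap f) =
        twist (fun t => g (etaT t)) (fun Z => psMap j.toLinearMap (psMap (DA Z) f)) Z := fun f => by
      ext J
      rw [coeff_psDer, coeff_psMap]
      refine (h₁ _).trans ?_
      simp only [twist, map_add, map_sum, MvPowerSeries.coeff_smul, coeff_psMap]
      rfl
    rw [map_derivation_apply]
    ext1
    · refine (e _).trans ?_
      simp only [twist, Prod.fst_add, Prod.fst_sum, Prod.smul_fst]
      rfl
    · funext i
      refine (e _).trans ?_
      simp only [twist, Prod.snd_add, Prod.snd_sum, Prod.smul_snd, Pi.add_apply, Finset.sum_apply,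
        Pi.smul_apply]
      rfl
  -- The twist has coefficients in `B`, that is, constant in the coordinates `x`, so the Lie
  -- derivative along the twisted field is the twist of the Lie derivatives.
  have e2 : lieDer (twist (fun t => g (etaT t)) (affineField n) Z) (map j.toLinearMap m) =
      twist (fun t => g (etaT t)) (fun Z => map j.toLinearMap (lieDer (affineField n Z) m)) Z := by
    simp only [← lieDer_map]
    exact map_twist (lieDerOf (map j.toLinearMap m)) _ _ _
  rw [e1, e2, ← twist_sub, map_twist]
  congr 1
  funext Z
  rw [← map_sub, pull_apply, act_apply, neg_add_eq_sub, map_sub (map j.toLinearMap)]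

end Forms

/-! ### Functoriality of the pull-back and removal of the antipode -/

namespace Forms

variable {n : ℕ} {𝕜 : Type u} [Field 𝕜] {A : Type v} [CommRing A] [Algebra 𝕜 A]
  {B : Type w} [CommRing B] [Algebra 𝕜 B] {B' : Type w} [CommRing B'] [Algebra 𝕜 B']

theorem map_comp_algHom (f : A →ₐ[𝕜] B) (g : B →ₐ[𝕜] B') (m : Forms n A) :
    map (g.comp f).toLinearMap m = map g.toLinearMap (map f.toLinearMap m) := rfl

theorem map_pullback (g : A →ₐ[𝕜] B) (φ : Diffeo n A) (m : Forms n A) :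
    map g.toLinearMap (pullback φ m) =
      pullback (Diffeo.map g.toRingHom φ) (map g.toLinearMap m) := by
  simp only [map_algHom_apply, pullback_apply, map_sum, map_mul, map_substAlgHom, map_pderiv,
    Diffeo.map_toFun]

theorem pullback_mul (𝕜 : Type u) [Field 𝕜] [Algebra 𝕜 B] (φ ψ : Diffeo n B) (m : Forms n B) :
    pullback (φ * ψ) m = pullback ψ (pullback φ m) := by
  have h : ∀ i, (φ * ψ).toFun i = MvPowerSeries.substAlgHom ψ.hasSubst (φ.toFun i) := fun i => by
    rw [MvPowerSeries.coe_substAlgHom]; rfl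
  simp only [pullback_apply, Diffeo.substAlgHom_mul]
  congr 1
  funext k
  simp only [h, pderiv_subst 𝕜, map_sum, map_mul, Finset.mul_sum, Finset.sum_mul]
  rw [Finset.sum_comm]
  exact Finset.sum_congr rfl fun l _ => Finset.sum_congr rfl fun i _ => (mul_assoc _ _ _).symm

theorem map_pull (k : B →ₐ[𝕜] B') (j : A →ₐ[𝕜] B) (g : FN n 𝕜 →ₐ[𝕜] B) (m : Forms n A) :
    map k.toLinearMap (pull j g m) = pull (k.comp j) (k.comp g) m := by
  rw [pull_apply, map_pullback, pull_apply, FN.point_comp, map_comp_algHom]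

variable [CharZero 𝕜]

/-- The coaction is pull-back along `ψ⁻¹`, and the antipode replaces `ψ` by `ψ⁻¹` once more; what
remains is pull-back along `ψ`. -/
theorem coactAnti_apply (m : Forms n A) : coactAnti (𝕜 := 𝕜) A m =
    pull (Algebra.TensorProduct.includeLeft : A →ₐ[𝕜] A ⊗[𝕜] FN n 𝕜)
      Algebra.TensorProduct.includeRight m := by
  let σ : A ⊗[𝕜] FN n 𝕜 →ₐ[𝕜] A ⊗[𝕜] FN n 𝕜 :=
    Algebra.TensorProduct.map (AlgHom.id 𝕜 A) (FN.antipodeHom n 𝕜)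
  have h1 : coactAnti (𝕜 := 𝕜) A m = map σ.toLinearMap (coact (𝕜 := 𝕜) A m) := rfl
  have h2 : σ.comp (Algebra.TensorProduct.includeRight : FN n 𝕜 →ₐ[𝕜] A ⊗[𝕜] FN n 𝕜) =
      AlgHom.comp Algebra.TensorProduct.includeRight (FN.antipodeHom n 𝕜) := by
    ext x; simp [σ]
  have h3 : σ.comp (Algebra.TensorProduct.includeLeft : A →ₐ[𝕜] A ⊗[𝕜] FN n 𝕜) =
      Algebra.TensorProduct.includeLeft := by
    ext x; simp [σ]
  have h4 : coact (𝕜 := 𝕜) A m = pullback (FN.point (Algebra.TensorProduct.includeRight :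
      FN n 𝕜 →ₐ[𝕜] A ⊗[𝕜] FN n 𝕜))⁻¹ (map (Algebra.TensorProduct.includeLeft :
        A →ₐ[𝕜] A ⊗[𝕜] FN n 𝕜).toLinearMap m) := rfl
  rw [h1, h4, map_pullback, ← map_comp_algHom, h3, map_inv, ← FN.point_comp, h2, FN.point_comp,
    pull_apply]
  congr 2
  have h5 : FN.point (FN.antipodeHom n 𝕜) = (FN.univ n 𝕜)⁻¹ := FN.map_antipodeHom
  rw [h5, map_inv, inv_inv]
  rfl

end Forms

/-! ### The right action of `N` on `⋀ s^* ⊗ Ω^{≤1}` -/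

section Cochains

variable {n : ℕ} {𝕜 : Type u} [Field 𝕜] {A B B' : Type u} [CommRing A] [Algebra 𝕜 A]
  [CommRing B] [Algebra 𝕜 B] [CommRing B'] [Algebra 𝕜 B']

/-- `b ⊗ ζ ↦ ζ ⊗ b m`. -/
def coeffMul (m : Forms n B) : B ⊗[𝕜] ExtS n 𝕜 →ₗ[𝕜] ExtS n 𝕜 ⊗[𝕜] Forms n B :=
  (TensorProduct.comm 𝕜 (Forms n B) (ExtS n 𝕜)).toLinearMap ∘ₗ
    TensorProduct.map ((LinearMap.toSpanSingleton B (Forms n B) m).restrictScalars 𝕜) LinearMap.id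

@[simp] theorem coeffMul_tmul (m : Forms n B) (b : B) (ζ : ExtS n 𝕜) :
    coeffMul m (b ⊗ₜ[𝕜] ζ) = ζ ⊗ₜ[𝕜] (b • m) := rfl

theorem coeffMul_add (m m' : Forms n B) (t : B ⊗[𝕜] ExtS n 𝕜) :
    coeffMul (m + m') t = coeffMul m t + coeffMul m' t := by
  induction t with
  | zero => simp
  | add x y hx hy => simp only [map_add, hx, hy]; abel
  | tmul b ζ => simp [TensorProduct.tmul_add]

theorem coeffMul_smul (b : B) (m : Forms n B) (t : B ⊗[𝕜] ExtS n 𝕜) :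
    coeffMul (b • m) t = coeffMul m ((b ⊗ₜ[𝕜] 1) * t) := by
  induction t with
  | zero => simp
  | add x y hx hy => rw [map_add, hx, hy, mul_add, map_add]
  | tmul c ζ =>
    rw [Algebra.TensorProduct.tmul_mul_tmul, coeffMul_tmul, coeffMul_tmul, one_mul, smul_smul,
      mul_comm]

/-- The left coaction on `⋀ s^*`, evaluated at the point of `N` given by `g`. -/
def coactAt (g : FN n 𝕜 →ₐ[𝕜] B) : ExtS n 𝕜 →ₐ[𝕜] B ⊗[𝕜] ExtS n 𝕜 :=
  (Algebra.TensorProduct.map g (AlgHom.id 𝕜 _)).comp (coactExt n 𝕜)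

theorem coactAt_apply (g : FN n 𝕜 →ₐ[𝕜] B) (η : ExtS n 𝕜) :
    coactAt g η = Algebra.TensorProduct.map g (AlgHom.id 𝕜 _) (coactExt n 𝕜 η) := rfl

/-- Application of an algebra map to the coefficients. -/
def changeC (j : A →ₐ[𝕜] B) : ExtS n 𝕜 ⊗[𝕜] Forms n A →ₗ[𝕜] ExtS n 𝕜 ⊗[𝕜] Forms n B :=
  TensorProduct.map LinearMap.id (Forms.map j.toLinearMap)

@[simp] theorem changeC_tmul (j : A →ₐ[𝕜] B) (η : ExtS n 𝕜) (m : Forms n A) :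
    changeC j (η ⊗ₜ[𝕜] m) = η ⊗ₜ[𝕜] Forms.map j.toLinearMap m := rfl

theorem changeC_changeC (j : A →ₐ[𝕜] B) (k : B →ₐ[𝕜] B') (x : ExtS n 𝕜 ⊗[𝕜] Forms n A) :
    changeC k (changeC j x) = changeC (k.comp j) x := by
  induction x with
  | zero => simp
  | add x y hx hy => simp only [map_add, hx, hy]
  | tmul η m => rfl

theorem changeC_coeffMul (k : B →ₐ[𝕜] B') (m : Forms n B) (t : B ⊗[𝕜] ExtS n 𝕜) :
    changeC k (coeffMul m t) = coeffMul (Forms.map k.toLinearMap m)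
      (Algebra.TensorProduct.map k (AlgHom.id 𝕜 (ExtS n 𝕜)) t) := by
  induction t with
  | zero => simp
  | add x y hx hy => simp only [map_add, hx, hy]
  | tmul b ζ =>
    rw [coeffMul_tmul, changeC_tmul, Forms.map_smul_coeff, Algebra.TensorProduct.map_tmul,
      coeffMul_tmul]
    rfl

theorem map_coactAt (k : B →ₐ[𝕜] B') (g : FN n 𝕜 →ₐ[𝕜] B) (η : ExtS n 𝕜) :
    Algebra.TensorProduct.map k (AlgHom.id 𝕜 (ExtS n 𝕜)) (coactAt g η) =
      coactAt (k.comp g) η := by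
  rw [coactAt_apply, coactAt_apply, ← AlgHom.comp_apply, ← Algebra.TensorProduct.map_comp]
  rfl

/-- The product on `⋀ s^* ⊗ Ω^{≤1}`, without signs. -/
def mulC : ExtS n 𝕜 ⊗[𝕜] Forms n B →ₗ[𝕜] ExtS n 𝕜 ⊗[𝕜] Forms n B →ₗ[𝕜]
    ExtS n 𝕜 ⊗[𝕜] Forms n B :=
  TensorProduct.map₂ (LinearMap.mul 𝕜 (ExtS n 𝕜)) Forms.wedge

@[simp] theorem mulC_tmul (η ζ : ExtS n 𝕜) (m m' : Forms n B) :
    mulC (η ⊗ₜ[𝕜] m) (ζ ⊗ₜ[𝕜] m') = (η * ζ) ⊗ₜ[𝕜] Forms.wedge (𝕜 := 𝕜) m m' := rfl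

theorem changeC_mulC (k : B →ₐ[𝕜] B') (x y : ExtS n 𝕜 ⊗[𝕜] Forms n B) :
    changeC k (mulC x y) = mulC (changeC k x) (changeC k y) := by
  induction x with
  | zero => simp
  | add x x' hx hx' => simp only [map_add, LinearMap.add_apply, hx, hx']
  | tmul η m =>
    induction y with
    | zero => simp
    | add x x' hx hx' => simp only [map_add, hx, hx']
    | tmul ζ m' => rw [mulC_tmul, changeC_tmul, changeC_tmul, changeC_tmul, mulC_tmul,
        Forms.map_wedge]

theorem mulC_coeffMul (m m' : Forms n B) (s t : B ⊗[𝕜] ExtS n 𝕜) :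
    mulC (coeffMul m s) (coeffMul m' t) = coeffMul (Forms.wedge (𝕜 := 𝕜) m m') (s * t) := by
  induction s with
  | zero => simp
  | add x x' hx hx' => simp only [map_add, LinearMap.add_apply, add_mul, hx, hx']
  | tmul b η =>
    induction t with
    | zero => simp
    | add x x' hx hx' => simp only [map_add, mul_add, hx, hx']
    | tmul c ζ => rw [coeffMul_tmul, coeffMul_tmul, mulC_tmul, Forms.wedge_smul_smul,
        Algebra.TensorProduct.tmul_mul_tmul, coeffMul_tmul]

theorem coactAt_ι (g : FN n 𝕜 →ₐ[𝕜] B) (θ : DualS n 𝕜) :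
    coactAt g (ExteriorAlgebra.ι 𝕜 θ) = (1 : B) ⊗ₜ[𝕜] ExteriorAlgebra.ι 𝕜 θ +
      ∑ i, ∑ j, ∑ k, θ (GlAff.Y 𝕜 i j) • (g (eta i j k) ⊗ₜ[𝕜] thetaX n 𝕜 k) := by
  rw [coactAt_apply, coactExt_ι, coactDual]
  simp only [LinearMap.coe_mk, AddHom.coe_mk, map_add, map_sum, map_smul,
    TensorProduct.map_tmul, LinearMap.id_apply, Algebra.TensorProduct.map_tmul, map_one]
  rfl

/-- The extension of `coactAt g` to the coefficients. -/
def coactLift (j : A →ₐ[𝕜] B) (g : FN n 𝕜 →ₐ[𝕜] B) : A ⊗[𝕜] ExtS n 𝕜 →ₐ[𝕜] B ⊗[𝕜] ExtS n 𝕜 :=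
  Algebra.TensorProduct.lift (Algebra.TensorProduct.includeLeft.comp j) (coactAt g) fun a η => by
    change ((j a) ⊗ₜ[𝕜] 1) * coactAt g η = coactAt g η * ((j a) ⊗ₜ[𝕜] 1)
    induction coactAt g η with
    | zero => simp
    | add x y hx hy => rw [mul_add, add_mul, hx, hy]
    | tmul b ζ => simp [mul_comm]

theorem coactLift_tmul (j : A →ₐ[𝕜] B) (g : FN n 𝕜 →ₐ[𝕜] B) (a : A) (ζ : ExtS n 𝕜) :
    coactLift j g (a ⊗ₜ[𝕜] ζ) = (j a ⊗ₜ[𝕜] 1) * coactAt g ζ :=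
  Algebra.TensorProduct.lift_tmul _ _ _ _ _

variable [CharZero 𝕜]

/-- The action of the point of `N` given by `g` on `⋀ s^* ⊗ Ω^{≤1}`, after a change of
coefficients. -/
def pullC (j : A →ₐ[𝕜] B) (g : FN n 𝕜 →ₐ[𝕜] B) :
    ExtS n 𝕜 ⊗[𝕜] Forms n A →ₗ[𝕜] ExtS n 𝕜 ⊗[𝕜] Forms n B :=
  tailCoact (Algebra.TensorProduct.productMap j g)

/-- The link with the definition of the bicomplex: the tail of the coboundary and the twisted factor
of the cup product are the simultaneous action of one point on forms and on `⋀ s^*`. Later arguments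
use only this description. -/
theorem pullC_tmul (j : A →ₐ[𝕜] B) (g : FN n 𝕜 →ₐ[𝕜] B) (η : ExtS n 𝕜) (m : Forms n A) :
    pullC j g (η ⊗ₜ[𝕜] m) = coeffMul (Forms.pull j g m) (coactAt g η) := by
  rw [pullC, tailCoact, TensorProduct.lift.tmul, LinearMap.comp_apply, coactAt_apply,
    AlgHom.toLinearMap_apply]
  induction coactExt n 𝕜 η with
  | zero => simp
  | add x y hx hy => simp only [map_add, LinearMap.add_apply, hx, hy]
  | tmul h ζ =>
    rw [TensorProduct.lift.tmul, LinearMap.mk₂_apply, Algebra.TensorProduct.map_tmul,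
      coeffMul_tmul]
    change ζ ⊗ₜ[𝕜] _ = ζ ⊗ₜ[𝕜] (g h • Forms.pull j g m)
    congr 1
    have e : ∀ x : Forms n (A ⊗[𝕜] FN n 𝕜),
        Forms.map (Algebra.TensorProduct.productMap j g).toLinearMap
          (Forms.map (LinearMap.mulLeft 𝕜 ((1 : A) ⊗ₜ[𝕜] h)) x) =
        g h • Forms.map (Algebra.TensorProduct.productMap j g).toLinearMap x := by
      have e0 : (1 : A) ⊗ₜ[𝕜] h = (Algebra.TensorProduct.includeRight :
        FN n 𝕜 →ₐ[𝕜] A ⊗[𝕜] FN n 𝕜) h := rfl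
      have e1 : ∀ f : PS n (A ⊗[𝕜] FN n 𝕜),
          Forms.psMap (LinearMap.mulLeft 𝕜 ((1 : A) ⊗ₜ[𝕜] h)) f = ((1 : A) ⊗ₜ[𝕜] h) • f := by
        intro f
        ext J
        rw [Forms.coeff_psMap, MvPowerSeries.coeff_smul]
        rfl
      intro x
      have e2 : Forms.map (LinearMap.mulLeft 𝕜 ((1 : A) ⊗ₜ[𝕜] h)) x = ((1 : A) ⊗ₜ[𝕜] h) • x := by
        ext1
        · exact e1 _
        · funext i
          exact e1 _
      rw [e2, Forms.map_smul_coeff, Algebra.TensorProduct.productMap_apply_tmul, map_one, one_mul]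
    refine (e _).trans ?_
    rw [Forms.coactAnti_apply, Forms.map_pull, Algebra.TensorProduct.productMap_left,
      Algebra.TensorProduct.productMap_right]

theorem changeC_pullC (k : B →ₐ[𝕜] B') (j : A →ₐ[𝕜] B) (g : FN n 𝕜 →ₐ[𝕜] B)
    (x : ExtS n 𝕜 ⊗[𝕜] Forms n A) :
    changeC k (pullC j g x) = pullC (k.comp j) (k.comp g) x := by
  induction x with
  | zero => simp
  | add x y hx hy => simp only [map_add, hx, hy]
  | tmul η m => rw [pullC_tmul, pullC_tmul, changeC_coeffMul, map_coactAt, Forms.map_pull]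

theorem pullC_changeC (k : A →ₐ[𝕜] B) (j : B →ₐ[𝕜] B') (g : FN n 𝕜 →ₐ[𝕜] B')
    (x : ExtS n 𝕜 ⊗[𝕜] Forms n A) :
    pullC j g (changeC k x) = pullC (j.comp k) g x := by
  induction x with
  | zero => simp
  | add x y hx hy => simp only [map_add, hx, hy]
  | tmul η m => rw [changeC_tmul, pullC_tmul, pullC_tmul]; rfl

theorem pullC_mulC (j : A →ₐ[𝕜] B) (g : FN n 𝕜 →ₐ[𝕜] B) (x y : ExtS n 𝕜 ⊗[𝕜] Forms n A) :
    pullC j g (mulC x y) = mulC (pullC j g x) (pullC j g y) := by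
  induction x with
  | zero => simp
  | add x x' hx hx' => simp only [map_add, LinearMap.add_apply, hx, hx']
  | tmul η m =>
    induction y with
    | zero => simp
    | add x x' hx hx' => simp only [map_add, hx, hx']
    | tmul ζ m' => rw [mulC_tmul, pullC_tmul, pullC_tmul, pullC_tmul, mulC_coeffMul,
        Forms.pull_wedge, map_mul]

/-- On generators this is the additivity of `η` on `N` together with the invariance of the `θ^k`, so
no cross terms appear. -/
theorem lift_coactAt (j : A →ₐ[𝕜] B) (g : FN n 𝕜 →ₐ[𝕜] B) (g' : FN n 𝕜 →ₐ[𝕜] A) :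
    (coactLift j g).comp (coactAt g') =
      coactAt (FN.eval (FN.point (j.comp g') * FN.point g)) := by
  refine ExteriorAlgebra.hom_ext (LinearMap.ext fun θ => ?_)
  change coactLift j g (coactAt g' (ExteriorAlgebra.ι 𝕜 θ)) =
    coactAt _ (ExteriorAlgebra.ι 𝕜 θ)
  have hX : ∀ k, coactAt g (thetaX n 𝕜 k) = (1 : B) ⊗ₜ[𝕜] thetaX n 𝕜 k := fun k => by
    rw [coactAt_apply, coactExt_thetaX, Algebra.TensorProduct.map_tmul, map_one]
    rfl
  have hE : ∀ i k l, FN.eval (𝕜 := 𝕜) (FN.point (j.comp g') * FN.point g) (eta i k l) =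
      j (g' (eta i k l)) + g (eta i k l) := fun i k l => by
    refine (FN.eval_mul_etaT _ _ (i, k, l)).trans ?_
    rw [FN.eval_point, FN.eval_point]
    rfl
  rw [coactAt_ι, coactAt_ι]
  simp only [map_add, map_sum, map_smul, coactLift_tmul, map_one, one_mul,
    hX, hE, TensorProduct.add_tmul, smul_add, Finset.sum_add_distrib, coactAt_ι,
    Algebra.TensorProduct.tmul_mul_tmul, mul_one]
  rw [← Algebra.TensorProduct.one_def, one_mul]
  abel

/-- A right action: pull-back reverses composition, so the point applied later stands on the right
of the product. -/
theorem pullC_pullC (j : A →ₐ[𝕜] B) (g : FN n 𝕜 →ₐ[𝕜] B) (j' : B' →ₐ[𝕜] A)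
    (g' : FN n 𝕜 →ₐ[𝕜] A) (x : ExtS n 𝕜 ⊗[𝕜] Forms n B') :
    pullC j g (pullC j' g' x) =
      pullC (j.comp j') (FN.eval (FN.point (j.comp g') * FN.point g)) x := by
  induction x with
  | zero => simp
  | add x y hx hy => simp only [map_add, hx, hy]
  | tmul η m =>
    have h : ∀ (m : Forms n A) (t : A ⊗[𝕜] ExtS n 𝕜), pullC j g (coeffMul m t) =
        coeffMul (Forms.pull j g m) (coactLift j g t) := by
      intro m t
      induction t with
      | zero => simp
      | add x y hx hy => simp only [map_add, hx, hy]
      | tmul a ζ =>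
        rw [coeffMul_tmul, pullC_tmul, Forms.pull_smul_coeff, coeffMul_smul, coactLift_tmul]
    rw [pullC_tmul, pullC_tmul, h, ← AlgHom.comp_apply, lift_coactAt, Forms.pull_apply,
      Forms.pull_apply, Forms.pull_apply, FN.point_eval, Forms.pullback_mul 𝕜, Forms.map_pullback,
      Forms.map_comp_algHom, FN.point_comp]

end Cochains

/-! ### The Chevalley-Eilenberg differential and its Leibniz rule -/

section Differential

variable {n : ℕ} {𝕜 : Type u} [Field 𝕜] {A B : Type u} [CommRing A] [Algebra 𝕜 A]
  [CommRing B] [Algebra 𝕜 B]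

theorem twist_X {M : Type*} [AddCommGroup M] [Module B M] (E : Fin n × Fin n × Fin n → B)
    (L : GlAff n 𝕜 → M) (k : Fin n) : twist E L (GlAff.X 𝕜 k) =
      L (GlAff.X 𝕜 k) + ∑ i, ∑ j, E (i, j, k) • L (GlAff.Y 𝕜 i j) := by
  simp [twist, GlAff.transl_X, Fintype.sum_prod_type, Pi.single_apply]

theorem coeffMul_sum {ι : Type*} (s : Finset ι) (m : ι → Forms n B) (t : B ⊗[𝕜] ExtS n 𝕜) :
    coeffMul (∑ i ∈ s, m i) t = ∑ i ∈ s, coeffMul (m i) t := by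
  classical
  induction s using Finset.induction_on with
  | empty =>
    rw [Finset.sum_empty, Finset.sum_empty, ← zero_smul B (0 : Forms n B), coeffMul_smul,
      TensorProduct.zero_tmul, zero_mul, map_zero]
  | insert i s hi ih => rw [Finset.sum_insert hi, Finset.sum_insert hi, coeffMul_add, ih]

/-- The diagonal action of `Z ∈ s` on forms with coefficients, for an action `D` on the
coefficients. -/
def actForms (D : GlAff n 𝕜 → B →ₗ[𝕜] B) (Z : GlAff n 𝕜) : Module.End 𝕜 (Forms n B) :=
  Forms.act Z + Forms.map (D Z)

theorem actForms_apply (D : GlAff n 𝕜 → B →ₗ[𝕜] B) (Z : GlAff n 𝕜) (m : Forms n B) :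
    actForms D Z m = Forms.act Z m + Forms.map (D Z) m := rfl

/-- The Chevalley-Eilenberg differential on `⋀ s^* ⊗ Ω^{≤1}`, for an action `D` of `s` on the
coefficients. -/
def diffC (D : GlAff n 𝕜 → B →ₗ[𝕜] B) : ExtS n 𝕜 ⊗[𝕜] Forms n B →ₗ[𝕜] ExtS n 𝕜 ⊗[𝕜] Forms n B :=
  TensorProduct.map (deRham n 𝕜) LinearMap.id -
    ∑ b, TensorProduct.map (LinearMap.mulLeft 𝕜 (ExteriorAlgebra.ι 𝕜 (dualBasis n 𝕜 b)))
      (actForms D (GlAff.basis n 𝕜 b))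

theorem diffC_tmul (D : GlAff n 𝕜 → B →ₗ[𝕜] B) (η : ExtS n 𝕜) (m : Forms n B) :
    diffC D (η ⊗ₜ[𝕜] m) = deRham n 𝕜 η ⊗ₜ[𝕜] m - ∑ b,
      (ExteriorAlgebra.ι 𝕜 (dualBasis n 𝕜 b) * η) ⊗ₜ[𝕜] actForms D (GlAff.basis n 𝕜 b) m := by
  simp [diffC]

/-- The grading involution of `⋀ s^* ⊗ Ω^{≤1}`. -/
def parityC : ExtS n 𝕜 ⊗[𝕜] Forms n B →ₗ[𝕜] ExtS n 𝕜 ⊗[𝕜] Forms n B :=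
  TensorProduct.map (parity n 𝕜).toLinearMap LinearMap.id

@[simp] theorem parityC_tmul (η : ExtS n 𝕜) (m : Forms n B) :
    parityC (η ⊗ₜ[𝕜] m) = parity n 𝕜 η ⊗ₜ[𝕜] m := rfl

theorem actForms_wedge (D : GlAff n 𝕜 → Derivation 𝕜 B B) (Z : GlAff n 𝕜) (m m' : Forms n B) :
    actForms (fun Z => (D Z).toLinearMap) Z (Forms.wedge (𝕜 := 𝕜) m m') =
      Forms.wedge (𝕜 := 𝕜) (actForms (fun Z => (D Z).toLinearMap) Z m) m' +
      Forms.wedge (𝕜 := 𝕜) m (actForms (fun Z => (D Z).toLinearMap) Z m') := by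
  simp only [actForms_apply, Forms.act_apply, Forms.lieDer_wedge, Forms.map_derivation_wedge,
    map_add, map_neg, LinearMap.add_apply, LinearMap.neg_apply, neg_add]
  abel

theorem actForms_smul (D : GlAff n 𝕜 → Derivation 𝕜 B B) (Z : GlAff n 𝕜) (b : B)
    (m : Forms n B) : actForms (fun Z => (D Z).toLinearMap) Z (b • m) =
      b • actForms (fun Z => (D Z).toLinearMap) Z m + D Z b • m := by
  simp only [actForms_apply, Forms.act_apply, Forms.map_derivation_smul, map_smul, smul_add,
    smul_neg]
  abel

/-- The graded Leibniz rule for the Chevalley-Eilenberg differential. -/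
theorem diffC_mulC (D : GlAff n 𝕜 → Derivation 𝕜 B B) (x y : ExtS n 𝕜 ⊗[𝕜] Forms n B) :
    diffC (fun Z => (D Z).toLinearMap) (mulC x y) =
      mulC (diffC (fun Z => (D Z).toLinearMap) x) y +
      mulC (parityC x) (diffC (fun Z => (D Z).toLinearMap) y) := by
  induction x with
  | zero => simp
  | add x x' hx hx' => simp only [map_add, LinearMap.add_apply, hx, hx']; abel
  | tmul η m =>
    induction y with
    | zero => simp
    | add x x' hx hx' => simp only [map_add, hx, hx']; abel
    | tmul ζ m' =>
      have h : ∀ b, ExteriorAlgebra.ι 𝕜 (dualBasis n 𝕜 b) * (η * ζ) =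
          parity n 𝕜 η * (ExteriorAlgebra.ι 𝕜 (dualBasis n 𝕜 b) * ζ) := fun b => by
        rw [← mul_assoc, ι_mul_eq_parity_mul_ι, mul_assoc]
      rw [mulC_tmul, diffC_tmul, diffC_tmul, diffC_tmul, parityC_tmul]
      simp only [map_sub, map_sum, LinearMap.sub_apply, LinearMap.sum_apply, mulC_tmul, deRham_mul,
        TensorProduct.add_tmul, actForms_wedge, TensorProduct.tmul_add, Finset.sum_add_distrib]
      simp only [h, mul_assoc]
      abel

theorem parityC_coeffMul (m : Forms n B) (g : FN n 𝕜 →ₐ[𝕜] B) (t : FN n 𝕜 ⊗[𝕜] ExtS n 𝕜) :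
    parityC (coeffMul m (Algebra.TensorProduct.map g (AlgHom.id 𝕜 _) t)) =
      coeffMul m (Algebra.TensorProduct.map g (AlgHom.id 𝕜 _) (parityF n 𝕜 t)) := by
  induction t with
  | zero => simp
  | add x y hx hy => simp only [map_add, hx, hy]
  | tmul f ζ => simp [parityF]

/-- A coefficient `g(f)` is differentiated as `g` of the derivative of `f`, so the terms that do not
differentiate the form `m` assemble into `extDer`. This isolates the part governed by
`extDer_coactExt`. -/
theorem diffC_coeffMul (D : GlAff n 𝕜 → Derivation 𝕜 B B) (g : FN n 𝕜 →ₐ[𝕜] B)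
    (h₂ : ∀ Z f, D Z (g f) = g (tri n 𝕜 Z f)) (m : Forms n B) (t : FN n 𝕜 ⊗[𝕜] ExtS n 𝕜) :
    diffC (fun Z => (D Z).toLinearMap)
        (coeffMul m (Algebra.TensorProduct.map g (AlgHom.id 𝕜 _) t)) =
      coeffMul m (Algebra.TensorProduct.map g (AlgHom.id 𝕜 _) (extDer n 𝕜 t)) -
      ∑ b, coeffMul (actForms (fun Z => (D Z).toLinearMap) (GlAff.basis n 𝕜 b) m)
        ((1 ⊗ₜ[𝕜] ExteriorAlgebra.ι 𝕜 (dualBasis n 𝕜 b)) *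
          Algebra.TensorProduct.map g (AlgHom.id 𝕜 _) t) := by
  induction t with
  | zero => simp
  | add x y hx hy => simp only [map_add, hx, hy, mul_add, Finset.sum_add_distrib]; abel
  | tmul f ζ =>
    simp only [Algebra.TensorProduct.map_tmul, coeffMul_tmul, diffC_tmul, extDer_tmul,
      actForms_smul, h₂, map_sub, map_sum, Algebra.TensorProduct.tmul_mul_tmul, one_mul,
      TensorProduct.tmul_add, Finset.sum_add_distrib, AlgHom.coe_id, id]
    abel

theorem diffC_changeC (j : A →ₐ[𝕜] B) (DA : GlAff n 𝕜 → A →ₗ[𝕜] A) (D : GlAff n 𝕜 → B →ₗ[𝕜] B)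
    (h : ∀ Z a, D Z (j a) = j (DA Z a)) (x : ExtS n 𝕜 ⊗[𝕜] Forms n A) :
    diffC D (changeC j x) = changeC j (diffC DA x) := by
  induction x with
  | zero => simp
  | add x y hx hy => simp only [map_add, hx, hy]
  | tmul η m =>
    have hact : ∀ Z, actForms D Z (Forms.map j.toLinearMap m) =
        Forms.map j.toLinearMap (actForms DA Z m) := fun Z => by
      have hD : Forms.map (D Z) (Forms.map j.toLinearMap m) =
          Forms.map j.toLinearMap (Forms.map (DA Z) m) := by
        ext1
        · ext J
          exact h Z _
        · funext i
          ext J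
          exact h Z _
      rw [actForms_apply, actForms_apply, map_add, hD, Forms.act_apply, Forms.act_apply, map_neg,
        Forms.lieDer_map]
    simp only [changeC_tmul, diffC_tmul, map_sub, map_sum, hact]

variable [CharZero 𝕜]

theorem parityC_pullC (j : A →ₐ[𝕜] B) (g : FN n 𝕜 →ₐ[𝕜] B) (x : ExtS n 𝕜 ⊗[𝕜] Forms n A) :
    parityC (pullC j g x) = pullC j g (parityC x) := by
  induction x with
  | zero => simp
  | add x y hx hy => simp only [map_add, hx, hy]
  | tmul η m =>
    rw [pullC_tmul, parityC_tmul, pullC_tmul, coactAt_apply, coactAt_apply, parityC_coeffMul,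
      coactExt_parity]

/-- The Chevalley-Eilenberg differential commutes with the action of `N`. -/
theorem diffC_pullC (j : A →ₐ[𝕜] B) (g : FN n 𝕜 →ₐ[𝕜] B) (D : GlAff n 𝕜 → Derivation 𝕜 B B)
    (DA : GlAff n 𝕜 → A →ₗ[𝕜] A)
    (h₁ : ∀ Z a, D Z (j a) = twist (fun t => g (etaT t)) (fun Z => j (DA Z a)) Z)
    (h₂ : ∀ Z f, D Z (g f) = g (tri n 𝕜 Z f)) (x : ExtS n 𝕜 ⊗[𝕜] Forms n A) :
    diffC (fun Z => (D Z).toLinearMap) (pullC j g x) = pullC j g (diffC DA x) := by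
  induction x with
  | zero => simp
  | add x y hx hy => simp only [map_add, hx, hy]
  | tmul η m =>
    have hact : ∀ Z, actForms (fun Z => (D Z).toLinearMap) Z (Forms.pull j g m) =
        twist (fun t => g (etaT t)) (fun Z => Forms.pull j g (actForms DA Z m)) Z := fun Z =>
      Forms.act_add_map_pull j g (D Z) DA Z (h₁ Z) (h₂ Z) m
    have hX : ∀ k, coactAt g (thetaX n 𝕜 k) = (1 : B) ⊗ₜ[𝕜] thetaX n 𝕜 k := fun k => by
      rw [coactAt_apply, coactExt_thetaX, Algebra.TensorProduct.map_tmul, map_one]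
      rfl
    have hY : ∀ i k, coactAt g (thetaY n 𝕜 i k) = (1 : B) ⊗ₜ[𝕜] thetaY n 𝕜 i k +
        ∑ l, g (eta i k l) ⊗ₜ[𝕜] thetaX n 𝕜 l := fun i k => by
      rw [coactAt_apply, coactExt_thetaY, map_add, map_sum]
      simp only [Algebra.TensorProduct.map_tmul, map_one]
      rfl
    rw [pullC_tmul, coactAt_apply, diffC_coeffMul D g h₂, extDer_coactExt, diffC_tmul, map_sub,
      pullC_tmul, map_sum, coactAt_apply]
    congr 1
    -- What is left is the invariance of the canonical element `∑ v^b ⊗ X_b`. The twist adds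
    -- `η^i_{jk} Y_i^j` to `X_k`, while the coaction adds `η^i_{jk} θ^k` to `θ^i_j`; both sides
    -- acquire the same sum of terms `η^i_{jk} θ^k ⊗ Y_i^j`.
    simp only [pullC_tmul, map_mul, hact]
    rw [← coactAt_apply]
    simp only [Fintype.sum_sum_type, Fintype.sum_prod_type, GlAff.basis_inl, GlAff.basis_inr,
      twist_Y, ← thetaX.eq_1, ← thetaY.eq_1, hX, hY, add_mul, map_add, Finset.sum_mul, map_sum,
      Finset.sum_add_distrib]
    have hlast : ∀ (e : B) (m : Forms n B) (ξ : ExtS n 𝕜) (t : B ⊗[𝕜] ExtS n 𝕜),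
        coeffMul (e • m) ((1 ⊗ₜ[𝕜] ξ) * t) = coeffMul m ((e ⊗ₜ[𝕜] ξ) * t) := fun e m ξ t => by
      rw [coeffMul_smul, ← mul_assoc, Algebra.TensorProduct.tmul_mul_tmul, mul_one, one_mul]
    simp only [twist_X, coeffMul_add, coeffMul_sum, hlast, Finset.sum_add_distrib]
    have hcomm : ∀ F : Fin n → Fin n → Fin n → ExtS n 𝕜 ⊗[𝕜] Forms n B,
        ∑ l, ∑ i, ∑ k, F i k l = ∑ i, ∑ k, ∑ l, F i k l := fun F => by
      rw [Finset.sum_comm]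
      exact Finset.sum_congr rfl fun i _ => Finset.sum_comm
    rw [hcomm, add_assoc, add_comm (∑ i, ∑ k, ∑ l, _)]
    rfl

/-- The vertical coboundary is a graded derivation of the cup product. -/
theorem dCE_cup (q q' : ℕ) (x : Coch n 𝕜 q) (y : Coch n 𝕜 q') :
    dCE (q + q') (cup q q' x y) = cup q q' (dCE q x) y + cup q q' (sgn n 𝕜 q x) (dCE q' y) := by
  have hd : ∀ (q : ℕ) (x : Coch n 𝕜 q), dCE q x =
      diffC (fun Z => (Tens.bulletDer Z : Derivation 𝕜 (Tens n 𝕜 q) _).toLinearMap) x :=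
    fun _ _ => rfl
  have hc : ∀ (x : Coch n 𝕜 q) (y : Coch n 𝕜 q'), cup q q' x y =
      mulC (pullC (Tens.place n 𝕜 (Fin.castAdd q'))
        ((Tens.place n 𝕜 (Fin.natAdd q)).comp (Tens.iterComul n 𝕜 q')) x)
        (changeC (Tens.place n 𝕜 (Fin.natAdd q)) y) := fun _ _ => rfl
  have hs : sgn n 𝕜 q x = parityC x := rfl
  rw [hc, hc, hc, hd, hd, hd, hs, diffC_mulC, parityC_pullC]
  congr 2
  -- The acting point is the product of the last `q'` factors. The two hypotheses are the twisting
  -- of the first block by the second, and the equivariance of `Δ^{(q')}` placed in the final block.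
  · refine congrArg mulC (diffC_pullC (Tens.place n 𝕜 (Fin.castAdd q'))
      ((Tens.place n 𝕜 (Fin.natAdd q)).comp (Tens.iterComul n 𝕜 q')) Tens.bulletDer
      (fun Z => Tens.bullet n 𝕜 q Z) (fun Z a => ?_) (fun Z f => ?_) x)
    · exact Tens.bullet_place_castAdd q q' Z a
    · change Tens.bullet n 𝕜 _ Z (Tens.place n 𝕜 (Fin.natAdd q) _) = _
      rw [Tens.bullet_place_natAdd]
      exact congrArg _ (Tens.bullet_iterComul q' Z f)
  · exact diffC_changeC (Tens.place n 𝕜 (Fin.natAdd q)) (fun Z => Tens.bullet n 𝕜 q' Z)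
      (fun Z => Tens.bullet n 𝕜 (q + q') Z) (Tens.bullet_place_natAdd q q') y

end Differential

/-! ### Iterated coproducts as products of points -/

namespace Tens

variable {n : ℕ} {𝕜 : Type u} [Field 𝕜] {q r : ℕ}

theorem place_id : place n 𝕜 (id : Fin q → Fin q) = AlgHom.id 𝕜 _ :=
  algHom_ext fun i => by rw [place_comp_slot]; rfl

variable [CharZero 𝕜]

theorem point_iterComul_zero : FN.point (iterComul n 𝕜 0) = 1 := by
  have h : iterComul n 𝕜 0 = (Algebra.ofId 𝕜 (Tens n 𝕜 0)).comp (FN.eval 1) := rfl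
  rw [h, FN.comp_eval, FN.point_eval, map_one]

theorem point_iterComul_succ (r : ℕ) : FN.point (iterComul n 𝕜 (r + 1)) =
    FN.point (slot n 𝕜 (0 : Fin (r + 1))) *
      FN.point ((place n 𝕜 Fin.succ).comp (iterComul n 𝕜 r)) := by
  rw [iterComul_succ, FN.point_productMap_comp_comul]

theorem point_comulSlots (i j : Fin r) : FN.point (comulSlots n 𝕜 i j) =
    FN.point (slot n 𝕜 i) * FN.point (slot n 𝕜 j) :=
  FN.point_productMap_comp_comul _ _

/-- The point of `Δ^{(r)}` is `ψ₁⋯ψ_r`. Its definition peels off the first factor; by associativity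
the last can be peeled off instead, as needed when the last face acts on a cup product. -/
theorem point_iterComul_succ_last (r : ℕ) : FN.point (iterComul n 𝕜 (r + 1)) =
    FN.point ((place n 𝕜 Fin.castSucc).comp (iterComul n 𝕜 r)) *
      FN.point (slot n 𝕜 (Fin.last r)) := by
  induction r with
  | zero =>
    rw [point_iterComul_succ, FN.point_comp, FN.point_comp, point_iterComul_zero, map_one, map_one,
      one_mul, mul_one]
    rfl
  | succ r ih =>
    rw [point_iterComul_succ, FN.point_comp, ih, map_mul, ← FN.point_comp, ← FN.point_comp,
      place_comp_slot, FN.point_comp (iterComul n 𝕜 (r + 1)), point_iterComul_succ, map_mul,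
      ← FN.point_comp, ← FN.point_comp, place_comp_slot, ← AlgHom.comp_assoc, ← AlgHom.comp_assoc,
      place_comp_place, place_comp_place, ← mul_assoc]
    rfl

theorem comulAt_comp_slot (i j : Fin q) : (comulAt n 𝕜 i).comp (slot n 𝕜 j) =
    if j < i then slot n 𝕜 j.castSucc else
      if j = i then comulSlots n 𝕜 j.castSucc j.succ else slot n 𝕜 j.succ := by
  rw [comulAt, lift_comp_slot]

theorem place_comp_comulSlots (e : Fin q → Fin r) (i j : Fin q) :
    (place n 𝕜 e).comp (comulSlots n 𝕜 i j) = comulSlots n 𝕜 (e i) (e j) :=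
  FN.point_injective (by
    rw [FN.point_comp, point_comulSlots, map_mul, ← FN.point_comp, ← FN.point_comp,
      place_comp_slot, place_comp_slot, point_comulSlots])

/-- Compatibility of `Δᵢ` with a change of the positions of the factors. -/
theorem comulAt_comp_place (i : Fin q) (i' : Fin r) (e : Fin q → Fin r)
    (f : Fin (q + 1) → Fin (r + 1)) (he : ∀ j, e j < i' ↔ j < i) (he' : ∀ j, e j = i' ↔ j = i)
    (h₁ : ∀ j ≤ i, f j.castSucc = (e j).castSucc) (h₂ : ∀ j, i ≤ j → f j.succ = (e j).succ) :
    (comulAt n 𝕜 i').comp (place n 𝕜 e) = (place n 𝕜 f).comp (comulAt n 𝕜 i) :=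
  algHom_ext fun j => by
    rw [AlgHom.comp_assoc, AlgHom.comp_assoc, place_comp_slot, comulAt_comp_slot,
      comulAt_comp_slot]
    simp only [he, he']
    split_ifs with h h'
    · rw [place_comp_slot, h₁ j h.le]
    · rw [place_comp_comulSlots, h₁ j h'.le, h₂ j h'.ge]
    · rw [place_comp_slot, h₂ j (not_lt.1 h)]

theorem comulAt_comp_place_of_lt (i' : Fin r) (e : Fin q → Fin r) (he : ∀ j, e j < i') :
    (comulAt n 𝕜 i').comp (place n 𝕜 e) = place n 𝕜 fun j => (e j).castSucc :=
  algHom_ext fun j => by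
    rw [AlgHom.comp_assoc, place_comp_slot, place_comp_slot, comulAt_comp_slot, if_pos (he j)]

theorem comulAt_comp_place_of_gt (i' : Fin r) (e : Fin q → Fin r) (he : ∀ j, i' < e j) :
    (comulAt n 𝕜 i').comp (place n 𝕜 e) = place n 𝕜 fun j => (e j).succ :=
  algHom_ext fun j => by
    rw [AlgHom.comp_assoc, place_comp_slot, place_comp_slot, comulAt_comp_slot,
      if_neg (he j).not_gt, if_neg (he j).ne']

/-- Replacing one factor of `ψ₁⋯ψ_q` by a product of two gives a product of `q + 1` factors, by
associativity in `N`. -/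
theorem comulAt_comp_iterComul (i : Fin q) :
    (comulAt n 𝕜 i).comp (iterComul n 𝕜 q) = iterComul n 𝕜 (q + 1) := by
  refine FN.point_injective ?_
  induction q with
  | zero => exact i.elim0
  | succ q ih =>
    rw [FN.point_comp, point_iterComul_succ, map_mul, ← FN.point_comp, ← FN.point_comp,
      ← AlgHom.comp_assoc, point_iterComul_succ (q + 1)]
    cases i using Fin.cases with
    | zero =>
      rw [comulAt_comp_slot, if_neg (lt_irrefl _), if_pos rfl, point_comulSlots,
        comulAt_comp_place_of_gt _ _ Fin.succ_pos, FN.point_comp (iterComul n 𝕜 (q + 1)),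
        point_iterComul_succ, map_mul, ← FN.point_comp, ← FN.point_comp, place_comp_slot,
        ← AlgHom.comp_assoc, place_comp_place, mul_assoc]
      rfl
    | succ i =>
      rw [comulAt_comp_slot, if_pos (Fin.succ_pos i),
        comulAt_comp_place i i.succ Fin.succ Fin.succ (fun _ => Fin.succ_lt_succ_iff)
          (fun _ => Fin.succ_inj) (fun _ _ => rfl) (fun _ _ => rfl), AlgHom.comp_assoc,
        FN.point_comp ((comulAt n 𝕜 i).comp _), ih, ← FN.point_comp]
      rfl

end Tens

/-! ### The faces of a cup product and the horizontal Leibniz rule -/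

section Horizontal

variable {n : ℕ} {𝕜 : Type u} [Field 𝕜]

theorem changeC_id {A : Type u} [CommRing A] [Algebra 𝕜 A] (x : ExtS n 𝕜 ⊗[𝕜] Forms n A) :
    changeC (AlgHom.id 𝕜 A) x = x := by
  induction x with
  | zero => simp
  | add x y hx hy => rw [map_add, hx, hy]
  | tmul η m => rfl

/-- The lengths `q + 1 + q'` and `q + q' + 1` are equal only propositionally; inside the direct sum
the relabelling becomes invisible. -/
theorem column_place_cast {r r' : ℕ} (h : r = r') (x : Coch n 𝕜 r) :
    column n 𝕜 r' (changeC (Tens.place n 𝕜 (Fin.cast h)) x) = column n 𝕜 r x := by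
  subst h
  have : Tens.place n 𝕜 (Fin.cast (rfl : r = r)) = AlgHom.id 𝕜 _ := Tens.place_id
  rw [this, changeC_id]

variable [CharZero 𝕜]

theorem cup_eq (q q' : ℕ) (x : Coch n 𝕜 q) (y : Coch n 𝕜 q') : cup q q' x y =
    mulC (pullC (Tens.place n 𝕜 (Fin.castAdd q'))
      ((Tens.place n 𝕜 (Fin.natAdd q)).comp (Tens.iterComul n 𝕜 q')) x)
      (changeC (Tens.place n 𝕜 (Fin.natAdd q)) y) := rfl

theorem bN_eq (q : ℕ) (x : Coch n 𝕜 q) : bN q x = changeC (Tens.place n 𝕜 Fin.succ) x +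
    ∑ i : Fin q, (-1 : 𝕜) ^ (i.val + 1) • changeC (Tens.comulAt n 𝕜 i) x +
    (-1 : 𝕜) ^ (q + 1) • pullC (Tens.place n 𝕜 Fin.castSucc) (Tens.slot n 𝕜 (Fin.last q)) x := by
  rw [bN, LinearMap.add_apply, LinearMap.add_apply, LinearMap.sum_apply]
  rfl

theorem changeC_cup {q q' : ℕ} {B : Type u} [CommRing B] [Algebra 𝕜 B]
    (k : Tens n 𝕜 (q + q') →ₐ[𝕜] B) (x : Coch n 𝕜 q) (y : Coch n 𝕜 q') :
    changeC k (cup q q' x y) = mulC (pullC (k.comp (Tens.place n 𝕜 (Fin.castAdd q')))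
      ((k.comp (Tens.place n 𝕜 (Fin.natAdd q))).comp (Tens.iterComul n 𝕜 q')) x)
      (changeC (k.comp (Tens.place n 𝕜 (Fin.natAdd q))) y) := by
  rw [cup_eq, changeC_mulC, changeC_pullC, changeC_changeC, AlgHom.comp_assoc]

variable (n 𝕜) in
/-- The identification of `F(N)^{⊗ (q + 1 + q')}` with `F(N)^{⊗ (q + q' + 1)}`. -/
def castSuccAdd (q q' : ℕ) : Tens n 𝕜 (q + 1 + q') →ₐ[𝕜] Tens n 𝕜 (q + q' + 1) :=
  Tens.place n 𝕜 (Fin.cast (Nat.add_right_comm q 1 q'))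

theorem changeC_succ_cup (q q' : ℕ) (x : Coch n 𝕜 q) (y : Coch n 𝕜 q') :
    changeC (Tens.place n 𝕜 Fin.succ) (cup q q' x y) =
    changeC (castSuccAdd n 𝕜 q q') (cup (q + 1) q' (changeC (Tens.place n 𝕜 Fin.succ) x) y) := by
  rw [changeC_cup, changeC_cup, pullC_changeC, castSuccAdd, Tens.place_comp_place,
    Tens.place_comp_place, Tens.place_comp_place, Tens.place_comp_place, Tens.place_comp_place]
  have e1 : Fin.succ ∘ Fin.castAdd q' =
      (Fin.cast (Nat.add_right_comm q 1 q') ∘ Fin.castAdd q') ∘ Fin.succ := by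
    funext i; ext; simp
  have e2 : Fin.succ ∘ Fin.natAdd q =
      (Fin.cast (Nat.add_right_comm q 1 q') ∘ Fin.natAdd (m := q') (q + 1)) := by
    funext i; ext; simp; omega
  rw [e1, e2]

theorem changeC_comulAt_castAdd_cup (q q' : ℕ) (x : Coch n 𝕜 q) (y : Coch n 𝕜 q') (i : Fin q) :
    changeC (Tens.comulAt n 𝕜 (Fin.castAdd q' i)) (cup q q' x y) =
    changeC (castSuccAdd n 𝕜 q q') (cup (q + 1) q' (changeC (Tens.comulAt n 𝕜 i) x) y) := by
  have e1 : (Tens.comulAt n 𝕜 (Fin.castAdd q' i)).comp (Tens.place n 𝕜 (Fin.castAdd q')) =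
      ((castSuccAdd n 𝕜 q q').comp (Tens.place n 𝕜 (Fin.castAdd q'))).comp
        (Tens.comulAt n 𝕜 i) := by
    rw [castSuccAdd, Tens.place_comp_place]
    exact Tens.comulAt_comp_place _ _ _ _ (fun _ => Iff.rfl) (fun _ => Fin.castAdd_inj)
      (fun _ _ => rfl) (fun _ _ => rfl)
  have e2 : (Tens.comulAt n 𝕜 (Fin.castAdd q' i)).comp (Tens.place n 𝕜 (Fin.natAdd q)) =
      (castSuccAdd n 𝕜 q q').comp (Tens.place n 𝕜 (Fin.natAdd (q + 1))) := by
    rw [castSuccAdd, Tens.place_comp_place, Tens.comulAt_comp_place_of_gt]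
    · congr 1
      funext j; ext; simp; omega
    · intro j
      rw [Fin.lt_def, Fin.val_castAdd, Fin.val_natAdd]
      omega
  rw [changeC_cup, changeC_cup, pullC_changeC, e1, e2]

/-- Splitting a factor of `y` does not change the product of all factors of `y`, so the action on
`x` merely becomes that of `q' + 1` factors. -/
theorem changeC_comulAt_natAdd_cup (q q' : ℕ) (x : Coch n 𝕜 q) (y : Coch n 𝕜 q') (i : Fin q') :
    changeC (Tens.comulAt n 𝕜 (Fin.natAdd q i)) (cup q q' x y) =
    cup q (q' + 1) x (changeC (Tens.comulAt n 𝕜 i) y) := by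
  have e1 : (Tens.comulAt n 𝕜 (Fin.natAdd q i)).comp (Tens.place n 𝕜 (Fin.castAdd q')) =
      Tens.place n 𝕜 (Fin.castAdd (q' + 1)) := by
    rw [Tens.comulAt_comp_place_of_lt]
    · rfl
    · intro j
      rw [Fin.lt_def, Fin.val_castAdd, Fin.val_natAdd]
      omega
  have e2 : (Tens.comulAt n 𝕜 (Fin.natAdd q i)).comp (Tens.place n 𝕜 (Fin.natAdd q)) =
      (Tens.place n 𝕜 (Fin.natAdd q)).comp (Tens.comulAt n 𝕜 i) :=
    Tens.comulAt_comp_place _ _ _ _ (fun _ => Fin.natAdd_lt_natAdd_iff ..)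
      (fun _ => Fin.natAdd_inj ..) (fun _ _ => rfl) (fun _ _ => rfl)
  rw [changeC_cup, e1, e2, AlgHom.comp_assoc, Tens.comulAt_comp_iterComul, cup_eq,
    changeC_changeC]

/-- The last point acts on both factors. On `x` it extends the product of `q'` points already acting
to one of `q' + 1`; on `y` it is the last face. -/
theorem pullC_castSucc_cup (q q' : ℕ) (x : Coch n 𝕜 q) (y : Coch n 𝕜 q') :
    pullC (Tens.place n 𝕜 Fin.castSucc) (Tens.slot n 𝕜 (Fin.last (q + q')))
    (cup q q' x y) = cup q (q' + 1) x
      (pullC (Tens.place n 𝕜 Fin.castSucc) (Tens.slot n 𝕜 (Fin.last q')) y) := by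
  rw [cup_eq, cup_eq, pullC_mulC, pullC_pullC, pullC_changeC, changeC_pullC,
    Tens.place_comp_place, Tens.place_comp_place, Tens.place_comp_place, Tens.place_comp_slot]
  have e : FN.eval (FN.point ((Tens.place n 𝕜 Fin.castSucc).comp
        ((Tens.place n 𝕜 (Fin.natAdd q)).comp (Tens.iterComul n 𝕜 q'))) *
      FN.point (Tens.slot n 𝕜 (Fin.last (q + q')))) =
      (Tens.place n 𝕜 (Fin.natAdd q)).comp (Tens.iterComul n 𝕜 (q' + 1)) := by
    refine FN.point_injective ?_
    rw [FN.point_eval, FN.point_comp _ (Tens.place n 𝕜 (Fin.natAdd q)),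
      Tens.point_iterComul_succ_last, map_mul, ← FN.point_comp, ← FN.point_comp,
      Tens.place_comp_slot, ← AlgHom.comp_assoc, ← AlgHom.comp_assoc, Tens.place_comp_place,
      Tens.place_comp_place]
    rfl
  rw [e]
  rfl

/-- On both sides `x` is acted on by `ψ_{q+1}(ψ_{q+2}⋯ψ_{q+q'+1})` and `y` is evaluated at the last
`q'` points. This is the term that cancels in the Leibniz rule. -/
theorem cup_pullC_castSucc (q q' : ℕ) (x : Coch n 𝕜 q) (y : Coch n 𝕜 q') :
    changeC (castSuccAdd n 𝕜 q q') (cup (q + 1) q'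
    (pullC (Tens.place n 𝕜 Fin.castSucc) (Tens.slot n 𝕜 (Fin.last q)) x) y) =
    cup q (q' + 1) x (changeC (Tens.place n 𝕜 Fin.succ) y) := by
  rw [changeC_cup, cup_eq, pullC_pullC, changeC_changeC, castSuccAdd, Tens.place_comp_place,
    Tens.place_comp_place, Tens.place_comp_place, Tens.place_comp_place, Tens.place_comp_slot]
  have e0 : Fin.cast (Nat.add_right_comm q 1 q') ∘ Fin.natAdd (q + 1) =
      Fin.natAdd q ∘ Fin.succ := by
    funext i; ext; simp; omega
  have e1 : (Fin.cast (Nat.add_right_comm q 1 q') ∘ Fin.castAdd q') (Fin.last q) =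
      Fin.natAdd q (0 : Fin (q' + 1)) := rfl
  have e : FN.eval (FN.point (Tens.slot n 𝕜 (Fin.natAdd q (0 : Fin (q' + 1)))) *
      FN.point ((Tens.place n 𝕜 (Fin.natAdd q ∘ Fin.succ)).comp (Tens.iterComul n 𝕜 q'))) =
      (Tens.place n 𝕜 (Fin.natAdd q)).comp (Tens.iterComul n 𝕜 (q' + 1)) := by
    refine FN.point_injective ?_
    rw [FN.point_eval, FN.point_comp _ (Tens.place n 𝕜 (Fin.natAdd q)),
      Tens.point_iterComul_succ, map_mul, ← FN.point_comp, ← FN.point_comp,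
      Tens.place_comp_slot, ← AlgHom.comp_assoc, Tens.place_comp_place]
  rw [e0, e1, e]
  rfl

/-- The cup product with the horizontal coboundary of the first factor, as a cochain with
`q + q' + 1` factors. -/
theorem bN_cup (q q' : ℕ) (x : Coch n 𝕜 q) (y : Coch n 𝕜 q') : bN (q + q') (cup q q' x y) =
    changeC (castSuccAdd n 𝕜 q q') (cup (q + 1) q' (bN q x) y) +
      (-1 : 𝕜) ^ q • cup q (q' + 1) x (bN q' y) := by
  -- Here `u` is the common value of the last face of `x` and the first face of `y`. It enters with
  -- the opposite signs `(-1)^{q+1}` and `(-1)^q`, and is absent from the coboundary of the cup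
  -- product.
  have h : ∀ a b c d u : Coch n 𝕜 (q + q' + 1), a + (b + (c + d)) =
      a + (b + ((-1 : 𝕜) ^ (q + 1) • u + ((-1 : 𝕜) ^ q • u + (c + d)))) := fun a b c d u => by
    rw [← add_assoc (_ • u), ← add_smul, pow_succ, mul_neg_one, neg_add_cancel, zero_smul, zero_add]
  rw [bN_eq, bN_eq, bN_eq, Fin.sum_univ_add, changeC_succ_cup, pullC_castSucc_cup]
  simp only [changeC_comulAt_castAdd_cup, changeC_comulAt_natAdd_cup, map_add, map_sum, map_smul,
    LinearMap.add_apply, LinearMap.sum_apply, LinearMap.smul_apply, cup_pullC_castSucc, smul_add,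
    Finset.smul_sum, smul_smul, ← pow_add, Fin.val_castAdd, Fin.val_natAdd, add_assoc]
  exact h _ _ _ _ _

end Horizontal

/-! ### Behaviour of the operations with respect to degrees -/

section Degrees

variable {n : ℕ} {𝕜 : Type u} [Field 𝕜] {A B : Type u} [CommRing A] [Algebra 𝕜 A]
  [CommRing B] [Algebra 𝕜 B]

theorem ι_mul_mem {p : ℕ} (θ : DualS n 𝕜) {η : ExtS n 𝕜} (hη : η ∈ ⋀[𝕜]^p (DualS n 𝕜)) :
    ExteriorAlgebra.ι 𝕜 θ * η ∈ ⋀[𝕜]^(p + 1) (DualS n 𝕜) := by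
  rw [ExteriorAlgebra.exteriorPower, pow_succ']
  exact Submodule.mul_mem_mul ⟨θ, rfl⟩ hη

theorem ext_mul_mem {p p' : ℕ} {η ζ : ExtS n 𝕜} (hη : η ∈ ⋀[𝕜]^p (DualS n 𝕜))
    (hζ : ζ ∈ ⋀[𝕜]^p' (DualS n 𝕜)) : η * ζ ∈ ⋀[𝕜]^(p + p') (DualS n 𝕜) := by
  rw [ExteriorAlgebra.exteriorPower, pow_add]
  exact Submodule.mul_mem_mul hη hζ

theorem ι_mem (θ : DualS n 𝕜) : ExteriorAlgebra.ι 𝕜 θ ∈ ⋀[𝕜]^1 (DualS n 𝕜) := by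
  rw [ExteriorAlgebra.exteriorPower, pow_one]
  exact ⟨θ, rfl⟩

theorem deRham_mem {p : ℕ} {η : ExtS n 𝕜} (hη : η ∈ ⋀[𝕜]^p (DualS n 𝕜)) :
    deRham n 𝕜 η ∈ ⋀[𝕜]^(p + 1) (DualS n 𝕜) := by
  induction hη using Submodule.pow_induction_on_left' with
  | algebraMap r =>
    rw [Algebra.algebraMap_eq_smul_one, map_smul, deRham_one, smul_zero]
    exact zero_mem _
  | add x y i hx hy h1 h2 =>
    rw [map_add]
    exact add_mem h1 h2
  | mem_mul m hm i x hx h =>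
    obtain ⟨θ, rfl⟩ := hm
    rw [deRham_mul, parity_ι, deRham_ι, neg_mul]
    refine add_mem ?_ (neg_mem (ι_mul_mem θ h))
    -- The index is rearranged because `dθ` has degree two and stands to the left of an element of
    -- degree `i`.
    rw [show i.succ + 1 = 2 + i by omega]
    refine ext_mul_mem ?_ hx
    exact sum_mem fun a _ => sum_mem fun b _ => Submodule.smul_mem _ _ (ι_mul_mem _ (ι_mem _))

/-- The cochains of degree `p` with values in a space `W` of forms. -/
def homC (p : ℕ) (W : Submodule 𝕜 (Forms n B)) : Submodule 𝕜 (ExtS n 𝕜 ⊗[𝕜] Forms n B) :=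
  LinearMap.range (TensorProduct.map (⋀[𝕜]^p (DualS n 𝕜)).subtype W.subtype)

theorem tmul_mem_homC {p : ℕ} {W : Submodule 𝕜 (Forms n B)} {η : ExtS n 𝕜} {m : Forms n B}
    (hη : η ∈ ⋀[𝕜]^p (DualS n 𝕜)) (hm : m ∈ W) : η ⊗ₜ[𝕜] m ∈ homC p W :=
  ⟨(⟨η, hη⟩ : ⋀[𝕜]^p (DualS n 𝕜)) ⊗ₜ[𝕜] (⟨m, hm⟩ : W), rfl⟩

theorem map_mem_of_mem_homC {M : Type*} [AddCommGroup M] [Module 𝕜 M] {p : ℕ}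
    {W : Submodule 𝕜 (Forms n B)} (f : ExtS n 𝕜 ⊗[𝕜] Forms n B →ₗ[𝕜] M) (S : Submodule 𝕜 M)
    (h : ∀ η ∈ ⋀[𝕜]^p (DualS n 𝕜), ∀ m ∈ W, f (η ⊗ₜ[𝕜] m) ∈ S)
    {x : ExtS n 𝕜 ⊗[𝕜] Forms n B} (hx : x ∈ homC p W) : f x ∈ S := by
  obtain ⟨w, rfl⟩ := hx
  induction w with
  | zero => simp
  | add x y hx hy =>
    rw [map_add, map_add]
    exact add_mem hx hy
  | tmul η m => exact h _ η.2 _ m.2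

theorem diffC_mem (D : GlAff n 𝕜 → B →ₗ[𝕜] B) {p : ℕ} {x : ExtS n 𝕜 ⊗[𝕜] Forms n B}
    (hx : x ∈ homC p ⊤) : diffC D x ∈ homC (p + 1) (⊤ : Submodule 𝕜 (Forms n B)) := by
  refine map_mem_of_mem_homC _ _ (fun η hη m _ => ?_) hx
  rw [diffC_tmul]
  exact sub_mem (tmul_mem_homC (deRham_mem hη) trivial)
    (sum_mem fun b _ => tmul_mem_homC (ι_mul_mem _ hη) trivial)

theorem changeC_mem (j : A →ₐ[𝕜] B) {p : ℕ} {W : Submodule 𝕜 (Forms n A)}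
    {W' : Submodule 𝕜 (Forms n B)} (h : ∀ m ∈ W, Forms.map j.toLinearMap m ∈ W')
    {x : ExtS n 𝕜 ⊗[𝕜] Forms n A} (hx : x ∈ homC p W) : changeC j x ∈ homC p W' :=
  map_mem_of_mem_homC _ _ (fun _ hη m hm => tmul_mem_homC hη (h m hm)) hx

theorem mulC_mem {p p' : ℕ} {W W' W'' : Submodule 𝕜 (Forms n B)}
    (h : ∀ m ∈ W, ∀ m' ∈ W', Forms.wedge (𝕜 := 𝕜) m m' ∈ W'')
    {x y : ExtS n 𝕜 ⊗[𝕜] Forms n B} (hx : x ∈ homC p W) (hy : y ∈ homC p' W') :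
    mulC x y ∈ homC (p + p') W'' := by
  refine map_mem_of_mem_homC (mulC.flip y) _ (fun η hη m hm => ?_) hx
  refine map_mem_of_mem_homC (mulC (η ⊗ₜ[𝕜] m)) _ (fun ζ hζ m' hm' => ?_) hy
  exact tmul_mem_homC (ext_mul_mem hη hζ) (h m hm m' hm')

/-- The subspace `B ⊗ ⋀^p s^*`. -/
def scalarExt (B : Type u) [CommRing B] [Algebra 𝕜 B] (p : ℕ) : Submodule 𝕜 (B ⊗[𝕜] ExtS n 𝕜) :=
  LinearMap.range (TensorProduct.map LinearMap.id (⋀[𝕜]^p (DualS n 𝕜)).subtype)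

theorem tmul_mul_mem_scalarExt {p : ℕ} (b : B) (θ : DualS n 𝕜) {t : B ⊗[𝕜] ExtS n 𝕜}
    (ht : t ∈ scalarExt B p) : b ⊗ₜ[𝕜] ExteriorAlgebra.ι 𝕜 θ * t ∈ scalarExt B (p + 1) := by
  obtain ⟨w, rfl⟩ := ht
  induction w with
  | zero => simp
  | add x y hx hy =>
    rw [map_add, mul_add]
    exact add_mem hx hy
  | tmul c η =>
    rw [TensorProduct.map_tmul, Algebra.TensorProduct.tmul_mul_tmul]
    exact ⟨(b * c) ⊗ₜ[𝕜] (⟨_, ι_mul_mem θ η.2⟩ : ⋀[𝕜]^(p + 1) (DualS n 𝕜)), rfl⟩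

/-- A generator is sent to `B`-combinations of generators, so each left multiplication raises the
degree by exactly one. -/
theorem coactAt_mem (g : FN n 𝕜 →ₐ[𝕜] B) {p : ℕ} {η : ExtS n 𝕜}
    (hη : η ∈ ⋀[𝕜]^p (DualS n 𝕜)) : coactAt g η ∈ scalarExt B p := by
  induction hη using Submodule.pow_induction_on_left' with
  | algebraMap r =>
    rw [AlgHom.commutes]
    refine ⟨algebraMap 𝕜 B r ⊗ₜ[𝕜] (⟨1, ?_⟩ : ⋀[𝕜]^0 (DualS n 𝕜)), rfl⟩
    rw [ExteriorAlgebra.exteriorPower, pow_zero]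
    exact Submodule.one_le.1 le_rfl
  | add x y i hx hy h1 h2 =>
    rw [map_add]
    exact add_mem h1 h2
  | mem_mul m hm i x hx h =>
    obtain ⟨θ, rfl⟩ := hm
    rw [map_mul, coactAt_ι, add_mul]
    simp only [Finset.sum_mul, smul_mul_assoc]
    exact add_mem (tmul_mul_mem_scalarExt _ _ h) (sum_mem fun i _ => sum_mem fun j _ =>
      sum_mem fun k _ => Submodule.smul_mem _ _ (tmul_mul_mem_scalarExt _ _ h))

/-- The space `W` is only a `𝕜`-subspace, so stability of `m` under multiplication by coefficients
in `B` is required separately. -/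
theorem coeffMul_mem {p : ℕ} {W : Submodule 𝕜 (Forms n B)} {m : Forms n B}
    (hm : ∀ b : B, b • m ∈ W) {t : B ⊗[𝕜] ExtS n 𝕜} (ht : t ∈ scalarExt B p) :
    coeffMul m t ∈ homC p W := by
  obtain ⟨w, rfl⟩ := ht
  induction w with
  | zero => simp
  | add x y hx hy =>
    rw [map_add, map_add]
    exact add_mem hx hy
  | tmul b η => exact tmul_mem_homC η.2 (hm b)

theorem mem_formsZero {m : Forms n B} : m ∈ formsZero n 𝕜 B ↔ m.2 = 0 := by
  rw [formsZero, LinearMap.range_inl, LinearMap.mem_ker, LinearMap.snd_apply]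

theorem mem_formsOne {m : Forms n B} : m ∈ formsOne n 𝕜 B ↔ m.1 = 0 := by
  rw [formsOne, LinearMap.range_inr, LinearMap.mem_ker, LinearMap.fst_apply]

variable [CharZero 𝕜]

theorem pullC_mem (j : A →ₐ[𝕜] B) (g : FN n 𝕜 →ₐ[𝕜] B) {p : ℕ} {W : Submodule 𝕜 (Forms n A)}
    {W' : Submodule 𝕜 (Forms n B)} (h : ∀ m ∈ W, ∀ b : B, b • Forms.pull j g m ∈ W')
    {x : ExtS n 𝕜 ⊗[𝕜] Forms n A} (hx : x ∈ homC p W) : pullC j g x ∈ homC p W' := by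
  refine map_mem_of_mem_homC _ _ (fun η hη m hm => ?_) hx
  rw [pullC_tmul]
  exact coeffMul_mem (h m hm) (coactAt_mem g hη)

theorem bN_mem {p q : ℕ} {x : Coch n 𝕜 q} (hx : x ∈ homC p ⊤) : bN q x ∈ homC p ⊤ := by
  rw [bN_eq]
  exact add_mem (add_mem (changeC_mem _ (fun _ _ => Submodule.mem_top) hx) (sum_mem fun i _ =>
    Submodule.smul_mem _ _ (changeC_mem _ (fun _ _ => Submodule.mem_top) hx)))
    (Submodule.smul_mem _ _ (pullC_mem _ _ (fun _ _ _ => Submodule.mem_top) hx))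

/-- Pull-back sends functions to functions, and a function times a one-form is a one-form. Only here
does the distinction between forms of degree zero and one play a role; the Leibniz rules hold for
all of `Ω^{≤1}` with products truncated in degree two. -/
theorem cup_mem {p q p' q' : ℕ} {x : Coch n 𝕜 q} {y : Coch n 𝕜 q'}
    (hx : x ∈ homC p (formsZero n 𝕜 _)) (hy : y ∈ homC p' (formsOne n 𝕜 _)) :
    cup q q' x y ∈ homC (p + p') (formsOne n 𝕜 _) := by
  rw [cup_eq]
  refine mulC_mem (W := formsZero n 𝕜 _) (W' := formsOne n 𝕜 _) (fun m hm m' hm' => ?_)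
    (pullC_mem _ _ (fun m hm b => ?_) hx) (changeC_mem _ (fun m hm => ?_) hy)
  · rw [mem_formsOne] at hm' ⊢
    change m.1 * m'.1 = 0
    rw [hm', mul_zero]
  · rw [mem_formsZero] at hm ⊢
    funext i
    rw [Prod.smul_snd, Forms.pull_apply, Forms.pullback_apply, Forms.map_algHom_apply, hm]
    simp only [Pi.smul_apply, Pi.zero_apply, map_zero, zero_mul, Finset.sum_const_zero, smul_zero]
  · rw [mem_formsOne] at hm ⊢
    rw [Forms.map_algHom_apply, hm]
    exact map_zero _

end Degrees

/-! ### Transfer to the direct sum of the columns -/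

section Columns

variable {n : ℕ} {𝕜 : Type u} [Field 𝕜]

theorem CZero_le_C (p q : ℕ) : CZero n 𝕜 p q ≤ C n 𝕜 p q := homogeneous_mono n 𝕜 p q le_top

theorem COne_le_C (p q : ℕ) : COne n 𝕜 p q ≤ C n 𝕜 p q := homogeneous_mono n 𝕜 p q le_top

variable [CharZero 𝕜]

theorem vertical_column (q : ℕ) (x : Coch n 𝕜 q) :
    vertical n 𝕜 (column n 𝕜 q x) = column n 𝕜 q (dCE q x) := by
  simp [vertical, DirectSum.toModule_lof]

theorem horizontal_column (q : ℕ) (x : Coch n 𝕜 q) :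
    horizontal n 𝕜 (column n 𝕜 q x) = column n 𝕜 (q + 1) (bN q x) := by
  simp [horizontal, DirectSum.toModule_lof]

theorem cupProd_column (q q' : ℕ) (x : Coch n 𝕜 q) (y : Coch n 𝕜 q') :
    cupProd n 𝕜 (column n 𝕜 q x) (column n 𝕜 q' y) = column n 𝕜 (q + q') (cup q q' x y) :=
  bilin_column _ _ _ _ _ _ _

theorem vertical_mem {p q : ℕ} {z : Bicomplex n 𝕜} (hz : z ∈ C n 𝕜 p q) :
    vertical n 𝕜 z ∈ C n 𝕜 (p + 1) q := by
  obtain ⟨x, hx, rfl⟩ := hz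
  rw [vertical_column]
  exact ⟨_, diffC_mem (fun Z => Tens.bullet n 𝕜 q Z) hx, rfl⟩

theorem horizontal_mem {p q : ℕ} {z : Bicomplex n 𝕜} (hz : z ∈ C n 𝕜 p q) :
    horizontal n 𝕜 z ∈ C n 𝕜 p (q + 1) := by
  obtain ⟨x, hx, rfl⟩ := hz
  rw [horizontal_column]
  exact ⟨_, bN_mem hx, rfl⟩

theorem cupProd_mem {p q p' q' : ℕ} {x y : Bicomplex n 𝕜} (hx : x ∈ CZero n 𝕜 p q)
    (hy : y ∈ COne n 𝕜 p' q') : cupProd n 𝕜 x y ∈ COne n 𝕜 (p + p') (q + q') := by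
  obtain ⟨x, hx, rfl⟩ := hx
  obtain ⟨y, hy, rfl⟩ := hy
  rw [cupProd_column]
  exact ⟨_, cup_mem hx hy, rfl⟩

theorem vertical_cupProd {p q p' q' : ℕ} {x y : Bicomplex n 𝕜} (hx : x ∈ C n 𝕜 p q)
    (hy : y ∈ C n 𝕜 p' q') : vertical n 𝕜 (cupProd n 𝕜 x y) =
      cupProd n 𝕜 (vertical n 𝕜 x) y + (-1 : 𝕜) ^ p • cupProd n 𝕜 x (vertical n 𝕜 y) := by
  obtain ⟨x, ⟨w, rfl⟩, rfl⟩ := hx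
  obtain ⟨y, -, rfl⟩ := hy
  rw [cupProd_column, vertical_column, vertical_column, vertical_column, cupProd_column,
    cupProd_column, dCE_cup, sgn_map, map_smul, LinearMap.smul_apply, map_add, map_smul]

theorem horizontal_cupProd {p q p' q' : ℕ} {x y : Bicomplex n 𝕜} (hx : x ∈ C n 𝕜 p q)
    (hy : y ∈ C n 𝕜 p' q') : horizontal n 𝕜 (cupProd n 𝕜 x y) =
      cupProd n 𝕜 (horizontal n 𝕜 x) y + (-1 : 𝕜) ^ q • cupProd n 𝕜 x (horizontal n 𝕜 y) := by
  obtain ⟨x, -, rfl⟩ := hx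
  obtain ⟨y, -, rfl⟩ := hy
  rw [cupProd_column, horizontal_column, horizontal_column, horizontal_column, cupProd_column,
    cupProd_column, bN_cup, map_add, map_smul, castSuccAdd, column_place_cast]
  rfl

end Columns

end HopfCyclic

end

/-! ### The total differential and its signs -/

theorem theorem4p7 {𝕜 : Type*} [Field 𝕜] [CharZero 𝕜] (n : ℕ) :
    (∀ (p q : ℕ) (z : HopfCyclic.Bicomplex n 𝕜), z ∈ HopfCyclic.C n 𝕜 p q →
      HopfCyclic.vertical n 𝕜 z ∈ HopfCyclic.C n 𝕜 (p + 1) q ∧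
        HopfCyclic.horizontal n 𝕜 z ∈ HopfCyclic.C n 𝕜 p (q + 1)) ∧
    ∀ (p q p' q' : ℕ) (x y : HopfCyclic.Bicomplex n 𝕜),
      x ∈ HopfCyclic.CZero n 𝕜 p q → y ∈ HopfCyclic.COne n 𝕜 p' q' →
      HopfCyclic.starProd n 𝕜 x y = (-1 : 𝕜) ^ (q * p') • HopfCyclic.cupProd n 𝕜 x y ∧
      HopfCyclic.starProd n 𝕜 x y ∈ HopfCyclic.COne n 𝕜 (p + p') (q + q') ∧
      (HopfCyclic.vertical n 𝕜 + (-1 : 𝕜) ^ (p + p') • HopfCyclic.horizontal n 𝕜)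
          (HopfCyclic.starProd n 𝕜 x y) =
        HopfCyclic.starProd n 𝕜
            ((HopfCyclic.vertical n 𝕜 + (-1 : 𝕜) ^ p • HopfCyclic.horizontal n 𝕜) x) y +
          (-1 : 𝕜) ^ (p + q) • HopfCyclic.starProd n 𝕜 x
            ((HopfCyclic.vertical n 𝕜 + (-1 : 𝕜) ^ p' • HopfCyclic.horizontal n 𝕜) y) := by
  refine ⟨fun p q z hz => ⟨HopfCyclic.vertical_mem hz, HopfCyclic.horizontal_mem hz⟩,
    fun p q p' q' x y hx hy => ?_⟩
  have hx' := HopfCyclic.CZero_le_C p q hx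
  have hy' := HopfCyclic.COne_le_C p' q' hy
  have hxy := HopfCyclic.starProd_eq hx' hy'
  refine ⟨hxy, ?_, ?_⟩
  · rw [hxy]
    exact Submodule.smul_mem _ _ (HopfCyclic.cupProd_mem hx hy)
  · have h : ((-1 : 𝕜) ^ q) * (-1 : 𝕜) ^ q = 1 := by rw [← mul_pow]; simp
    -- For the vertical differential of `y` the row index `p'` becomes `p' + 1`, so the product
    -- carries an extra `(-1)^q`; with the prefactor `(-1)^{p+q}` this leaves the sign `(-1)^p` of
    -- the vertical Leibniz rule.
    have h' : (-1 : 𝕜) ^ (p + q) * (-1 : 𝕜) ^ (q * (p' + 1)) =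
        (-1 : 𝕜) ^ (q * p') * (-1 : 𝕜) ^ p := by
      rw [mul_add, mul_one, pow_add, pow_add]
      linear_combination (-1 : 𝕜) ^ p * (-1 : 𝕜) ^ (q * p') * h
    simp only [LinearMap.add_apply, LinearMap.smul_apply, map_add, map_smul, hxy,
      HopfCyclic.starProd_eq (HopfCyclic.vertical_mem hx') hy',
      HopfCyclic.starProd_eq (HopfCyclic.horizontal_mem hx') hy',
      HopfCyclic.starProd_eq hx' (HopfCyclic.vertical_mem hy'),
      HopfCyclic.starProd_eq hx' (HopfCyclic.horizontal_mem hy'),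
      HopfCyclic.vertical_cupProd hx' hy', HopfCyclic.horizontal_cupProd hx' hy', smul_add,
      smul_smul, h']
    -- For the horizontal differential of `x` the column index `q` becomes `q + 1`, and the
    -- resulting `(-1)^{p'}` turns `(-1)^p` into the required `(-1)^{p+p'}`.
    rw [add_mul, one_mul, pow_add, pow_add, pow_add]
    module
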